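/- Let $\lambda$ be a Ferrers shape (English notation; box $(i,j)$ is in row $i$ and column $j$, $i,j\ge 1$), let $k$ be a positive integer, and let $n$ be such that $\lambda$ is contained in the staircase shape $(n-1,\dots,2,1)$. A north-east (south-east) chain of length $\ell$ in $\lambda$ is a sequence of $\ell$ boxes of $\lambda$ in which every box is strictly north (south) and strictly east of the preceding one and for which the smallest rectangle containing all the boxes is contained in $\lambda$. A $k$-north-east filling (resp. $k$-south-east filling) of $\lambda$ is a set of boxes of $\lambda$ (the boxes filled with $1$) containing no north-east (resp. south-east) chain of length $k+1$, of maximal cardinality with this property. Let $\mathcal F_{NE}(\lambda,k)$ and $\mathcal F_{SE}(\lambda,k)$ be the sets of these fillings. Let $\mu$ be the shape obtained from $\lambda$ by deleting its first $k$ rows and first $k$ columns. There is a unique permutation $\tau\in S_n$ with Rothe diagram $\{(i,\tau_j): i<j,\ \tau_i>\tau_j\}=\mu$; put $\sigma=\sigma_k(\lambda)=[1,\dots,k,\tau_1+k,\tau_2+k,\dots]$ (trailing fixed points are irrelevant). Let $\mathcal{RP}(\sigma)$ be the set of reduced pipe dreams for $\sigma$ in the staircase $(n-1,\dots,1)$,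 each identified with its set of crossings (any two pipes cross at most once, and the pipe ending at the left of row $i$ starts at the top of column $\sigma_i$). Let $\mathcal{CS}(\sigma)$ be the set of compatible sequences $\binom{a_1\cdots a_\ell}{b_1\cdots b_\ell}$ for $\sigma$: $a_1\le\dots\le a_\ell$; $b_i>b_{i+1}$ if $a_i=a_{i+1}$; $s_{b_1}\cdots s_{b_\ell}$ is a reduced word for $\sigma$; and $a_i\le b_i$. Let $\mathcal{FT}(\mu,k)$ be the set of $k$-flagged tableaux of shape $\mu$, i.e. semistandard tableaux with entries in row $i$ at most $i+k$. Let $\mathcal{RPP}(\mu,k)$ be the set of reverse plane partitions of shape $\mu$ with entries in $\{0,\dots,k\}$. Let $\mathrm{Fan}(\mu,k)$ be the set of $k$-tuples of north-east lattice paths, each running from the south-west to the north-east corner of the smallest rectangle containing $\mu$ with all boxes to its north-west in $\mu$, such that the $i$-th path stays weakly south-east of the $j$-th for $i<j$. Then each of the following maps is a bijection: 1. $\mathcal F_{NE}(\lambda,k)\to\mathcal{RP}(\sigma)$, $F\mapsto\lambda\setminus F$; 2. $\mathcal{RP}(\sigma)\to\mathcal{CS}(\sigma)$, which reads the column $\binom{i}{i+j-1}$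 for every crossing $(i,j)$, row by row from north to south and from east to west in each row; 3. $\mathcal{CS}(\sigma)\to\mathcal{FT}(\mu,k)$, which sends a sequence to the recording tableau, with entries $a_1,\dots,a_\ell$, of the column Edelman--Greene insertion of $b_1,\dots,b_\ell$; 4. $\mathcal{FT}(\mu,k)\to\mathcal{RPP}(\mu,k)$, which subtracts $i$ from every entry of row $i$, for all $i$; 5. $\mathcal{RPP}(\mu,k)\to\mathrm{Fan}(\mu,k)$, where the $i$-th path has exactly the entries $\le k-i$ to its north-west; 6. $\mathrm{Fan}(\mu,k)\to\mathcal F_{SE}(\lambda,k)$, which turns paths into boxes filled with $1$: with lattice point $(r,c)$, $r,c\ge 0$, denoting the point $r$ units below and $c$ units to the right of the north-west corner of $\mu$, each point $(r,c)$ of the $i$-th path gives the box $(r+k-i+1,\,c+k-i+1)$ if this box lies in $\lambda$; in addition all boxes of $\lambda$ that lie in no south-east chain of length $k+1$ are filled with $1$. Consequently the composition of these maps is an explicit bijection $\mathcal F_{NE}(\lambda,k)\to\mathcal F_{SE}(\lambda,k)$. -/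

import Mathlib

/-! Everything is numbered from `0`: rows (from north to south), columns (from west to east),
the letters permuted by a permutation, the simple transpositions `s_b = (b, b + 1)` and the
entries of tableaux. A Ferrers shape is a Young diagram in English notation; the box `(i, j)` is
the one in row `i` and column `j`. -/

namespace Fillings

/-- A box, given by its row and its column. -/
abbrev Box := ℕ × ℕ

/-! ### Chains and maximal fillings -/

/-- Every box is strictly north and strictly east of all the preceding ones. -/
def IsNE {l : ℕ} (c : Fin l → Box) : Prop :=
  ∀ a b : Fin l, a < b → (c b).1 < (c a).1 ∧ (c a).2 < (c b).2

/-- Every box is strictly south and strictly east of all the preceding ones. -/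
def IsSE {l : ℕ} (c : Fin l → Box) : Prop :=
  ∀ a b : Fin l, a < b → (c a).1 < (c b).1 ∧ (c a).2 < (c b).2

/-- The smallest rectangle containing all the boxes of a sequence. -/
def rectHull {l : ℕ} (c : Fin l → Box) : Set Box :=
  {x | (∃ a, (c a).1 ≤ x.1) ∧ (∃ a, x.1 ≤ (c a).1) ∧
       (∃ a, (c a).2 ≤ x.2) ∧ (∃ a, x.2 ≤ (c a).2)}

/-- North-east chains in the shape `lam`. -/
def IsNEChain (lam : YoungDiagram) {l : ℕ} (c : Fin l → Box) : Prop :=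
  IsNE c ∧ (∀ a, c a ∈ lam.cells) ∧ rectHull c ⊆ lam.cells

/-- South-east chains in the shape `lam`. -/
def IsSEChain (lam : YoungDiagram) {l : ℕ} (c : Fin l → Box) : Prop :=
  IsSE c ∧ (∀ a, c a ∈ lam.cells) ∧ rectHull c ⊆ lam.cells

/-- A `(0,1)`-filling, identified with its set `F` of boxes filled with `1`, that has no
north-east chain of `1`s of length `k + 1`. -/
def AvoidsNE (lam : YoungDiagram) (k : ℕ) (F : Finset Box) : Prop :=
  F ⊆ lam.cells ∧ ¬ ∃ c : Fin (k + 1) → Box, IsNEChain lam c ∧ ∀ a, c a ∈ F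

/-- The same for south-east chains. -/
def AvoidsSE (lam : YoungDiagram) (k : ℕ) (F : Finset Box) : Prop :=
  F ⊆ lam.cells ∧ ¬ ∃ c : Fin (k + 1) → Box, IsSEChain lam c ∧ ∀ a, c a ∈ F

/-- The `k`-north-east fillings: the number of `1`s is maximal. -/
def neFillings (lam : YoungDiagram) (k : ℕ) : Set (Finset Box) :=
  {F | AvoidsNE lam k F ∧ ∀ G, AvoidsNE lam k G → G.card ≤ F.card}

/-- The `k`-south-east fillings: the number of `1`s is maximal. -/
def seFillings (lam : YoungDiagram) (k : ℕ) : Set (Finset Box) :=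
  {F | AvoidsSE lam k F ∧ ∀ G, AvoidsSE lam k G → G.card ≤ F.card}

/-! ### Pipe dreams -/

/-- The staircase shape `(n - 1, …, 2, 1)`. -/
def staircase (n : ℕ) : Finset Box :=
  (Finset.range n ×ˢ Finset.range n).filter (fun x => x.1 + x.2 + 1 < n)

/-- The side through which a pipe enters a box. -/
inductive Side where
  | top
  | right

/-- `Enters D p s i j`: in the pipe dream with set of crossings `D` (all other boxes contain two
turning pipes), the pipe that starts at the top of column `p` enters the box `(i, j)` through its
side `s`. Pipes run from the top to the left: at a turn, a pipe that comes in through the top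
leaves through the left, and one that comes in through the right leaves through the bottom. -/
inductive Enters (D : Finset Box) (p : ℕ) : Side → ℕ → ℕ → Prop
  | start : Enters D p Side.top 0 p
  | straightDown {i j : ℕ} : Enters D p Side.top i j → (i, j) ∈ D → Enters D p Side.top (i + 1) j
  | turnDown {i j : ℕ} : Enters D p Side.right i j → (i, j) ∉ D → Enters D p Side.top (i + 1) j
  | straightLeft {i j : ℕ} :
      Enters D p Side.right i (j + 1) → (i, j + 1) ∈ D → Enters D p Side.right i j
  | turnLeft {i j : ℕ} :
      Enters D p Side.top i (j + 1) → (i, j + 1) ∉ D → Enters D p Side.right i j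

/-- The pipe that starts at the top of column `p` ends at the left of row `i`. -/
def EndsAt (D : Finset Box) (p i : ℕ) : Prop :=
  (Enters D p Side.top i 0 ∧ (i, 0) ∉ D) ∨ (Enters D p Side.right i 0 ∧ (i, 0) ∈ D)

/-- The pipes `p` and `q` cross in the box `x`. -/
def CrossIn (D : Finset Box) (p q : ℕ) (x : Box) : Prop :=
  x ∈ D ∧ ((Enters D p Side.top x.1 x.2 ∧ Enters D q Side.right x.1 x.2) ∨
    (Enters D q Side.top x.1 x.2 ∧ Enters D p Side.right x.1 x.2))

/-- Any two pipes cross at most once. -/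
def IsReduced (D : Finset Box) : Prop :=
  ∀ p q : ℕ, p ≠ q → ∀ x y : Box, CrossIn D p q x → CrossIn D p q y → x = y

/-- The reduced pipe dreams of size `n` for the permutation `σ`: reading the starting columns of
the pipes at the left from top to bottom gives the one-line notation of `σ`. -/
def reducedPipeDreams (n : ℕ) (σ : Equiv.Perm ℕ) : Set (Finset Box) :=
  {D | D ⊆ staircase n ∧ IsReduced D ∧ ∀ i, EndsAt D (σ i) i}

/-! ### The permutation attached to a shape -/

/-- The Rothe diagram of a permutation. -/
def rotheDiagram (σ : Equiv.Perm ℕ) : Set Box :=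
  {x | ∃ i j : ℕ, i < j ∧ σ j < σ i ∧ x = (i, σ j)}

/-- `τ` is a permutation in `S_n` (it fixes everything from `n` on) with diagram `μ`. -/
def IsDominantOf (n : ℕ) (μ : YoungDiagram) (τ : Equiv.Perm ℕ) : Prop :=
  (∀ m, n ≤ m → τ m = m) ∧ rotheDiagram τ = (μ.cells : Set Box)

/-- The permutation `1_k × τ`, i.e. `[1, …, k, τ_1 + k, τ_2 + k, …]` in one-line notation. -/
def shiftPerm (k : ℕ) (τ : Equiv.Perm ℕ) : Equiv.Perm ℕ where
  toFun m := if m < k then m else τ (m - k) + k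
  invFun m := if m < k then m else τ.symm (m - k) + k
  left_inv m := by
    by_cases h : m < k
    · simp [h]
    · simp only [h, if_false]
      have : ¬ (τ (m - k) + k < k) := by omega
      simp only [this, if_false, Nat.add_sub_cancel, Equiv.symm_apply_apply]
      omega
  right_inv m := by
    by_cases h : m < k
    · simp [h]
    · simp only [h, if_false]
      have : ¬ (τ.symm (m - k) + k < k) := by omega
      simp only [this, if_false, Nat.add_sub_cancel, Equiv.apply_symm_apply]
      omega

/-- The shape obtained from `lam` by removing its first `k` rows and its first `k` columns. -/
def removeHook (lam : YoungDiagram) (k : ℕ) : YoungDiagram where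
  cells := (lam.cells.filter fun x => k ≤ x.1 ∧ k ≤ x.2).image fun x => (x.1 - k, x.2 - k)
  isLowerSet := by
    intro x y hyx hx
    obtain ⟨z, hz, rfl⟩ := Finset.mem_image.1 (Finset.mem_coe.1 hx)
    obtain ⟨hz, h1, h2⟩ := Finset.mem_filter.1 hz
    have h3 : y.1 ≤ z.1 - k := hyx.1
    have h4 : y.2 ≤ z.2 - k := hyx.2
    refine Finset.mem_coe.2 (Finset.mem_image.2 ⟨(y.1 + k, y.2 + k), ?_, ?_⟩)
    · refine Finset.mem_filter.2 ⟨?_, Nat.le_add_left _ _, Nat.le_add_left _ _⟩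
      refine Finset.mem_coe.1 (lam.isLowerSet (a := z) (Prod.mk_le_mk.2 ⟨?_, ?_⟩) hz) <;> omega
    · simp

/-! ### The reading biword and compatible sequences -/

/-- The reading biword of a pipe dream of size `n`: row by row from north to south, and from east
to west inside a row, the column `(i, i + j)` is read for every crossing `(i, j)`. -/
def readingBiword (n : ℕ) (D : Finset Box) : List (ℕ × ℕ) :=
  (List.range n).flatMap fun i =>
    ((List.range n).reverse.filter (fun j => (i, j) ∈ D)).map fun j => (i, i + j)

/-- The product `s_{b_1} s_{b_2} ⋯` of simple transpositions. -/
def wordProd (w : List ℕ) : Equiv.Perm ℕ :=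
  (w.map fun b => Equiv.swap b (b + 1)).prod

/-- Reduced words: words of minimal length for their product. -/
def IsReducedWord (w : List ℕ) (σ : Equiv.Perm ℕ) : Prop :=
  wordProd w = σ ∧ ∀ v : List ℕ, wordProd v = σ → w.length ≤ v.length

/-- The compatible sequences for `σ`, as lists of columns `(a, b)`. -/
def compatibleSequences (σ : Equiv.Perm ℕ) : Set (List (ℕ × ℕ)) :=
  {t | t.IsChain (fun u v => u.1 ≤ v.1) ∧
       t.IsChain (fun u v => u.1 = v.1 → v.2 < u.2) ∧
       IsReducedWord (t.map Prod.snd) σ ∧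
       ∀ u ∈ t, u.1 ≤ u.2}

/-! ### Column Edelman–Greene insertion -/

/-- Insert `x` into a strictly increasing column. Let `y` be the smallest entry larger than `x`. If
there is none, append `x`. If `y = x + 1` and `x` is in the column, leave the column unchanged, and
otherwise replace `y` by `x`; in both cases `y` is to be inserted into the next column. -/
def egColumn (x : ℕ) : List ℕ → List ℕ × Option ℕ
  | [] => ([x], none)
  | y :: C =>
    if x < y then (x :: C, some y)
    else if y = x ∧ C.head? = some (x + 1) then (y :: C, some (x + 1))
    else (y :: (egColumn x C).1, (egColumn x C).2)

/-- Insert `x` into a tableau, given as the list of its columns; the second component of the result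
is the new box. -/
def egInsert (x : ℕ) : List (List ℕ) → List (List ℕ) × Box
  | [] => ([[x]], (0, 0))
  | C :: P =>
    match egColumn x C with
    | (E, none) => (E :: P, (C.length, 0))
    | (E, some y) => (E :: (egInsert y P).1, ((egInsert y P).2.1, (egInsert y P).2.2 + 1))

/-- A tableau, as a partial function: `none` outside of its shape. -/
abbrev Tableau := Box → Option ℕ

/-- Insert `b` into the insertion tableau `PQ.1` and write `a` into the new box of the recording
tableau `PQ.2`. -/
def egStep (PQ : List (List ℕ) × Tableau) (ab : ℕ × ℕ) : List (List ℕ) × Tableau :=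
  ((egInsert ab.2 PQ.1).1, Function.update PQ.2 (egInsert ab.2 PQ.1).2 (some ab.1))

/-- The recording tableau `Q(t)`. -/
def recordingTableau (t : List (ℕ × ℕ)) : Tableau :=
  (t.foldl egStep ([], fun _ => none)).2

/-- The `k`-flagged tableaux of shape `μ`: semistandard tableaux with entries at most `i + k` in
row `i`. -/
def flaggedTableaux (μ : YoungDiagram) (k : ℕ) : Set Tableau :=
  {T | ∃ S : SemistandardYoungTableau μ, (∀ x ∈ μ.cells, S x.1 x.2 ≤ x.1 + k) ∧
    T = fun x => if x ∈ μ.cells then some (S x.1 x.2) else none}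

/-! ### Reverse plane partitions, fans of paths and south-east fillings -/

/-- The reverse plane partitions of shape `μ` and height `k`: entries in `{0, …, k}`, weakly
increasing along rows and columns. -/
def reversePlanePartitions (μ : YoungDiagram) (k : ℕ) : Set Tableau :=
  {R | (∀ x, (R x).isSome = true ↔ x ∈ μ.cells) ∧
       (∀ x m, R x = some m → m ≤ k) ∧
       ∀ x y m l, x ≤ y → R x = some m → R y = some l → m ≤ l}

/-- Subtract `i` from all entries in row `i`. -/
def subtractRows (T : Tableau) : Tableau :=
  fun x => (T x).map (fun m => m - x.1)

/-- North-east lattice paths inside `μ`, as lists of lattice points: they go from the south-west to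
the north-east corner of the smallest rectangle containing `μ`, by unit north and east steps, and
all boxes to the north-west of the path belong to `μ`. The lattice point `(i, j)` is the north-west
corner of the box `(i, j)`. -/
def IsPathInside (μ : YoungDiagram) (p : List (ℕ × ℕ)) : Prop :=
  p.head? = some (μ.colLen 0, 0) ∧ p.getLast? = some (0, μ.rowLen 0) ∧
  p.IsChain (fun u v => (u.1 = v.1 + 1 ∧ u.2 = v.2) ∨ (u.1 = v.1 ∧ v.2 = u.2 + 1)) ∧
  ∀ i j : ℕ, (i + 1, j + 1) ∈ p → (i, j) ∈ μ.cells

/-- The `k`-fans of noncrossing paths inside `μ`, numbered from the bottom: a path with a smaller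
number stays weakly south-east of one with a larger number (they may share points and edges). -/
def fans (μ : YoungDiagram) (k : ℕ) : Set (Fin k → List (ℕ × ℕ)) :=
  {f | (∀ i, IsPathInside μ (f i)) ∧
       ∀ i j, i < j → List.Forall₂ (fun u v => v.1 ≤ u.1) (f i) (f j)}

/-- From the given lattice point, walk the given number of steps along the south-east boundary of
the set of boxes `N`: an east step if the box to the north-east of the current point belongs to `N`
(or if the top has been reached), and a north step otherwise. -/
def boundaryWalk (N : Box → Bool) : ℕ → ℕ × ℕ → List (ℕ × ℕ)
  | 0, u => [u]
  | s + 1, (0, j) => (0, j) :: boundaryWalk N s (0, j + 1)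
  | s + 1, (i + 1, j) =>
    (i + 1, j) :: boundaryWalk N s (if N (i, j) then (i + 1, j + 1) else (i, j))

/-- The fan of paths of a reverse plane partition: the path with number `i` separates the entries
smaller than `k - i`, to its north-west, from the other entries. -/
def fanOfRPP (μ : YoungDiagram) (k : ℕ) (R : Tableau) : Fin k → List (ℕ × ℕ) :=
  fun i => boundaryWalk (fun x => (R x).any (fun m => decide (m + i < k)))
    (μ.colLen 0 + μ.rowLen 0) (μ.colLen 0, 0)

/-- The boxes of `lam` that are in no south-east chain of length `k + 1`. -/
noncomputable def passiveBoxes (lam : YoungDiagram) (k : ℕ) : Finset Box :=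
  open Classical in
  lam.cells.filter fun x => ¬ ∃ c : Fin (k + 1) → Box, IsSEChain lam c ∧ ∃ a, c a = x

/-- Turn a fan of paths into a filling of `lam`: lattice points become boxes, where the bottom path
is placed with `(0, 0)` at the box `(k - 1, k - 1)` and each further path one diagonal step
further to the north-west; the boxes contained in every filling are added. -/
noncomputable def fillingOfFan (lam : YoungDiagram) (k : ℕ) (f : Fin k → List (ℕ × ℕ)) :
    Finset Box :=
  passiveBoxes lam k ∪
    lam.cells.filter fun x =>
      ∃ i : Fin k, ∃ u ∈ f i, x = (u.1 + (k - 1 - i), u.2 + (k - 1 - i))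

/-! ### The whole map -/

/-- The complementary map. -/
def complementary (lam : YoungDiagram) (F : Finset Box) : Finset Box :=
  lam.cells \ F

/-- The composition of all the maps. -/
noncomputable def neToSe (n : ℕ) (lam : YoungDiagram) (k : ℕ) (F : Finset Box) : Finset Box :=
  fillingOfFan lam k (fanOfRPP (removeHook lam k) k (subtractRows (recordingTableau
    (readingBiword n (complementary lam F)))))

end Fillings

/-!
The six maps are shown to be bijections one after the other. Let `μ` be the shape without its first
`k` rows and columns, `τ` its dominant permutation, and `σ = 1_k × τ`. All arguments about
permutations are phrased with words in the simple transpositions: a word has minimal length exactly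
if every letter exchanges an ascent of the product so far (`red_iff_asc`), and the columns of a
compatible sequence lie to the north-west of the boxes of the Rothe diagram
(`exists_rothe_of_mem`).

* A permutation is determined by its Rothe diagram (`eq_of_rotheDiagram_eq`), and the column reading
  word of the tableau with entries `i + j` represents a permutation with Rothe diagram `μ`
  (`rotheDiagram_dominantPerm`).
* Complements of north-east fillings. The Demazure product of the reading word of a pipe dream
  records the lengths of the longest north-east chains of turning boxes: the number of values below
  `c` among the first `x` positions is the length of the longest chain in the first `x` rows and `c`
  columns (`rankFn_demazure_readingBiword`). Hence a filling has no chain of length `k + 1` if and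
  only if the Demazure product of its complement satisfies certain rank conditions
  (`avoidsNE_iff`). A permutation that satisfies them has at least as many inversions as `μ` has
  boxes, and `σ` is the only one with equality (`card_le_invNum`, `eq_of_invNum_eq`). So the
  complements of the maximal fillings are the reduced pipe dreams of `σ` (`bijOn_complementary`).
* Compatible sequences. The pipes that meet in a box are read off from the product of the word up to
  this box (`enters_iff`). Therefore a pipe dream is reduced if and only if its word is
  (`isReduced_iff`).
* Flagged tableaux. Column insertion preserves the product of the column reading word
  (`insertSpec_egInsert`), is invertible (`egInsert_inj`, `exists_egInsert_eq`), and the new boxes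
  move to the left or to the right according to the comparison of consecutive letters
  (`col_egInsert_egInsert`). There is only one insertion tableau for `σ`
  (`IsTab.eq_minTab_colLens`): its reversed column reading word belongs to a compatible sequence for
  the inverse of `σ`, so that each entry is bounded in terms of the Rothe diagram. The flag
  condition and the condition `a ≤ b` are matched in `flag_le` and `newBox_le`.
* Reverse plane partitions and fans. Subtracting the row numbers is invertible since columns are
  strictly increasing, and a path is the same as the subshape of boxes to its north-west
  (`IsPathInside.eq_fullWalk`, `nwRegion_fullWalk`), so that a fan is the same as a decreasing sequence of subshapes.
* South-east fillings. Each diagonal is a chain, so a filling without chains of length `k + 1` has at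
  most `k` boxes on it; the maximal fillings attain this bound on every diagonal with more than `k`
  boxes and contain all the shorter diagonals (`mem_seFillings`). Reading the `a`-th boxes of all
  long diagonals gives a path, since otherwise `a + 1` boxes of one diagonal and `k - a` boxes of
  another one would form a chain (`isSubshape_fillingRegion`).
-/

namespace Fillings

/-! ### Words in the simple transpositions and their inversions -/

theorem wordProd_nil : wordProd [] = 1 := rfl

theorem wordProd_cons (b : ℕ) (w : List ℕ) :
    wordProd (b :: w) = Equiv.swap b (b + 1) * wordProd w := by
  simp [wordProd]

theorem wordProd_append (u v : List ℕ) : wordProd (u ++ v) = wordProd u * wordProd v := by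
  simp [wordProd]

theorem wordProd_concat (u : List ℕ) (b : ℕ) :
    wordProd (u ++ [b]) = wordProd u * Equiv.swap b (b + 1) := by
  simp [wordProd]

theorem wordProd_reverse (w : List ℕ) : wordProd w.reverse = (wordProd w)⁻¹ := by
  induction w with
  | nil => simp [wordProd]
  | cons b w ih => rw [List.reverse_cons, wordProd_concat, ih, wordProd_cons, mul_inv_rev,
      Equiv.swap_inv]

/-- The inversions of a permutation, recorded as pairs of values `p < q` such that `q` comes
before `p` in one-line notation. -/
def valueInv (f : Equiv.Perm ℕ) : Set (ℕ × ℕ) :=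
  {x | x.1 < x.2 ∧ f.symm x.2 < f.symm x.1}

/-- The number of inversions (junk value `0` if there are infinitely many). -/
noncomputable def invNum (f : Equiv.Perm ℕ) : ℕ := (valueInv f).ncard

theorem valueInv_one : valueInv 1 = ∅ := by
  ext ⟨p, q⟩
  simp only [valueInv, Set.mem_ofPred_eq, Set.mem_empty_iff_false, iff_false, not_and]
  intro h
  change ¬ q < p
  omega

theorem valueInv_mul_swap {f : Equiv.Perm ℕ} {b : ℕ} (h : f b < f (b + 1)) :
    valueInv (f * Equiv.swap b (b + 1)) = insert (f b, f (b + 1)) (valueInv f) := by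
  ext ⟨p, q⟩
  obtain ⟨i, rfl⟩ := f.surjective p
  obtain ⟨j, rfl⟩ := f.surjective q
  have e : ∀ m, (f * Equiv.swap b (b + 1)).symm (f m) = Equiv.swap b (b + 1) m := by
    intro m
    rw [Equiv.symm_apply_eq]
    simp
  simp only [valueInv, Set.mem_ofPred_eq, Set.mem_insert_iff, Prod.mk.injEq, e,
    Equiv.symm_apply_apply, f.injective.eq_iff]
  rw [Equiv.swap_apply_def, Equiv.swap_apply_def]
  split_ifs <;> subst_vars <;> omega

theorem valueInv_notMem {f : Equiv.Perm ℕ} {b : ℕ} : (f b, f (b + 1)) ∉ valueInv f := by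
  simp [valueInv]

theorem mul_swap_mul_swap (f : Equiv.Perm ℕ) (a b : ℕ) :
    f * Equiv.swap a b * Equiv.swap a b = f := by
  rw [mul_assoc, Equiv.swap_mul_self, mul_one]

theorem valueInv_mul_swap_of_gt {f : Equiv.Perm ℕ} {b : ℕ} (h : f (b + 1) < f b) :
    valueInv f = insert (f (b + 1), f b) (valueInv (f * Equiv.swap b (b + 1))) := by
  have := valueInv_mul_swap (f := f * Equiv.swap b (b + 1)) (b := b) (by simpa using h)
  rw [mul_swap_mul_swap] at this
  simpa using this

theorem valueInv_finite (w : List ℕ) : (valueInv (wordProd w)).Finite := by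
  induction w using List.reverseRecOn with
  | nil => simp [wordProd_nil, valueInv_one]
  | append_singleton w b ih =>
    rw [wordProd_concat]
    rcases lt_trichotomy (wordProd w b) (wordProd w (b + 1)) with h | h | h
    · rw [valueInv_mul_swap h]
      exact ih.insert _
    · have := (wordProd w).injective h
      omega
    · rw [valueInv_mul_swap_of_gt h] at ih
      exact ih.subset (Set.subset_insert _ _)

theorem invNum_concat_of_lt {w : List ℕ} {b : ℕ} (h : wordProd w b < wordProd w (b + 1)) :
    invNum (wordProd (w ++ [b])) = invNum (wordProd w) + 1 := by
  rw [wordProd_concat, invNum, valueInv_mul_swap h,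
    Set.ncard_insert_of_notMem valueInv_notMem (valueInv_finite w), invNum]

theorem invNum_concat_of_gt {w : List ℕ} {b : ℕ} (h : wordProd w (b + 1) < wordProd w b) :
    invNum (wordProd (w ++ [b])) + 1 = invNum (wordProd w) := by
  have h2 := invNum_concat_of_lt (w := w ++ [b]) (b := b) (by simpa [wordProd_concat] using h)
  rw [← h2, wordProd_concat, wordProd_concat, mul_swap_mul_swap]

theorem wordProd_succ_lt_or_gt (w : List ℕ) (b : ℕ) :
    wordProd w b < wordProd w (b + 1) ∨ wordProd w (b + 1) < wordProd w b := by
  rcases lt_trichotomy (wordProd w b) (wordProd w (b + 1)) with h | h | h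
  · exact Or.inl h
  · have := (wordProd w).injective h
    omega
  · exact Or.inr h

/-- A word of minimal length for its product. -/
def Red (w : List ℕ) : Prop := ∀ v : List ℕ, wordProd v = wordProd w → w.length ≤ v.length

theorem isReducedWord_iff {w : List ℕ} {σ : Equiv.Perm ℕ} :
    IsReducedWord w σ ↔ wordProd w = σ ∧ Red w := by
  constructor
  · rintro ⟨rfl, h⟩
    exact ⟨rfl, h⟩
  · rintro ⟨rfl, h⟩
    exact ⟨rfl, h⟩

/-- Every letter exchanges an ascent of the product of the letters before it. -/
def Asc (w : List ℕ) : Prop :=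
  ∀ u b v, w = u ++ b :: v → wordProd u b < wordProd u (b + 1)

theorem Asc.left {u v : List ℕ} (h : Asc (u ++ v)) : Asc u := by
  rintro x b y rfl
  exact h x b (y ++ v) (by simp)

theorem Asc.invNum_eq {w : List ℕ} (h : Asc w) : invNum (wordProd w) = w.length := by
  induction w using List.reverseRecOn with
  | nil => simp [wordProd_nil, valueInv_one, invNum]
  | append_singleton w b ih =>
    rw [invNum_concat_of_lt (h w b [] rfl), ih h.left]
    simp

theorem invNum_le_length (w : List ℕ) : invNum (wordProd w) ≤ w.length := by
  induction w using List.reverseRecOn with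
  | nil => simp [wordProd_nil, valueInv_one, invNum]
  | append_singleton w b ih =>
    rw [List.length_append, List.length_singleton]
    rcases wordProd_succ_lt_or_gt w b with h | h
    · rw [invNum_concat_of_lt h]
      omega
    · have := invNum_concat_of_gt h
      omega

theorem asc_of_invNum_eq {w : List ℕ} (h : invNum (wordProd w) = w.length) : Asc w := by
  induction w using List.reverseRecOn with
  | nil => 
    intro u b v huv
    simp at huv
  | append_singleton w b ih =>
    have h1 := invNum_le_length w
    rw [List.length_append, List.length_singleton] at h
    rcases wordProd_succ_lt_or_gt w b with hb | hb
    · rw [invNum_concat_of_lt hb] at h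
      intro u c v huv
      rcases List.eq_nil_or_concat v with rfl | ⟨v, d, rfl⟩
      · obtain ⟨rfl, h3⟩ := List.append_inj' huv rfl
        simp only [List.cons.injEq, and_true] at h3
        exact h3 ▸ hb
      · have : w ++ [b] = (u ++ c :: v) ++ [d] := by simpa using huv
        obtain ⟨h2, -⟩ := List.append_inj' this rfl
        exact ih (by omega) u c v h2
    · have := invNum_concat_of_gt hb
      omega

/-- Sorting: a product of simple transpositions is the product of a word whose length is the
number of its inversions. -/
theorem exists_word_length_eq_invNum (w : List ℕ) :
    ∃ v, wordProd v = wordProd w ∧ v.length = invNum (wordProd w) := by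
  induction hn : invNum (wordProd w) using Nat.strong_induction_on generalizing w with
  | _ n ih =>
  by_cases hd : ∃ b, wordProd w (b + 1) < wordProd w b
  · obtain ⟨b, hb⟩ := hd
    have h1 := invNum_concat_of_gt hb
    obtain ⟨v, hv, hl⟩ := ih _ (by omega) (w ++ [b]) rfl
    refine ⟨v ++ [b], ?_, ?_⟩
    · rw [wordProd_concat, hv, wordProd_concat, mul_swap_mul_swap]
    · rw [List.length_append, hl, List.length_singleton]
      omega
  · have hm : StrictMono (wordProd w) := strictMono_nat_of_lt_succ fun b =>
      (wordProd_succ_lt_or_gt w b).resolve_right fun h => hd ⟨b, h⟩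
    have h1 : wordProd w = 1 := by
      have : (hm.orderIsoOfSurjective _ (wordProd w).surjective) = OrderIso.refl ℕ :=
        Subsingleton.elim _ _
      ext m
      exact congrArg (fun e : ℕ ≃o ℕ => e m) this
    refine ⟨[], by rw [h1, wordProd_nil], ?_⟩
    rw [← hn, h1, invNum, valueInv_one]
    simp

theorem red_iff_invNum_eq {w : List ℕ} : Red w ↔ invNum (wordProd w) = w.length := by
  constructor
  · intro h
    obtain ⟨v, hv, hl⟩ := exists_word_length_eq_invNum w
    have := h v hv
    have := invNum_le_length w
    omega
  · intro h v hv
    rw [← h, ← hv]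
    exact invNum_le_length v

/-- The two descriptions of reduced words: minimal length, and never undoing an inversion. -/
theorem red_iff_asc {w : List ℕ} : Red w ↔ Asc w :=
  red_iff_invNum_eq.trans ⟨asc_of_invNum_eq, Asc.invNum_eq⟩

theorem Red.left {u v : List ℕ} (h : Red (u ++ v)) : Red u := by
  intro x hx
  have := h (x ++ v) (by rw [wordProd_append, wordProd_append, hx])
  simp only [List.length_append] at this
  omega

theorem Red.right {u v : List ℕ} (h : Red (u ++ v)) : Red v := by
  intro x hx
  have := h (u ++ x) (by rw [wordProd_append, wordProd_append, hx])
  simp only [List.length_append] at this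
  omega

theorem Red.congr {u v : List ℕ} (h : Red u) (hp : wordProd v = wordProd u)
    (hl : v.length = u.length) : Red v := by
  intro x hx
  rw [hl]
  exact h x (hx.trans hp)

theorem Red.reverse {w : List ℕ} (h : Red w) : Red w.reverse := by
  intro v hv
  have := h v.reverse (by rw [wordProd_reverse, hv, wordProd_reverse, inv_inv])
  simpa using this

theorem not_red_cons_cons (b : ℕ) : ¬ Red [b, b] := by
  intro h
  have := h [] (by simp [wordProd])
  simp at this

/-- In a reduced word inversions are never undone. -/
theorem Asc.valueInv_subset {u v : List ℕ} (h : Asc (u ++ v)) :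
    valueInv (wordProd u) ⊆ valueInv (wordProd (u ++ v)) := by
  induction v using List.reverseRecOn with
  | nil => simp
  | append_singleton v b ih =>
    rw [← List.append_assoc] at h ⊢
    rw [wordProd_concat, valueInv_mul_swap (h _ b [] rfl)]
    exact (ih h.left).trans (Set.subset_insert _ _)

theorem Asc.mem_valueInv {u v : List ℕ} {b : ℕ} (h : Asc (u ++ b :: v)) :
    (wordProd u b, wordProd u (b + 1)) ∈ valueInv (wordProd (u ++ b :: v)) := by
  have h1 : u ++ b :: v = (u ++ [b]) ++ v := by simp
  have h2 := h u b v rfl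
  rw [h1] at h ⊢
  apply h.valueInv_subset
  rw [wordProd_concat, valueInv_mul_swap h2]
  exact Set.mem_insert _ _

/-- Every inversion is created by some letter. -/
theorem exists_letter_of_mem_valueInv {w : List ℕ} {p q : ℕ}
    (h : (p, q) ∈ valueInv (wordProd w)) :
    ∃ u b v, w = u ++ b :: v ∧ wordProd u b = p ∧ wordProd u (b + 1) = q := by
  induction w using List.reverseRecOn with
  | nil => simp [wordProd_nil, valueInv_one] at h
  | append_singleton w b ih =>
    have key : (p, q) ∈ valueInv (wordProd w) ∨ (p, q) = (wordProd w b, wordProd w (b + 1)) := by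
      rw [wordProd_concat] at h
      rcases wordProd_succ_lt_or_gt w b with hb | hb
      · rw [valueInv_mul_swap hb] at h
        exact h.symm
      · left
        rw [valueInv_mul_swap_of_gt hb]
        exact Set.mem_insert_of_mem _ h
    rcases key with h | h
    · obtain ⟨u, c, v, rfl, hp, hq⟩ := ih h
      exact ⟨u, c, v ++ [b], by simp, hp, hq⟩
    · simp only [Prod.mk.injEq] at h
      exact ⟨w, b, [], rfl, h.1.symm, h.2.symm⟩

theorem wordProd_apply_of_lt {w : List ℕ} {β m : ℕ} (h : ∀ b ∈ w, β ≤ b) (hm : m < β) :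
    wordProd w m = m := by
  induction w with
  | nil => simp [wordProd_nil]
  | cons b w ih =>
    have hb := h b (by simp)
    rw [wordProd_cons, Equiv.Perm.mul_apply, ih fun c hc => h c (by simp [hc]),
      Equiv.swap_apply_of_ne_of_ne] <;> omega

theorem wordProd_apply_of_gt {w : List ℕ} {β m : ℕ} (h : ∀ b ∈ w, b < β) (hm : β < m) :
    wordProd w m = m := by
  induction w with
  | nil => simp [wordProd_nil]
  | cons b w ih =>
    have hb := h b (by simp)
    rw [wordProd_cons, Equiv.Perm.mul_apply, ih fun c hc => h c (by simp [hc]),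
      Equiv.swap_apply_of_ne_of_ne] <;> omega

theorem wordProd_symm_apply_of_lt {w : List ℕ} {β m : ℕ} (h : ∀ b ∈ w, β ≤ b) (hm : m < β) :
    (wordProd w).symm m = m := by
  rw [Equiv.symm_apply_eq, wordProd_apply_of_lt h hm]

theorem le_wordProd_symm_apply {w : List ℕ} {β m : ℕ} (h : ∀ b ∈ w, β ≤ b) (hm : β ≤ m) :
    β ≤ (wordProd w).symm m := by
  by_contra hlt
  push Not at hlt
  have := wordProd_apply_of_lt h hlt
  rw [Equiv.apply_symm_apply] at this
  omega

/-- A reduced word of a permutation that fixes the numbers below `k` has no letter below `k`. -/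
theorem Red.le_of_mem {w : List ℕ} {k : ℕ} (h : Red w) (hf : ∀ m < k, wordProd w m = m) :
    ∀ b ∈ w, k ≤ b := by
  by_contra hc
  push Not at hc
  have hex : ∃ b, b ∈ w ∧ b < k := hc
  classical
  obtain ⟨hbw, hbk⟩ := Nat.find_spec hex
  set b := Nat.find hex with hb
  have hmin : ∀ c ∈ w, b ≤ c := by
    intro c hcw
    by_contra hlt
    exact Nat.find_min hex (m := c) (by omega) ⟨hcw, by omega⟩
  obtain ⟨u, v, huv, hbu⟩ := List.eq_append_cons_of_mem hbw
  have hu : ∀ c ∈ u, b + 1 ≤ c := by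
    intro c hcu
    have h1 := hmin c (by rw [huv]; simp [hcu])
    have h2 : c ≠ b := fun h => hbu (h ▸ hcu)
    omega
  have hA := red_iff_asc.1 h
  rw [huv] at hA
  have h1 := hA.mem_valueInv
  rw [wordProd_apply_of_lt hu (Nat.lt_succ_self b), ← huv] at h1
  obtain ⟨h2, h3⟩ := h1
  simp only at h2 h3
  set q := wordProd u (b + 1)
  have h4 : (wordProd w).symm b = b := by rw [Equiv.symm_apply_eq, hf b hbk]
  rw [h4] at h3
  have h5 := hf _ (h3.trans hbk)
  rw [Equiv.apply_symm_apply] at h5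
  omega

/-! ### Rothe diagrams -/

theorem mem_rotheDiagram {σ : Equiv.Perm ℕ} {i v : ℕ} :
    (i, v) ∈ rotheDiagram σ ↔ v < σ i ∧ i < σ.symm v := by
  constructor
  · rintro ⟨a, b, h1, h2, h3⟩
    simp only [Prod.mk.injEq] at h3
    obtain ⟨rfl, rfl⟩ := h3
    exact ⟨h2, by simpa using h1⟩
  · rintro ⟨h1, h2⟩
    exact ⟨i, σ.symm v, h2, by simpa using h1, by simp⟩

theorem rotheDiagram_eq_image (σ : Equiv.Perm ℕ) :
    rotheDiagram σ = (fun x : ℕ × ℕ => (σ.symm x.2, x.1)) '' valueInv σ := by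
  ext ⟨i, v⟩
  rw [mem_rotheDiagram]
  constructor
  · rintro ⟨h1, h2⟩
    exact ⟨(v, σ i), ⟨h1, by simpa using h2⟩, by simp⟩
  · rintro ⟨⟨p, q⟩, ⟨h1, h2⟩, h3⟩
    simp only [Prod.mk.injEq] at h1 h2 h3
    obtain ⟨rfl, rfl⟩ := h3
    exact ⟨by simpa using h1, h2⟩

theorem ncard_rotheDiagram (σ : Equiv.Perm ℕ) : (rotheDiagram σ).ncard = invNum σ := by
  rw [rotheDiagram_eq_image, invNum]
  apply Set.ncard_image_of_injective
  rintro ⟨p, q⟩ ⟨p', q'⟩ h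
  simp only [Prod.mk.injEq, EmbeddingLike.apply_eq_iff_eq] at h
  rw [h.1, h.2]

theorem rotheDiagram_finite (w : List ℕ) : (rotheDiagram (wordProd w)).Finite := by
  rw [rotheDiagram_eq_image]
  exact (valueInv_finite w).image _

/-- A permutation is determined by its Rothe diagram: at the first position where two permutations
differ, the smaller value is in the row of one diagram only. -/
theorem eq_of_rotheDiagram_eq {f g : Equiv.Perm ℕ} (h : rotheDiagram f = rotheDiagram g) :
    f = g := by
  have key : ∀ f g : Equiv.Perm ℕ, rotheDiagram f = rotheDiagram g → ∀ i, (∀ m < i, f m = g m) →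
      g i ≤ f i := by
    intro f g h i hm
    by_contra hlt
    push Not at hlt
    have h1 : (i, f i) ∈ rotheDiagram g := by
      refine mem_rotheDiagram.2 ⟨hlt, ?_⟩
      by_contra hle
      push Not at hle
      rcases hle.lt_or_eq with h2 | h2
      · have := hm _ h2
        rw [Equiv.apply_symm_apply] at this
        have := f.injective this
        omega
      · rw [Equiv.symm_apply_eq] at h2
        omega
    rw [← h, mem_rotheDiagram] at h1
    omega
  ext i
  induction i using Nat.strong_induction_on with
  | _ i ih => exact le_antisymm (key g f h.symm i fun m hm => (ih m hm).symm) (key f g h i ih)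

theorem rotheDiagram_inv (σ : Equiv.Perm ℕ) (i v : ℕ) :
    (i, v) ∈ rotheDiagram σ⁻¹ ↔ (v, i) ∈ rotheDiagram σ := by
  rw [mem_rotheDiagram, mem_rotheDiagram]
  exact and_comm

theorem rotheDiagram_shiftPerm (k : ℕ) (τ : Equiv.Perm ℕ) (i v : ℕ) :
    (i, v) ∈ rotheDiagram (shiftPerm k τ) ↔
      k ≤ i ∧ k ≤ v ∧ (i - k, v - k) ∈ rotheDiagram τ := by
  have e1 : ∀ m, shiftPerm k τ m = if m < k then m else τ (m - k) + k := fun m => rfl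
  have e2 : ∀ m, (shiftPerm k τ).symm m = if m < k then m else τ.symm (m - k) + k := fun m => rfl
  rw [mem_rotheDiagram, mem_rotheDiagram, e1, e2]
  split_ifs <;> omega

/-! ### Biwords -/

/-- The order of the columns of a compatible sequence: first by the upper entry, increasingly, then
by the lower entry, decreasingly. -/
def BiLt (x y : ℕ × ℕ) : Prop := x.1 < y.1 ∨ (x.1 = y.1 ∧ y.2 < x.2)

instance : IsTrans (ℕ × ℕ) BiLt where
  trans := by
    rintro ⟨a, b⟩ ⟨c, d⟩ ⟨e, f⟩ h1 h2
    simp only [BiLt] at *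
    omega

theorem pairwise_biLt_iff {t : List (ℕ × ℕ)} :
    t.Pairwise BiLt ↔ t.IsChain (fun u v => u.1 ≤ v.1) ∧
      t.IsChain (fun u v => u.1 = v.1 → v.2 < u.2) := by
  rw [← List.isChain_iff_pairwise]
  constructor
  · intro h
    constructor
    · refine h.imp fun x y hxy => ?_
      simp only [BiLt] at hxy
      omega
    · refine h.imp fun x y hxy => ?_
      simp only [BiLt] at hxy
      omega
  · rintro ⟨h1, h2⟩
    refine (List.isChain_iff_getElem.2 fun i hi => ?_)
    have h3 := List.isChain_iff_getElem.1 h1 i hi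
    have h4 := List.isChain_iff_getElem.1 h2 i hi
    simp only [BiLt]
    omega

theorem mem_compatibleSequences {σ : Equiv.Perm ℕ} {t : List (ℕ × ℕ)} :
    t ∈ compatibleSequences σ ↔ t.Pairwise BiLt ∧ wordProd (t.map Prod.snd) = σ ∧
      Red (t.map Prod.snd) ∧ ∀ u ∈ t, u.1 ≤ u.2 := by
  rw [pairwise_biLt_iff, compatibleSequences, Set.mem_ofPred_eq, isReducedWord_iff]
  tauto

/-- A strictly decreasing block of letters moves no value more than one position to the right, so
the distance that a value has moved is bounded by the number of blocks. -/
theorem le_wordProd_add {s : List (ℕ × ℕ)} {a₀ : ℕ} (hs : s.Pairwise BiLt)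
    (ha : ∀ u ∈ s, a₀ ≤ u.1) {A B : ℕ} (hA : a₀ ≤ A) (hAB : ∀ u ∈ s, BiLt u (A, B)) (m : ℕ) :
    m + a₀ ≤ wordProd (s.map Prod.snd) m + A + (if m ≤ B then 0 else 1) := by
  induction s using List.reverseRecOn generalizing A B m with
  | nil =>
    simp only [List.map_nil, wordProd_nil, Equiv.Perm.one_apply]
    omega
  | append_singleton s x ih =>
    obtain ⟨a', b'⟩ := x
    rw [List.pairwise_append] at hs
    have hx : a₀ ≤ a' := ha (a', b') (by simp)
    have key := ih hs.1 (fun u hu => ha u (by simp [hu])) hx (B := b')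
      (fun u hu => hs.2.2 u hu _ (by simp))
    have hlast := hAB (a', b') (by simp)
    simp only [BiLt] at hlast
    rw [List.map_append, List.map_singleton, wordProd_concat, Equiv.Perm.mul_apply]
    dsimp only
    have k1 := key m
    have k2 := key b'
    have k3 := key (b' + 1)
    simp only [le_refl, if_true, show ¬ (b' + 1 ≤ b') by omega, if_false] at k2 k3
    rw [Equiv.swap_apply_def]
    split_ifs at k1 ⊢ <;> subst_vars <;> omega

/-- Every column of a compatible sequence lies weakly to the north-west of a box of the Rothe
diagram, namely of the one given by the two values that the letter exchanges. -/
theorem exists_rothe_of_mem {t : List (ℕ × ℕ)} {a₀ : ℕ} (ht : t.Pairwise BiLt)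
    (ha : ∀ u ∈ t, a₀ ≤ u.1) (hab : ∀ u ∈ t, u.1 ≤ u.2) (hr : Red (t.map Prod.snd))
    {a b : ℕ} (h : (a, b) ∈ t) :
    ∃ i p, (i, p) ∈ rotheDiagram (wordProd (t.map Prod.snd)) ∧ a ≤ i ∧ b + a₀ ≤ p + a := by
  obtain ⟨s, r, rfl⟩ := List.append_of_mem h
  rw [List.pairwise_append, List.pairwise_cons] at ht
  have hA := red_iff_asc.1 hr
  rw [List.map_append, List.map_cons] at hA ⊢
  have h1 := hA.mem_valueInv
  set p := wordProd (s.map Prod.snd) b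
  set q := wordProd (s.map Prod.snd) (b + 1) with hq
  refine ⟨(wordProd (s.map Prod.snd ++ b :: r.map Prod.snd)).symm q, p, ?_, ?_, ?_⟩
  · rw [rotheDiagram_eq_image]
    exact ⟨_, h1, rfl⟩
  · rw [show List.map Prod.snd s ++ b :: List.map Prod.snd r =
      (List.map Prod.snd s ++ [b]) ++ List.map Prod.snd r by simp, wordProd_append,
      wordProd_concat]
    change a ≤ (wordProd (List.map Prod.snd r)).symm
      ((wordProd (List.map Prod.snd s) * Equiv.swap b (b + 1)).symm q)
    have h2 : (wordProd (List.map Prod.snd s) * Equiv.swap b (b + 1)).symm q = b := by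
      rw [Equiv.symm_apply_eq]
      simp [hq]
    rw [h2]
    apply le_wordProd_symm_apply
    · intro c hc
      obtain ⟨⟨a', c'⟩, hm, rfl⟩ := List.mem_map.1 hc
      have h3 := ht.2.1.1 _ hm
      have h4 := hab (a', c') (by simp [hm])
      simp only [BiLt] at h3 h4 ⊢
      omega
    · exact hab (a, b) (by simp)
  · have h2 := le_wordProd_add (A := a) (B := b) ht.1 (fun u hu => ha u (by simp [hu]))
      (ha (a, b) (by simp)) (fun u hu => ht.2.2 u hu _ (by simp)) b
    simpa using h2


/-! ### Pipe dreams and their reading words -/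

/-- The part of the reading biword that comes from the columns `j, …, n - 1` of row `i`. -/
def rowFrom (n : ℕ) (D : Finset Box) (i j : ℕ) : List (ℕ × ℕ) :=
  ((List.range' j (n - j)).reverse.filter (fun j => (i, j) ∈ D)).map fun j => (i, i + j)

/-- The part of the reading biword that comes from the rows above row `i` and the columns
`j, …, n - 1` of row `i`. -/
def before (n : ℕ) (D : Finset Box) (i j : ℕ) : List (ℕ × ℕ) :=
  (List.range i).flatMap (fun i => rowFrom n D i 0) ++ rowFrom n D i j

/-- The pipes in the order in which they cross the border between the boxes that are read in
`before n D i j` and the other boxes, from the south-west to the north-east. -/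
def front (n : ℕ) (D : Finset Box) (i j : ℕ) : Equiv.Perm ℕ :=
  wordProd ((before n D i j).map Prod.snd)

section Reading
variable {n : ℕ} {D : Finset Box}

theorem mem_staircase {n : ℕ} {x : Box} : x ∈ staircase n ↔ x.1 + x.2 + 1 < n := by
  simp only [staircase, Finset.mem_filter, Finset.mem_product, Finset.mem_range]
  omega

theorem rowFrom_of_le {i j : ℕ} (h : n ≤ j) : rowFrom n D i j = [] := by
  simp [rowFrom, Nat.sub_eq_zero_of_le h]

theorem rowFrom_of_mem {i j : ℕ} (hj : j < n) (h : (i, j) ∈ D) :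
    rowFrom n D i j = rowFrom n D i (j + 1) ++ [(i, i + j)] := by
  have : n - j = (n - (j + 1)) + 1 := by omega
  rw [rowFrom, this, List.range'_succ]
  simp [rowFrom, h]

theorem rowFrom_of_notMem {i j : ℕ} (h : (i, j) ∉ D) :
    rowFrom n D i j = rowFrom n D i (j + 1) := by
  rcases Nat.lt_or_ge j n with hj | hj
  · have : n - j = (n - (j + 1)) + 1 := by omega
    rw [rowFrom, this, List.range'_succ]
    simp [rowFrom, h]
  · rw [rowFrom_of_le hj, rowFrom_of_le (by omega)]

theorem mem_rowFrom {i j : ℕ} {x : ℕ × ℕ} :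
    x ∈ rowFrom n D i j ↔ x.1 = i ∧ ∃ c, j ≤ c ∧ c < n ∧ (i, c) ∈ D ∧ x.2 = i + c := by
  simp only [rowFrom, List.mem_map, List.mem_filter, List.mem_reverse, List.mem_range'_1,
    decide_eq_true_eq]
  constructor
  · rintro ⟨c, ⟨⟨h1, h2⟩, h3⟩, rfl⟩
    exact ⟨rfl, c, h1, by omega, h3, rfl⟩
  · rintro ⟨rfl, c, h1, h2, h3, h4⟩
    exact ⟨c, ⟨⟨h1, by omega⟩, h3⟩, by ext <;> simp [h4]⟩

theorem pairwise_rowFrom (i j : ℕ) : (rowFrom n D i j).Pairwise BiLt := by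
  rw [rowFrom, List.pairwise_map]
  apply List.Pairwise.filter
  rw [List.pairwise_reverse]
  refine List.Pairwise.imp ?_ (List.pairwise_lt_range' (s := j) (n := n - j) (step := 1))
  intro a b hab
  exact Or.inr ⟨rfl, Nat.add_lt_add_left hab i⟩

theorem pairwise_rows (i : ℕ) :
    ((List.range i).flatMap (fun i => rowFrom n D i 0)).Pairwise BiLt := by
  rw [List.pairwise_flatMap]
  refine ⟨fun i _ => pairwise_rowFrom i 0, ?_⟩
  refine List.Pairwise.imp ?_ (List.pairwise_lt_range (n := i))
  intro a b hab x hx y hy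
  rw [mem_rowFrom] at hx hy
  simp only [BiLt]
  omega

theorem readingBiword_eq : readingBiword n D = before n D n n := by
  rw [before, rowFrom_of_le le_rfl, List.append_nil, readingBiword]
  simp only [rowFrom, Nat.sub_zero, List.range_eq_range']

theorem pairwise_readingBiword : (readingBiword n D).Pairwise BiLt := by
  rw [readingBiword_eq, before, rowFrom_of_le le_rfl, List.append_nil]
  exact pairwise_rows n

theorem before_succ (i j : ℕ) : before n D (i + 1) j = before n D i 0 ++ rowFrom n D (i + 1) j := by
  simp [before, List.range_succ, List.flatMap_append]

variable (hD : D ⊆ staircase n)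
include hD

theorem lt_of_mem_staircase {i j : ℕ} (h : (i, j) ∈ D) : i + j + 1 < n :=
  mem_staircase.1 (hD h)

theorem mem_readingBiword {a b : ℕ} :
    (a, b) ∈ readingBiword n D ↔ ∃ j, (a, j) ∈ D ∧ b = a + j := by
  rw [readingBiword_eq, before, rowFrom_of_le le_rfl, List.append_nil, List.mem_flatMap]
  simp only [mem_rowFrom, List.mem_range]
  constructor
  · rintro ⟨i, hi, rfl, c, -, -, h, hb⟩
    exact ⟨c, h, hb⟩
  · rintro ⟨j, h, hb⟩
    have := lt_of_mem_staircase hD h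
    exact ⟨a, by omega, rfl, j, by omega, by omega, h, hb⟩

theorem front_of_mem {i j : ℕ} (h : (i, j) ∈ D) :
    front n D i j = front n D i (j + 1) * Equiv.swap (i + j) (i + j + 1) := by
  have := lt_of_mem_staircase hD h
  rw [front, before, rowFrom_of_mem (by omega) h, ← List.append_assoc, List.map_append,
    List.map_singleton, wordProd_concat]
  rfl

omit hD in
theorem front_of_notMem {i j : ℕ} (h : (i, j) ∉ D) : front n D i j = front n D i (j + 1) := by
  rw [front, before, rowFrom_of_notMem h]
  rfl

omit hD in
theorem front_succ_apply {i j m : ℕ} (h : m < i + 1 + j) :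
    front n D (i + 1) j m = front n D i 0 m := by
  rw [front, before_succ, List.map_append, wordProd_append, Equiv.Perm.mul_apply]
  rw [wordProd_apply_of_lt (β := i + 1 + j) _ h]
  · rfl
  · intro b hb
    obtain ⟨x, hx, rfl⟩ := List.mem_map.1 hb
    obtain ⟨-, c, hc, -, -, h2⟩ := mem_rowFrom.1 hx
    omega

theorem front_apply_of_gt {i j m : ℕ} (h : i + j < m) : front n D i j m = front n D i 0 m := by
  induction j with
  | zero => rfl
  | succ j ih =>
    rw [← ih (by omega)]
    by_cases hm : (i, j) ∈ D
    · rw [front_of_mem hD hm, Equiv.Perm.mul_apply, Equiv.swap_apply_of_ne_of_ne] <;> omega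
    · rw [front_of_notMem hm]

theorem front_top (i j : ℕ) : front n D (i + 1) (j + 1) (i + 1 + j) = front n D i j (i + j + 1) := by
  rw [front_succ_apply (by omega), Nat.add_right_comm,
    front_apply_of_gt hD (Nat.lt_succ_self (i + j))]

/-- The pipe that enters a box through the given side, read off from `front`. -/
def pipeAt (n : ℕ) (D : Finset Box) : Side → ℕ → ℕ → ℕ
  | Side.top, i, j => front n D i (j + 1) (i + j)
  | Side.right, i, j => front n D i (j + 1) (i + j + 1)

omit hD in
theorem front_zero_apply (p : ℕ) : front n D 0 (p + 1) p = p := by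
  rw [front, wordProd_apply_of_lt (β := p + 1) _ (by omega)]
  intro b hb
  obtain ⟨x, hx, rfl⟩ := List.mem_map.1 hb
  rw [before] at hx
  simp only [List.range_zero, List.flatMap_nil, List.nil_append] at hx
  obtain ⟨-, c, hc, -, -, h2⟩ := mem_rowFrom.1 hx
  omega

theorem pipeAt_of_enters {p i j : ℕ} {s : Side} (h : Enters D p s i j) : p = pipeAt n D s i j := by
  induction h with
  | start =>
    simp only [pipeAt, Nat.zero_add]
    rw [front_zero_apply]
  | @straightDown i j _ hm ih =>
    simp only [pipeAt] at ih ⊢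
    rw [front_top hD, front_of_mem hD hm, Equiv.Perm.mul_apply, Equiv.swap_apply_right]
    exact ih
  | @turnDown i j _ hm ih =>
    simp only [pipeAt] at ih ⊢
    rw [front_top hD, front_of_notMem hm]
    exact ih
  | @straightLeft i j _ hm ih =>
    simp only [pipeAt] at ih ⊢
    rw [front_of_mem hD hm, Equiv.Perm.mul_apply, Nat.add_assoc i j 1, Equiv.swap_apply_left]
    exact ih
  | @turnLeft i j _ hm ih =>
    simp only [pipeAt] at ih ⊢
    rw [front_of_notMem hm, Nat.add_assoc i j 1]
    exact ih

theorem enters_right_of_top {i : ℕ}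
    (h : ∀ j, Enters D (pipeAt n D Side.top i j) Side.top i j) (j : ℕ) :
    Enters D (pipeAt n D Side.right i j) Side.right i j := by
  have turn : ∀ j, (i, j + 1) ∉ D → Enters D (pipeAt n D Side.right i j) Side.right i j := by
    intro j hm
    have := Enters.turnLeft (h (j + 1)) hm
    simp only [pipeAt] at this ⊢
    rwa [front_of_notMem hm, Nat.add_assoc i j 1]
  rcases Nat.lt_or_ge n j with hj | hj
  · exact turn j fun hm => by have := lt_of_mem_staircase hD hm; omega
  · induction hj using Nat.decreasingInduction with
    | self => exact turn n fun hm => by have := lt_of_mem_staircase hD hm; omega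
    | of_succ j hj ih =>
      by_cases hm : (i, j + 1) ∈ D
      · have := Enters.straightLeft ih hm
        simp only [pipeAt] at this ⊢
        rwa [front_of_mem hD hm, Equiv.Perm.mul_apply, Nat.add_assoc i j 1, Equiv.swap_apply_left]
      · exact turn j hm

theorem enters_pipeAt (s : Side) (i j : ℕ) : Enters D (pipeAt n D s i j) s i j := by
  have top : ∀ i j, Enters D (pipeAt n D Side.top i j) Side.top i j := by
    intro i
    induction i with
    | zero =>
      intro j
      simp only [pipeAt, Nat.zero_add]
      rw [front_zero_apply]
      exact Enters.start
    | succ i ih =>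
      intro j
      have hr := enters_right_of_top hD ih j
      by_cases hm : (i, j) ∈ D
      · have := Enters.straightDown (ih j) hm
        simp only [pipeAt] at this ⊢
        rwa [front_top hD, front_of_mem hD hm, Equiv.Perm.mul_apply, Equiv.swap_apply_right]
      · have := Enters.turnDown hr hm
        simp only [pipeAt] at this ⊢
        rwa [front_top hD, front_of_notMem hm]
  cases s with
  | top => exact top i j
  | right => exact enters_right_of_top hD (top i) j

theorem enters_iff {p i j : ℕ} {s : Side} : Enters D p s i j ↔ p = pipeAt n D s i j :=
  ⟨pipeAt_of_enters hD, fun h => h ▸ enters_pipeAt hD s i j⟩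

theorem endsAt_iff_front {p i : ℕ} : EndsAt D p i ↔ p = front n D i 0 i := by
  rw [EndsAt, enters_iff hD, enters_iff hD]
  simp only [pipeAt, Nat.add_zero, Nat.zero_add]
  by_cases hm : (i, 0) ∈ D
  · rw [front_of_mem hD hm]
    simp [hm]
  · rw [front_of_notMem hm]
    simp [hm]

theorem wordProd_readingBiword_apply (i : ℕ) :
    wordProd ((readingBiword n D).map Prod.snd) i = front n D i 0 i := by
  have h1 : ∀ t, front n D (i + t) 0 i = front n D i 0 i := by
    intro t
    induction t with
    | zero => rfl
    | succ t ih => rw [← Nat.add_assoc, front_succ_apply (by omega), ih]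
  have empty : ∀ i j, n ≤ i → rowFrom n D i j = [] := by
    intro i j h
    rw [List.eq_nil_iff_forall_not_mem]
    intro x hx
    obtain ⟨-, c, -, -, h2, -⟩ := mem_rowFrom.1 hx
    have := lt_of_mem_staircase hD h2
    omega
  have h2 : ∀ t, front n D (n + t) 0 = wordProd ((readingBiword n D).map Prod.snd) := by
    intro t
    induction t with
    | zero =>
      rw [readingBiword_eq, front, Nat.add_zero, before, before, empty n 0 le_rfl,
        empty n n le_rfl]
    | succ t ih =>
      rw [← ih, front, ← Nat.add_assoc, before_succ, empty _ _ (by omega), List.append_nil]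
      rfl
  rw [← h2 i, Nat.add_comm n i, h1]

theorem endsAt_iff {σ : Equiv.Perm ℕ} :
    (∀ i, EndsAt D (σ i) i) ↔ wordProd ((readingBiword n D).map Prod.snd) = σ := by
  simp only [endsAt_iff_front hD, ← wordProd_readingBiword_apply hD]
  exact ⟨fun h => Equiv.ext fun i => (h i).symm, fun h i => by rw [h]⟩

theorem crossIn_iff {p q i j : ℕ} : CrossIn D p q (i, j) ↔ (i, j) ∈ D ∧
    ((front n D i (j + 1) (i + j) = p ∧ front n D i (j + 1) (i + j + 1) = q) ∨
      (front n D i (j + 1) (i + j) = q ∧ front n D i (j + 1) (i + j + 1) = p)) := by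
  rw [CrossIn, enters_iff hD, enters_iff hD, enters_iff hD, enters_iff hD]
  simp only [pipeAt, eq_comm]

theorem readingBiword_eq_append {i j : ℕ} (h : (i, j) ∈ D) :
    ∃ r, readingBiword n D = before n D i (j + 1) ++ (i, i + j) :: r := by
  have hn := lt_of_mem_staircase hD h
  have h1 : ∀ c, c ≤ j → ∃ r, rowFrom n D i c = rowFrom n D i (j + 1) ++ (i, i + j) :: r := by
    intro c hc
    induction hc using Nat.decreasingInduction with
    | self => exact ⟨[], rowFrom_of_mem (by omega) h⟩
    | of_succ c hc ih =>
      obtain ⟨r, hr⟩ := ih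
      by_cases hm : (i, c) ∈ D
      · exact ⟨r ++ [(i, i + c)], by rw [rowFrom_of_mem (by omega) hm, hr]; simp⟩
      · exact ⟨r, by rw [rowFrom_of_notMem hm, hr]⟩
  obtain ⟨r, hr⟩ := h1 0 (Nat.zero_le _)
  obtain ⟨t, ht⟩ : ∃ t, n = i + 1 + t := ⟨n - (i + 1), by omega⟩
  rw [readingBiword_eq, before, rowFrom_of_le le_rfl, List.append_nil, before]
  conv =>
    enter [1, r, 1, 2, 1]
    rw [ht]
  rw [List.range_add, List.flatMap_append, List.range_succ, List.flatMap_append,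
    List.flatMap_singleton, hr]
  simp

end Reading

theorem eq_of_append_cons_eq {α : Type*} {x : α} {u v u' v' : List α} (hn : (u ++ x :: v).Nodup)
    (h : u ++ x :: v = u' ++ x :: v') : u = u' := by
  induction u generalizing u' with
  | nil =>
    cases u' with
    | nil => rfl
    | cons y u' =>
      simp only [List.nil_append, List.cons_append, List.cons.injEq] at h hn
      obtain ⟨rfl, rfl⟩ := h
      simp at hn
  | cons z u ih =>
    cases u' with
    | nil =>
      simp only [List.nil_append, List.cons_append, List.cons.injEq] at h hn
      obtain ⟨rfl, rfl⟩ := h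
      simp at hn
    | cons y u' =>
      simp only [List.cons_append, List.cons.injEq, List.nodup_cons] at h hn
      rw [h.1, ih hn.2 h.2]

theorem nodup_of_pairwise_biLt {t : List (ℕ × ℕ)} (h : t.Pairwise BiLt) : t.Nodup :=
  h.imp fun {a b} hab hne => by
    subst hne
    simp [BiLt] at hab

theorem eq_of_pairwise_biLt {s t : List (ℕ × ℕ)} (hs : s.Pairwise BiLt) (ht : t.Pairwise BiLt)
    (h : ∀ x, x ∈ s ↔ x ∈ t) : s = t := by
  have hp : s.Perm t :=
    (List.perm_ext_iff_of_nodup (nodup_of_pairwise_biLt hs) (nodup_of_pairwise_biLt ht)).2 h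
  refine hp.eq_of_pairwise ?_ hs ht
  intro a b _ _ h1 h2
  simp only [BiLt] at h1 h2
  omega

/-- A pipe dream is reduced exactly if its reading word is. -/
theorem isReduced_iff {n : ℕ} {D : Finset Box} (hD : D ⊆ staircase n) :
    IsReduced D ↔ Red ((readingBiword n D).map Prod.snd) := by
  rw [red_iff_asc]
  have hnd := nodup_of_pairwise_biLt (pairwise_readingBiword (n := n) (D := D))
  constructor
  · intro hred
    have split : ∀ {u v : List ℕ} {b : ℕ}, (readingBiword n D).map Prod.snd = u ++ b :: v →
        ∃ i j s, b = i + j ∧ (i, j) ∈ D ∧ u = (before n D i (j + 1)).map Prod.snd ∧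
          readingBiword n D = before n D i (j + 1) ++ (i, i + j) :: s := by
      intro u v b h
      obtain ⟨u', v', h1, rfl, h2⟩ := List.map_eq_append_iff.1 h
      obtain ⟨⟨a, c⟩, v'', rfl, rfl, rfl⟩ := List.map_eq_cons_iff.1 h2
      obtain ⟨j, hj, rfl⟩ := (mem_readingBiword hD (a := a) (b := c)).1 (by rw [h1]; simp)
      obtain ⟨r, hr⟩ := readingBiword_eq_append hD hj
      have h3 : u' = before n D a (j + 1) := by
        rw [h1] at hnd hr
        exact eq_of_append_cons_eq hnd hr
      exact ⟨a, j, r, rfl, hj, by rw [h3], hr⟩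
    intro u b v huv
    -- a letter that exchanges a descent is a crossing of two pipes that have crossed before, when
    -- their inversion was created
    obtain ⟨i, j, s, rfl, hm, rfl, hs⟩ := split huv
    by_contra hlt
    have hgt := (wordProd_succ_lt_or_gt _ (i + j)).resolve_left hlt
    have hinv : (wordProd ((before n D i (j + 1)).map Prod.snd) (i + j + 1),
        wordProd ((before n D i (j + 1)).map Prod.snd) (i + j)) ∈
        valueInv (wordProd ((before n D i (j + 1)).map Prod.snd)) := by
      refine ⟨hgt, ?_⟩
      simp
    obtain ⟨u', c, v', h1, h2, h3⟩ := exists_letter_of_mem_valueInv hinv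
    have hs' := congrArg (List.map Prod.snd) hs
    rw [List.map_append, h1, List.append_assoc, List.cons_append] at hs'
    obtain ⟨i', j', s', rfl, hm', rfl, hs'⟩ := split hs'
    have hxy := hred _ _ (ne_of_lt hgt) (i', j') (i, j)
      ((crossIn_iff hD).2 ⟨hm', Or.inl ⟨h2, h3⟩⟩) ((crossIn_iff hD).2 ⟨hm, Or.inr ⟨rfl, rfl⟩⟩)
    simp only [Prod.mk.injEq] at hxy
    obtain ⟨rfl, rfl⟩ := hxy
    have := congrArg List.length h1
    simp at this
  · intro hA
    have asc : ∀ {i j : ℕ}, (i, j) ∈ D →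
        front n D i (j + 1) (i + j) < front n D i (j + 1) (i + j + 1) := by
      intro i j h
      obtain ⟨r, hr⟩ := readingBiword_eq_append hD h
      exact hA _ _ _ (by rw [hr, List.map_append, List.map_cons])
    -- after a crossing, the two pipes stay inverted, so they do not cross again in a later box
    have twice : ∀ {i j i' j' : ℕ} {z r : List (ℕ × ℕ)}, (i, j) ∈ D → (i', j') ∈ D →
        before n D i' (j' + 1) = before n D i (j + 1) ++ (i, i + j) :: z →
        readingBiword n D = before n D i' (j' + 1) ++ r →
        front n D i (j + 1) (i + j) = front n D i' (j' + 1) (i' + j') →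
        front n D i (j + 1) (i + j + 1) = front n D i' (j' + 1) (i' + j' + 1) → False := by
      intro i j i' j' z r hx hy hz hr h1 h2
      have hA' : Asc ((before n D i' (j' + 1)).map Prod.snd) := by
        rw [hr, List.map_append] at hA
        exact hA.left
      rw [hz, List.map_append, List.map_cons] at hA'
      have h3 := hA'.mem_valueInv
      have h4 := h3.2
      rw [← List.map_cons (f := Prod.snd) (a := (i, i + j)), ← List.map_append, ← hz] at h4
      change (front n D i' (j' + 1)).symm (front n D i (j + 1) (i + j + 1)) <
        (front n D i' (j' + 1)).symm (front n D i (j + 1) (i + j)) at h4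
      rw [h1, h2, Equiv.symm_apply_apply, Equiv.symm_apply_apply] at h4
      omega
    rintro p q hpq ⟨i, j⟩ ⟨i', j'⟩ hx hy
    rw [crossIn_iff hD] at hx hy
    obtain ⟨hx, hx'⟩ := hx
    obtain ⟨hy, hy'⟩ := hy
    have ax := asc hx
    have ay := asc hy
    have e1 : front n D i (j + 1) (i + j) = front n D i' (j' + 1) (i' + j') := by omega
    have e2 : front n D i (j + 1) (i + j + 1) = front n D i' (j' + 1) (i' + j' + 1) := by omega
    obtain ⟨r, hr⟩ := readingBiword_eq_append hD hx
    obtain ⟨r', hr'⟩ := readingBiword_eq_append hD hy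
    rcases List.append_eq_append_iff.1 (hr.symm.trans hr') with ⟨z, hz, hz'⟩ | ⟨z, hz, hz'⟩
    · cases z with
      | nil =>
        simp only [List.nil_append, List.cons.injEq, Prod.mk.injEq] at hz'
        obtain ⟨⟨rfl, h⟩, -⟩ := hz'
        rw [Prod.mk.injEq]
        omega
      | cons y z =>
        simp only [List.cons_append, List.cons.injEq] at hz'
        obtain ⟨rfl, -⟩ := hz'
        exact (twice hx hy hz hr' e1 e2).elim
    · cases z with
      | nil =>
        simp only [List.nil_append, List.cons.injEq, Prod.mk.injEq] at hz'
        obtain ⟨⟨rfl, h⟩, -⟩ := hz'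
        rw [Prod.mk.injEq]
        omega
      | cons y z =>
        simp only [List.cons_append, List.cons.injEq] at hz'
        obtain ⟨rfl, -⟩ := hz'
        exact (twice hy hx hz hr e1.symm e2.symm).elim

theorem mem_reducedPipeDreams {n : ℕ} {σ : Equiv.Perm ℕ} {D : Finset Box} :
    D ∈ reducedPipeDreams n σ ↔ D ⊆ staircase n ∧ Red ((readingBiword n D).map Prod.snd) ∧
      wordProd ((readingBiword n D).map Prod.snd) = σ := by
  rw [reducedPipeDreams, Set.mem_ofPred_eq]
  refine and_congr_right fun hD => ?_
  rw [isReduced_iff hD, endsAt_iff hD]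

theorem readingBiword_le {n : ℕ} {D : Finset Box} (hD : D ⊆ staircase n) :
    ∀ u ∈ readingBiword n D, u.1 ≤ u.2 := by
  rintro ⟨a, b⟩ hu
  obtain ⟨j, -, rfl⟩ := (mem_readingBiword hD).1 hu
  simp

/-- The hypothesis on the Rothe diagram makes the staircase large enough: a column of a compatible
sequence lies to the north-west of a box of the Rothe diagram, so that the crossing it stands for is
in the staircase. -/
theorem bijOn_readingBiword {n : ℕ} {σ : Equiv.Perm ℕ}
    (hσ : rotheDiagram σ ⊆ (staircase n : Set Box)) :
    Set.BijOn (readingBiword n) (reducedPipeDreams n σ) (compatibleSequences σ) := by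
  refine ⟨?_, ?_, ?_⟩
  · intro D hD
    rw [mem_reducedPipeDreams] at hD
    exact mem_compatibleSequences.2
      ⟨pairwise_readingBiword, hD.2.2, hD.2.1, readingBiword_le hD.1⟩
  · intro D hD E hE h
    rw [mem_reducedPipeDreams] at hD hE
    ext ⟨i, j⟩
    have h1 := mem_readingBiword hD.1 (a := i) (b := i + j)
    have h2 := mem_readingBiword hE.1 (a := i) (b := i + j)
    simp only [Nat.add_left_cancel_iff, exists_eq_right'] at h1 h2
    rw [← h1, ← h2, h]
  · intro t ht
    rw [mem_compatibleSequences] at ht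
    obtain ⟨h1, h2, h3, h4⟩ := ht
    have hD : (t.map fun x => (x.1, x.2 - x.1)).toFinset ⊆ staircase n := by
      intro x hx
      rw [List.mem_toFinset, List.mem_map] at hx
      obtain ⟨⟨a, b⟩, hab, rfl⟩ := hx
      obtain ⟨i, p, h5, h6, h7⟩ :=
        exists_rothe_of_mem h1 (fun _ _ => Nat.zero_le _) h4 h3 hab
      rw [h2] at h5
      have h8 := mem_staircase.1 (hσ h5)
      have h9 := h4 _ hab
      rw [mem_staircase]
      simp only at h8 h9 ⊢
      omega
    have hrt : readingBiword n (t.map fun x => (x.1, x.2 - x.1)).toFinset = t := by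
      refine eq_of_pairwise_biLt pairwise_readingBiword h1 ?_
      rintro ⟨a, b⟩
      rw [mem_readingBiword hD]
      simp only [List.mem_toFinset, List.mem_map, Prod.mk.injEq]
      constructor
      · rintro ⟨j, ⟨⟨a', b'⟩, hm, rfl, rfl⟩, rfl⟩
        have := h4 _ hm
        simp only at this ⊢
        rwa [Nat.add_sub_cancel' this]
      · intro hm
        have := h4 _ hm
        exact ⟨b - a, ⟨(a, b), hm, rfl, rfl⟩, by simp only at this; omega⟩
    refine ⟨_, mem_reducedPipeDreams.2 ⟨hD, ?_, ?_⟩, hrt⟩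
    · rwa [hrt]
    · rwa [hrt]


/-! ### Demazure products and the longest north-east chains of turning boxes -/

/-- The Demazure product of a word: letters that would exchange a descent are skipped. -/
def demazure (w : List ℕ) : Equiv.Perm ℕ :=
  w.foldl (fun f b => if f b < f (b + 1) then f * Equiv.swap b (b + 1) else f) 1

theorem demazure_concat (w : List ℕ) (b : ℕ) :
    demazure (w ++ [b]) = if demazure w b < demazure w (b + 1)
      then demazure w * Equiv.swap b (b + 1) else demazure w := by
  rw [demazure, List.foldl_append]
  rfl

theorem demazure_of_asc {w : List ℕ} (h : Asc w) : demazure w = wordProd w := by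
  induction w using List.reverseRecOn with
  | nil => rfl
  | append_singleton w b ih =>
    rw [demazure_concat, ih h.left, if_pos (h w b [] rfl), wordProd_concat]

/-- The letters that are not skipped form a reduced word of the Demazure product. -/
theorem exists_sublist_demazure (w : List ℕ) :
    ∃ v, v.Sublist w ∧ Red v ∧ wordProd v = demazure w := by
  induction w using List.reverseRecOn with
  | nil => exact ⟨[], List.Sublist.refl _, fun v _ => Nat.zero_le _, rfl⟩
  | append_singleton w b ih =>
    obtain ⟨v, hs, hr, hp⟩ := ih
    rw [demazure_concat]
    split_ifs with h
    · refine ⟨v ++ [b], hs.append_right _, ?_, by rw [wordProd_concat, hp]⟩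
      rw [red_iff_invNum_eq] at hr ⊢
      rw [invNum_concat_of_lt (by rwa [hp]), hr]
      simp
    · exact ⟨v, hs.trans (List.sublist_append_left _ _), hr, hp⟩

/-- The number of values below `c` among the first `x` positions. -/
def rankFn (f : Equiv.Perm ℕ) (x c : ℕ) : ℕ := ((Finset.range x).filter (fun m => f m < c)).card

theorem rankFn_succ (f : Equiv.Perm ℕ) (x c : ℕ) :
    rankFn f (x + 1) c = rankFn f x c + if f x < c then 1 else 0 := by
  rw [rankFn, rankFn, Finset.range_add_one, Finset.filter_insert]
  split_ifs with h
  · rw [Finset.card_insert_of_notMem (by simp)]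
  · rfl

theorem rankFn_one (x c : ℕ) : rankFn 1 x c = min x c := by
  induction x with
  | zero => rw [Nat.zero_min]; rfl
  | succ x ih =>
    rw [rankFn_succ, ih, Equiv.Perm.one_apply]
    split_ifs <;> omega

theorem rankFn_mul_swap {f : Equiv.Perm ℕ} {b x c : ℕ} (h : b + 1 ≠ x) :
    rankFn (f * Equiv.swap b (b + 1)) x c = rankFn f x c := by
  rw [rankFn, rankFn]
  refine Finset.card_bij' (fun m _ => Equiv.swap b (b + 1) m)
    (fun m _ => Equiv.swap b (b + 1) m) ?_ ?_ (by simp) (by simp)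
  all_goals
    intro m hm
    rw [Finset.mem_filter, Finset.mem_range] at hm ⊢
    refine ⟨?_, by simpa using hm.2⟩
    have := hm.1
    rw [Equiv.swap_apply_def]
    split_ifs <;> omega

theorem rankFn_demazure_append {u v : List ℕ} {x c : ℕ} (h : ∀ b ∈ v, b + 1 ≠ x) :
    rankFn (demazure (u ++ v)) x c = rankFn (demazure u) x c := by
  induction v using List.reverseRecOn with
  | nil => simp
  | append_singleton v b ih =>
    rw [← List.append_assoc, demazure_concat, ← ih fun b hb => h b (by simp [hb])]
    split_ifs
    · exact rankFn_mul_swap (h b (by simp))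
    · rfl

theorem rankFn_demazure_concat (u : List ℕ) (b c : ℕ) :
    rankFn (demazure (u ++ [b])) (b + 1) c = rankFn (demazure u) b c +
      if demazure u b < c ∧ demazure u (b + 1) < c then 1 else 0 := by
  rw [rankFn_succ, rankFn_demazure_append (by simp), demazure_concat]
  split_ifs <;> simp_all <;> omega

/-- The length of the longest north-east chain of boxes outside `D` in the rows `0, …, i - 1` and
the last `d` of the columns `0, …, c - 1`. -/
def neLen (D : Finset Box) (c : ℕ) : ℕ → ℕ → ℕ
  | 0, _ => 0
  | _ + 1, 0 => 0
  | i + 1, d + 1 =>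
    if (i, c - (d + 1)) ∈ D then max (neLen D c i (d + 1)) (neLen D c (i + 1) d)
    else neLen D c i d + 1

theorem neLen_succ_of_mem {D : Finset Box} {c i j : ℕ} (hj : j < c) (h : (i, j) ∈ D) :
    neLen D c (i + 1) (c - j) = max (neLen D c i (c - j)) (neLen D c (i + 1) (c - (j + 1))) := by
  have e : c - j = c - (j + 1) + 1 := by omega
  have e2 : c - (c - (j + 1) + 1) = j := by omega
  rw [e, neLen, if_pos (by rwa [e2])]

theorem neLen_succ_of_notMem {D : Finset Box} {c i j : ℕ} (hj : j < c) (h : (i, j) ∉ D) :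
    neLen D c (i + 1) (c - j) = neLen D c i (c - (j + 1)) + 1 := by
  have e : c - j = c - (j + 1) + 1 := by omega
  have e2 : c - (c - (j + 1) + 1) = j := by omega
  rw [e, neLen, if_neg (by rwa [e2])]

theorem neLen_zero_right (D : Finset Box) (c i : ℕ) : neLen D c i 0 = 0 := by
  cases i <;> simp [neLen]

theorem length_le_neLen {D : Finset Box} {c l i d : ℕ} (hd : d ≤ c) (x : Fin l → Box)
    (hx : IsNE x) (hi : ∀ a, (x a).1 < i) (hj : ∀ a, c - d ≤ (x a).2 ∧ (x a).2 < c)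
    (hD : ∀ a, x a ∉ D) : l ≤ neLen D c i d := by
  fun_induction neLen D c i d generalizing l with
  | case1 d =>
    cases l with
    | zero => rfl
    | succ l => exact absurd (hi 0) (by omega)
  | case2 i =>
    cases l with
    | zero => rfl
    | succ l => exact absurd (hj 0) (by omega)
  | case3 i d hm ih1 ih2 =>
    cases l with
    | zero => exact Nat.zero_le _
    | succ l =>
      have h0 : ∀ a, (x a).1 ≤ (x 0).1 ∧ (x 0).2 ≤ (x a).2 := by
        intro a
        rcases Fin.eq_zero_or_eq_succ a with rfl | ⟨a, rfl⟩
        · simp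
        · have := hx 0 a.succ (Fin.succ_pos a)
          omega
      by_cases hr : (x 0).1 < i
      · exact le_max_of_le_left (ih1 hd x hx (fun a => (h0 a).1.trans_lt hr) hj hD)
      · refine le_max_of_le_right (ih2 (by omega) x hx hi (fun a => ⟨?_, (hj a).2⟩) hD)
        have h1 : (x 0).2 ≠ c - (d + 1) := by
          intro he
          apply hD 0
          rw [← he] at hm
          convert hm using 1
          ext
          · have := hi 0
            simp only
            omega
          · rfl
        have := hj 0
        have := h0 a
        omega
  | case4 i d hm ih =>
    cases l with
    | zero => exact Nat.zero_le _
    | succ l =>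
      refine Nat.succ_le_succ (ih (by omega) (fun a => x a.succ)
        (fun a b hab => hx _ _ (Fin.succ_lt_succ_iff.2 hab)) (fun a => ?_) (fun a => ?_)
        fun a => hD _)
      · have := hx 0 a.succ (Fin.succ_pos a)
        have := hi 0
        omega
      · have := hx 0 a.succ (Fin.succ_pos a)
        have := hj 0
        have := hj a.succ
        omega

theorem exists_neChain {D : Finset Box} {c l i d : ℕ} (hd : d ≤ c) (hl : l ≤ neLen D c i d) :
    ∃ x : Fin l → Box, IsNE x ∧ (∀ a, (x a).1 < i) ∧
      (∀ a, c - d ≤ (x a).2 ∧ (x a).2 < c) ∧ ∀ a, x a ∉ D := by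
  fun_induction neLen D c i d generalizing l with
  | case1 d =>
    obtain rfl : l = 0 := by omega
    exact ⟨Fin.elim0, fun a => a.elim0, fun a => a.elim0, fun a => a.elim0, fun a => a.elim0⟩
  | case2 i =>
    obtain rfl : l = 0 := by omega
    exact ⟨Fin.elim0, fun a => a.elim0, fun a => a.elim0, fun a => a.elim0, fun a => a.elim0⟩
  | case3 i d hm ih1 ih2 =>
    rcases le_max_iff.1 hl with h | h
    · obtain ⟨x, h1, h2, h3, h4⟩ := ih1 hd h
      exact ⟨x, h1, fun a => (h2 a).trans (Nat.lt_succ_self i), h3, h4⟩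
    · obtain ⟨x, h1, h2, h3, h4⟩ := ih2 (by omega) h
      exact ⟨x, h1, h2, fun a => ⟨by have := h3 a; omega, (h3 a).2⟩, h4⟩
  | case4 i d hm ih =>
    cases l with
    | zero =>
      exact ⟨Fin.elim0, fun a => a.elim0, fun a => a.elim0, fun a => a.elim0, fun a => a.elim0⟩
    | succ l =>
      obtain ⟨x, h1, h2, h3, h4⟩ := ih (l := l) (by omega) (by omega)
      refine ⟨Fin.cons (i, c - (d + 1)) x, ?_, ?_, ?_, ?_⟩
      · intro a b hab
        rcases Fin.eq_zero_or_eq_succ b with rfl | ⟨b, rfl⟩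
        · exact absurd hab (Fin.not_lt_zero a)
        · rcases Fin.eq_zero_or_eq_succ a with rfl | ⟨a, rfl⟩
          · simp only [Fin.cons_succ, Fin.cons_zero]
            have := h2 b
            have := h3 b
            omega
          · exact h1 a b (Fin.succ_lt_succ_iff.1 hab)
      · intro a
        rcases Fin.eq_zero_or_eq_succ a with rfl | ⟨a, rfl⟩
        · simp
        · simpa using (h2 a).trans (Nat.lt_succ_self i)
      · intro a
        rcases Fin.eq_zero_or_eq_succ a with rfl | ⟨a, rfl⟩
        · simp only [Fin.cons_zero]
          omega
        · have := h3 a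
          simp only [Fin.cons_succ]
          omega
      · intro a
        rcases Fin.eq_zero_or_eq_succ a with rfl | ⟨a, rfl⟩
        · simpa using hm
        · simpa using h4 a

section Rank
variable {n : ℕ} {D : Finset Box}

/-- The analogue of `front` in which pipes that have crossed before do not cross again. -/
def demFront (n : ℕ) (D : Finset Box) (i j : ℕ) : Equiv.Perm ℕ :=
  demazure ((before n D i j).map Prod.snd)

theorem demFront_of_notMem {i j : ℕ} (h : (i, j) ∉ D) :
    demFront n D i j = demFront n D i (j + 1) := by
  rw [demFront, before, rowFrom_of_notMem h]
  rfl

theorem rankFn_demFront_succ {i j x c : ℕ} (h : x ≤ i + 1 + j) :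
    rankFn (demFront n D (i + 1) j) x c = rankFn (demFront n D i 0) x c := by
  rw [demFront, before_succ, List.map_append]
  apply rankFn_demazure_append
  intro b hb
  obtain ⟨x, hx, rfl⟩ := List.mem_map.1 hb
  obtain ⟨-, c, hc, -, -, h2⟩ := mem_rowFrom.1 hx
  omega

theorem before_of_mem (hD : D ⊆ staircase n) {i j : ℕ} (h : (i, j) ∈ D) :
    before n D i j = before n D i (j + 1) ++ [(i, i + j)] := by
  have := lt_of_mem_staircase hD h
  rw [before, rowFrom_of_mem (by omega) h, ← List.append_assoc]
  rfl

theorem rankFn_demFront_zero (hD : D ⊆ staircase n) {i j x c : ℕ} (h : i + j < x) :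
    rankFn (demFront n D i 0) x c = rankFn (demFront n D i j) x c := by
  induction j with
  | zero => rfl
  | succ j ih =>
    rw [ih (by omega)]
    by_cases hm : (i, j) ∈ D
    · rw [demFront, before_of_mem hD hm, List.map_append]
      refine rankFn_demazure_append fun b hb => ?_
      simp only [List.map_cons, List.map_nil, List.mem_singleton] at hb
      omega
    · rw [demFront_of_notMem hm]

/-- Along the border between the boxes that have been read and the others, the rank function counts
the longest north-east chain of turning boxes and the columns that have not been reached. -/
theorem rankFn_demFront (hD : D ⊆ staircase n) (c i : ℕ) : ∀ j,
    rankFn (demFront n D i j) (i + 1 + j) c = min j c + neLen D c (i + 1) (c - j) := by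
  have step : ∀ i, (∀ j₀ j, j ≤ j₀ →
      rankFn (demFront n D i j₀) (i + j) c = min j c + neLen D c i (c - j)) →
      ∀ j, rankFn (demFront n D i j) (i + 1 + j) c = min j c + neLen D c (i + 1) (c - j) := by
    intro i hi
    have turn : ∀ j, (i, j) ∉ D →
        rankFn (demFront n D i j) (i + 1 + j) c = min j c + neLen D c (i + 1) (c - j) := by
      intro j hm
      rw [demFront_of_notMem hm, show i + 1 + j = i + (j + 1) by omega, hi _ _ le_rfl]
      rcases Nat.lt_or_ge j c with hj | hj
      · rw [neLen_succ_of_notMem hj hm]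
        omega
      · rw [Nat.sub_eq_zero_of_le hj, Nat.sub_eq_zero_of_le (by omega), neLen_zero_right,
          neLen_zero_right]
        omega
    intro j
    rcases Nat.lt_or_ge n j with hj | hj
    · exact turn j fun hm => by have := lt_of_mem_staircase hD hm; omega
    · induction hj using Nat.decreasingInduction with
      | self => exact turn n fun hm => by have := lt_of_mem_staircase hD hm; omega
      | of_succ j hj ih =>
        by_cases hm : (i, j) ∈ D
        · have h1 := hi (j + 1) j (by omega)
          rw [show i + 1 + (j + 1) = i + j + 1 + 1 by omega, rankFn_succ, rankFn_succ, h1] at ih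
          rw [demFront, before_of_mem hD hm, List.map_append, List.map_singleton,
            show i + 1 + j = i + j + 1 by omega, rankFn_demazure_concat]
          change rankFn (demFront n D i (j + 1)) (i + j) c +
            (if demFront n D i (j + 1) (i + j) < c ∧ demFront n D i (j + 1) (i + j + 1) < c
              then 1 else 0) = _
          rw [h1]
          rcases Nat.lt_or_ge j c with hj | hj
          · rw [neLen_succ_of_mem hj hm]
            split_ifs at ih ⊢ <;> omega
          · rw [Nat.sub_eq_zero_of_le hj, Nat.sub_eq_zero_of_le (by omega), neLen_zero_right,
              neLen_zero_right] at ih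
            rw [Nat.sub_eq_zero_of_le hj, neLen_zero_right, neLen_zero_right]
            split_ifs at ih ⊢ <;> omega
        · exact turn j hm
  induction i with
  | zero =>
    apply step
    intro j₀ j hj
    rw [Nat.zero_add, show neLen D c 0 (c - j) = 0 by simp [neLen], Nat.add_zero, ← rankFn_one,
      demFront, ← List.nil_append (List.map _ _), rankFn_demazure_append]
    · rfl
    · intro b hb
      obtain ⟨x, hx, rfl⟩ := List.mem_map.1 hb
      rw [before] at hx
      simp only [List.range_zero, List.flatMap_nil, List.nil_append] at hx
      obtain ⟨-, c, hc, -, -, h2⟩ := mem_rowFrom.1 hx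
      omega
  | succ i ih =>
    apply step
    intro j₀ j hj
    rw [rankFn_demFront_succ (by omega), rankFn_demFront_zero hD (j := j) (by omega), ih]

/-- The north-east chains of turning boxes in the rectangle with `x` rows and `c` columns are
counted by the Demazure product. -/
theorem rankFn_demazure_readingBiword (hD : D ⊆ staircase n) {x c : ℕ} (hx : x ≤ n) :
    rankFn (demazure ((readingBiword n D).map Prod.snd)) x c = neLen D c x c := by
  cases x with
  | zero => simp [rankFn, neLen]
  | succ i =>
    have h1 := rankFn_demFront hD c i 0
    rw [Nat.zero_min, Nat.zero_add, Nat.add_zero, Nat.sub_zero] at h1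
    rw [← h1]
    obtain ⟨t, ht⟩ : ∃ t, n = i + 1 + t := ⟨n - (i + 1), by omega⟩
    have h2 : readingBiword n D = before n D i 0 ++
        (List.map (i + 1 + ·) (List.range t)).flatMap (fun i => rowFrom n D i 0) := by
      rw [readingBiword_eq, before, rowFrom_of_le le_rfl, List.append_nil, before]
      conv =>
        enter [1, 2]
        rw [ht]
      rw [List.range_add, List.flatMap_append, List.range_succ, List.flatMap_append,
        List.flatMap_singleton]
    rw [h2, List.map_append, rankFn_demazure_append]
    · rfl
    · intro b hb
      obtain ⟨y, hy, rfl⟩ := List.mem_map.1 hb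
      obtain ⟨r, hr, hy⟩ := List.mem_flatMap.1 hy
      obtain ⟨s, -, rfl⟩ := List.mem_map.1 hr
      obtain ⟨-, e, -, -, -, h3⟩ := mem_rowFrom.1 hy
      omega

end Rank

/-! ### Maximal north-east fillings are the complements of reduced pipe dreams -/

theorem mem_cells_of_le {lam : YoungDiagram} {x y : Box} (hx : x ∈ lam.cells) (h1 : y.1 ≤ x.1)
    (h2 : y.2 ≤ x.2) : y ∈ lam.cells :=
  lam.isLowerSet (a := x) (Prod.mk_le_mk.2 ⟨h1, h2⟩) hx

theorem mem_removeHook {lam : YoungDiagram} {k i j : ℕ} :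
    (i, j) ∈ (removeHook lam k).cells ↔ (i + k, j + k) ∈ lam.cells := by
  simp only [removeHook, Finset.mem_image, Finset.mem_filter, Prod.mk.injEq, Prod.exists]
  constructor
  · rintro ⟨a, b, ⟨h1, h2, h3⟩, rfl, rfl⟩
    rwa [Nat.sub_add_cancel h2, Nat.sub_add_cancel h3]
  · intro h
    exact ⟨i + k, j + k, ⟨h, by omega, by omega⟩, by omega, by omega⟩

/-- A filling avoids long north-east chains exactly if the Demazure product of its complement
satisfies the rank conditions given by the boxes of the shape. -/
theorem avoidsNE_iff {lam : YoungDiagram} {k n : ℕ} (hn : lam.cells ⊆ staircase n)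
    {F : Finset Box} (hF : F ⊆ lam.cells) :
    AvoidsNE lam k F ↔ ∀ x ∈ lam.cells,
      rankFn (demazure ((readingBiword n (complementary lam F)).map Prod.snd)) (x.1 + 1) (x.2 + 1)
        ≤ k := by
  have hD : complementary lam F ⊆ staircase n := Finset.sdiff_subset.trans hn
  constructor
  · rintro ⟨-, h⟩ ⟨i, j⟩ hx
    have hlt := mem_staircase.1 (hn hx)
    simp only at hlt ⊢
    by_contra hc
    rw [rankFn_demazure_readingBiword hD (by omega)] at hc
    obtain ⟨c, h1, h2, h3, h4⟩ := exists_neChain (D := complementary lam F) (i := i + 1)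
      (l := k + 1) (le_refl (j + 1)) (by omega)
    have hin : ∀ a, c a ∈ lam.cells := fun a =>
      mem_cells_of_le hx (by have := h2 a; simp only; omega) (by have := h3 a; simp only; omega)
    refine h ⟨c, ⟨h1, hin, ?_⟩, ?_⟩
    · rintro y ⟨-, ⟨a, ha⟩, -, ⟨b, hb⟩⟩
      exact mem_cells_of_le hx (by have := h2 a; simp only; omega)
        (by have := h3 b; simp only; omega)
    · intro a
      by_contra hm
      exact h4 a (Finset.mem_sdiff.2 ⟨hin a, hm⟩)
  · intro h
    refine ⟨hF, ?_⟩
    rintro ⟨c, ⟨h1, h2, h3⟩, h4⟩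
    have hrow : ∀ a, (c a).1 ≤ (c 0).1 := fun a => by
      rcases Fin.eq_zero_or_eq_succ a with rfl | ⟨a, rfl⟩
      · simp
      · exact (h1 0 a.succ (Fin.succ_pos a)).1.le
    have hcol : ∀ a, (c a).2 ≤ (c (Fin.last k)).2 := fun a => by
      rcases (Fin.le_last a).lt_or_eq with hl | rfl
      · exact (h1 a _ hl).2.le
      · simp
    have hx : ((c 0).1, (c (Fin.last k)).2) ∈ lam.cells :=
      h3 ⟨⟨0, le_rfl⟩, ⟨0, le_rfl⟩, ⟨Fin.last k, le_rfl⟩, ⟨Fin.last k, le_rfl⟩⟩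
    have h5 := h _ hx
    have hlt := mem_staircase.1 (hn hx)
    simp only at h5 hlt
    rw [rankFn_demazure_readingBiword hD (by omega)] at h5
    have h6 := length_le_neLen (D := complementary lam F) (i := (c 0).1 + 1)
      (le_refl ((c (Fin.last k)).2 + 1)) c h1
      (fun a => Nat.lt_succ_of_le (hrow a))
      (fun a => ⟨by omega, Nat.lt_succ_of_le (hcol a)⟩)
      (fun a ha => (Finset.mem_sdiff.1 ha).2 (h4 a))
    omega

/-- The number of inversions whose larger value is at position `m`. -/
def code (f : Equiv.Perm ℕ) (m : ℕ) : ℕ :=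
  ((Finset.range (f m)).filter (fun v => m < f.symm v)).card

theorem apply_le_add_code (f : Equiv.Perm ℕ) (m : ℕ) : f m ≤ m + code f m := by
  have h1 := Finset.card_filter_add_card_filter_not (s := Finset.range (f m))
    (fun v => m < f.symm v)
  have h2 : ((Finset.range (f m)).filter (fun v => ¬ m < f.symm v)).card ≤
      (Finset.range m).card := by
    refine Finset.card_le_card_of_injOn f.symm ?_ f.symm.injective.injOn
    intro v hv
    simp only [Finset.coe_filter, Finset.mem_range, Set.mem_ofPred_eq, Finset.coe_range,
      Set.mem_Iio] at hv ⊢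
    have : f.symm v ≠ m := by
      rw [Ne, Equiv.symm_apply_eq]
      omega
    omega
  rw [Finset.card_range] at h1 h2
  rw [code]
  omega

theorem rankFn_eq_card_values (f : Equiv.Perm ℕ) (x c : ℕ) :
    rankFn f x c = ((Finset.range c).filter (fun v => f.symm v < x)).card := by
  refine Finset.card_bij' (fun m _ => f m) (fun v _ => f.symm v) ?_ ?_ (by simp) (by simp)
  · intro m hm
    simp only [Finset.mem_filter, Finset.mem_range, Equiv.symm_apply_apply] at hm ⊢
    exact hm.symm
  · intro m hm
    simp only [Finset.mem_filter, Finset.mem_range, Equiv.apply_symm_apply] at hm ⊢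
    exact hm.symm

theorem card_rotheDiagram_eq_sum_code {f : Equiv.Perm ℕ} {R : Finset Box}
    (hR : (R : Set Box) = rotheDiagram f) {N : ℕ} (hN : ∀ x ∈ R, x.1 < N) :
    R.card = ∑ m ∈ Finset.range N, code f m := by
  rw [Finset.card_eq_sum_card_fiberwise (f := Prod.fst) (t := Finset.range N)
    (fun x hx => by simpa using hN x hx)]
  refine Finset.sum_congr rfl fun m _ => ?_
  have hmem : ∀ x, x ∈ R ↔ x.2 < f x.1 ∧ x.1 < f.symm x.2 := by
    rintro ⟨i, v⟩
    rw [← mem_rotheDiagram, ← hR, Finset.mem_coe]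
  refine Finset.card_bij' (fun x _ => x.2) (fun v _ => (m, v)) ?_ ?_ ?_ (by simp)
  · rintro ⟨i, v⟩ hx
    simp only [Finset.mem_filter, hmem, Finset.mem_range] at hx ⊢
    obtain ⟨h, rfl⟩ := hx
    exact h
  · intro v hv
    simpa [hmem] using hv
  · rintro ⟨i, v⟩ hx
    simp only [Finset.mem_filter] at hx
    rw [hx.2]

/-- Under the rank conditions, column by column, there are at least as many positions with a large
code as there are boxes in `μ`; if there are no more, they are in the expected place. -/
theorem card_le_invNum {lam : YoungDiagram} {k : ℕ} {w : List ℕ}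
    (h : ∀ x ∈ lam.cells, rankFn (wordProd w) (x.1 + 1) (x.2 + 1) ≤ k) :
    (removeHook lam k).cells.card ≤ invNum (wordProd w) ∧
      (invNum (wordProd w) = (removeHook lam k).cells.card →
        ∀ m c, c < code (wordProd w) m → c + k < wordProd w m) := by
  set f := wordProd w with hf
  set μ := removeHook lam k with hμ
  obtain ⟨R, hR⟩ := (rotheDiagram_finite w).exists_finset_coe
  obtain ⟨N, hN⟩ : ∃ N, (∀ x ∈ R, x.1 < N) ∧ (∀ x ∈ lam.cells, x.1 < N) := by
    refine ⟨((R ∪ lam.cells).image Prod.fst).sup id + 1, ?_, ?_⟩ <;>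
    · intro x hx
      refine Nat.lt_succ_of_le (Finset.le_sup (f := id) (Finset.mem_image_of_mem _ ?_))
      simp [hx]
  obtain ⟨M, hM⟩ : ∃ M, (∀ x ∈ μ.cells, x.2 < M) ∧ (∀ m < N, code f m ≤ M) := by
    refine ⟨(μ.cells.image Prod.snd).sup id + 1 + ∑ m ∈ Finset.range N, code f m, ?_, ?_⟩
    · intro x hx
      have := Finset.le_sup (f := id) (Finset.mem_image_of_mem Prod.snd hx)
      simp only [id] at this
      omega
    · intro m hm
      have := Finset.single_le_sum (f := code f) (fun _ _ => Nat.zero_le _)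
        (Finset.mem_range.2 hm)
      omega
  -- the rank condition at the lowest box of column `c` of `μ` forces as many positions with a code
  -- larger than `c` as this column has boxes
  have col : ∀ c, ∃ T : Finset ℕ, (μ.cells.filter (fun x => x.2 = c)).card ≤ T.card ∧
      (∀ m ∈ T, m < N ∧ c < code f m ∧ c + k < f m) := by
    intro c
    rcases Nat.eq_zero_or_pos (μ.colLen c) with h0 | h0
    · refine ⟨∅, ?_, by simp⟩
      rw [Finset.card_empty, Nat.le_zero, Finset.card_eq_zero, Finset.filter_eq_empty_iff]
      rintro ⟨i, j⟩ hx rfl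
      have := YoungDiagram.mem_iff_lt_colLen.1 ((YoungDiagram.mem_cells _).1 hx)
      simp only at this h0
      omega
    · obtain ⟨i, hi⟩ : ∃ i, μ.colLen c = i + 1 := ⟨μ.colLen c - 1, by omega⟩
      have hic : (i + k, c + k) ∈ lam.cells := by
        rw [← mem_removeHook, YoungDiagram.mem_cells, YoungDiagram.mem_iff_lt_colLen, ← hμ]
        omega
      have hr := h _ hic
      simp only at hr
      refine ⟨(Finset.range (i + k + 1)).filter (fun m => ¬ f m < c + k + 1), ?_, ?_⟩
      · have h1 := Finset.card_filter_add_card_filter_not (s := Finset.range (i + k + 1))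
          (fun m => f m < c + k + 1)
        have h2 : (μ.cells.filter (fun x => x.2 = c)).card ≤ (Finset.range (i + 1)).card := by
          refine Finset.card_le_card_of_injOn Prod.fst ?_ ?_
          · rintro ⟨a, b⟩ hx
            simp only [Finset.coe_filter, Set.mem_ofPred_eq, YoungDiagram.mem_cells] at hx
            obtain ⟨hx, rfl⟩ := hx
            have := YoungDiagram.mem_iff_lt_colLen.1 hx
            simp only [Finset.coe_range, Set.mem_Iio]
            omega
          · rintro ⟨a, b⟩ hx ⟨a', b'⟩ hx' hab
            simp only [Finset.coe_filter, Set.mem_ofPred_eq] at hx hx' hab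
            rw [hab, hx.2, hx'.2]
        rw [Finset.card_range] at h1 h2
        rw [rankFn] at hr
        omega
      · intro m hm
        simp only [Finset.mem_filter, Finset.mem_range] at hm
        have hN' := hN.2 _ hic
        simp only at hN'
        refine ⟨by omega, ?_, by omega⟩
        rw [rankFn_eq_card_values] at hr
        have h1 := Finset.card_filter_add_card_filter_not (s := Finset.range (c + k + 1))
          (fun v => f.symm v < i + k + 1)
        have h2 : ((Finset.range (c + k + 1)).filter (fun v => ¬ f.symm v < i + k + 1)).card ≤
            code f m := by
          refine Finset.card_le_card fun v hv => ?_
          simp only [Finset.mem_filter, Finset.mem_range] at hv ⊢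
          omega
        rw [Finset.card_range] at h1
        omega
  choose T hT hT' using col
  have hsum : (∑ m ∈ Finset.range N, code f m) = ∑ c ∈ Finset.range M,
      ((Finset.range N).filter (fun m => c < code f m)).card := by
    refine Eq.trans ?_ (Finset.sum_card_bipartiteAbove_eq_sum_card_bipartiteBelow
      (s := Finset.range N) (t := Finset.range M) (fun m c => c < code f m))
    refine Finset.sum_congr rfl fun m hm => ?_
    have hcm := hM.2 m (Finset.mem_range.1 hm)
    rw [Finset.bipartiteAbove]
    have : (Finset.range M).filter (fun c => c < code f m) = Finset.range (code f m) := by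
      ext c
      simp only [Finset.mem_filter, Finset.mem_range]
      omega
    rw [this, Finset.card_range]
  have hcard : μ.cells.card = ∑ c ∈ Finset.range M, (μ.cells.filter (fun x => x.2 = c)).card :=
    Finset.card_eq_sum_card_fiberwise (fun x hx => by simpa using hM.1 x hx)
  have hinv : invNum f = ∑ m ∈ Finset.range N, code f m := by
    rw [← ncard_rotheDiagram, ← hR, Set.ncard_coe_finset]
    exact card_rotheDiagram_eq_sum_code hR hN.1
  have hsub : ∀ c, T c ⊆ (Finset.range N).filter (fun m => c < code f m) := by
    intro c m hm
    have := hT' c m hm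
    simp only [Finset.mem_filter, Finset.mem_range]
    omega
  have hle : ∀ c ∈ Finset.range M, (μ.cells.filter (fun x => x.2 = c)).card ≤
      ((Finset.range N).filter (fun m => c < code f m)).card := fun c _ =>
    (hT c).trans (Finset.card_le_card (hsub c))
  refine ⟨?_, ?_⟩
  · rw [hinv, hsum, hcard]
    exact Finset.sum_le_sum hle
  · intro heq m c hc
    have hmN : m < N := by
      have hpos : 0 < code f m := by omega
      obtain ⟨v, hv⟩ := Finset.card_pos.1 hpos
      simp only [Finset.mem_filter, Finset.mem_range] at hv
      have : (m, v) ∈ rotheDiagram f := mem_rotheDiagram.2 hv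
      rw [← hR] at this
      exact hN.1 _ this
    have hcM : c < M := hc.trans_le (hM.2 m hmN)
    rw [hinv, hsum, hcard] at heq
    have h1 := (Finset.sum_eq_sum_iff_of_le hle).1 heq.symm c (Finset.mem_range.2 hcM)
    have h2 : T c = (Finset.range N).filter (fun m => c < code f m) :=
      Finset.eq_of_subset_of_card_le (hsub c) (h1 ▸ hT c)
    have h3 : m ∈ T c := by
      rw [h2]
      simp [hmN, hc]
    exact (hT' c m h3).2.2

/-- If the rank conditions are satisfied with the least possible number of inversions, then the
first `k` values are fixed and all boxes of `μ`, shifted by `k`, are in the Rothe diagram. -/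
theorem eq_of_invNum_eq {lam : YoungDiagram} {k : ℕ} {w : List ℕ}
    (h : ∀ x ∈ lam.cells, rankFn (wordProd w) (x.1 + 1) (x.2 + 1) ≤ k)
    (heq : invNum (wordProd w) = (removeHook lam k).cells.card) {σ : Equiv.Perm ℕ}
    (hσ : ∀ i j, (i, j) ∈ rotheDiagram σ ↔
      k ≤ i ∧ k ≤ j ∧ (i - k, j - k) ∈ (removeHook lam k).cells) :
    wordProd w = σ := by
  have hcode := (card_le_invNum h).2 heq
  set f := wordProd w
  -- a position before `k` has code zero, since a positive code forces a value of at least `k`, and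
  -- then a code larger than that value minus `k`
  have hle : ∀ m < k, f m ≤ m := by
    intro m hm
    have h1 := apply_le_add_code f m
    rcases Nat.eq_zero_or_pos (code f m) with h0 | h0
    · omega
    · have := hcode m (code f m - 1) (by omega)
      omega
  have hfix : ∀ m < k, f m = m := by
    intro m
    induction m using Nat.strong_induction_on with
    | _ m ih =>
      intro hm
      by_contra hne
      have h1 := hle m hm
      have h2 := ih (f m) (by omega) (by omega)
      exact hne (f.injective h2)
  have hsub : rotheDiagram σ ⊆ rotheDiagram f := by
    rintro ⟨i, j⟩ hij
    obtain ⟨hi, hj, hm⟩ := (hσ i j).1 hij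
    obtain ⟨i, rfl⟩ := Nat.exists_eq_add_of_le' hi
    obtain ⟨j, rfl⟩ := Nat.exists_eq_add_of_le' hj
    rw [Nat.add_sub_cancel, Nat.add_sub_cancel, mem_removeHook] at hm
    have hr := h _ hm
    simp only [rankFn] at hr
    -- the fixed values `0, …, k - 1` exhaust the rank condition at this box
    have key : (Finset.range (i + k + 1)).filter (fun m => f m < j + k + 1) = Finset.range k := by
      refine (Finset.eq_of_subset_of_card_le (fun m hm => ?_) (by simpa using hr)).symm
      have hm := Finset.mem_range.1 hm
      simp only [Finset.mem_filter, Finset.mem_range]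
      have := hfix m hm
      omega
    have hmem : ∀ m, m < i + k + 1 → f m < j + k + 1 → m < k := by
      intro m h1 h2
      rw [← Finset.mem_range, ← key]
      exact Finset.mem_filter.2 ⟨Finset.mem_range.2 h1, h2⟩
    rw [mem_rotheDiagram]
    constructor
    · by_contra hc
      have := hmem (i + k) (by omega) (by omega)
      omega
    · by_contra hc
      have h1 := hmem (f.symm (j + k)) (by omega) (by simp)
      have h2 := hfix _ h1
      rw [Equiv.apply_symm_apply] at h2
      omega
  refine (eq_of_rotheDiagram_eq (Set.eq_of_subset_of_ncard_le hsub ?_ (rotheDiagram_finite w))).symm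
  rw [ncard_rotheDiagram, heq, ← Set.ncard_coe_finset]
  refine Set.ncard_le_ncard_of_injOn (fun x => (x.1 + k, x.2 + k)) ?_ ?_
    ((rotheDiagram_finite w).subset hsub)
  · rintro ⟨i, j⟩ hx
    rw [hσ]
    simpa using hx
  · rintro ⟨i, j⟩ - ⟨i', j'⟩ - hx
    simp only [Prod.mk.injEq, Nat.add_right_cancel_iff] at hx
    rw [hx.1, hx.2]

/-- The complement of a filling that avoids chains of length `k + 1` satisfies the rank conditions,
hence has at least as many boxes as `μ`, with equality only for reduced pipe dreams of `σ`. Since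
there is such a pipe dream, these are the complements of the maximal fillings. -/
theorem bijOn_complementary {lam : YoungDiagram} {k n : ℕ} (hn : lam.cells ⊆ staircase n)
    {σ : Equiv.Perm ℕ} (hσ : ∀ i j, (i, j) ∈ rotheDiagram σ ↔
      k ≤ i ∧ k ≤ j ∧ (i - k, j - k) ∈ (removeHook lam k).cells)
    (hne : (reducedPipeDreams n σ).Nonempty) :
    Set.BijOn (complementary lam) (neFillings lam k) (reducedPipeDreams n σ) := by
  have hrothe : ∀ i j, (i, j) ∈ rotheDiagram σ → (i, j) ∈ lam.cells := by
    intro i j hij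
    obtain ⟨hi, hj, hm⟩ := (hσ i j).1 hij
    rwa [mem_removeHook, Nat.sub_add_cancel hi, Nat.sub_add_cancel hj] at hm
  have hrank : ∀ x ∈ lam.cells, rankFn σ (x.1 + 1) (x.2 + 1) ≤ k := by
    rintro ⟨i, j⟩ hx
    have hsub : (Finset.range (i + 1)).filter (fun m => σ m < j + 1) ⊆ Finset.range k := by
      intro m hm
      simp only [Finset.mem_filter, Finset.mem_range] at hm ⊢
      by_contra hmk
      have hvk : σ m < k := by
        by_contra hvk
        have h1 := (hσ m (σ m)).2 ⟨by omega, by omega, by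
          rw [mem_removeHook, Nat.sub_add_cancel (by omega), Nat.sub_add_cancel (by omega)]
          exact mem_cells_of_le hx (by simp only; omega) (by simp only; omega)⟩
        rw [mem_rotheDiagram] at h1
        omega
      -- a value below `k` behind position `k` gives an inversion in a column below `k`
      obtain ⟨m', hm', hv⟩ : ∃ m' < k, k ≤ σ m' := by
        by_contra hc
        push Not at hc
        have hinj : Set.InjOn σ (insert m (Finset.range k) : Finset ℕ) := σ.injective.injOn
        have := Finset.card_le_card_of_injOn (s := insert m (Finset.range k))
          (t := Finset.range k) σ (fun y hy => by
            simp only [Finset.coe_insert, Finset.coe_range, Set.mem_insert_iff, Set.mem_Iio] at hy ⊢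
            rcases hy with rfl | hy
            · exact hvk
            · exact hc y hy) hinj
        rw [Finset.card_insert_of_notMem (by simpa using hmk), Finset.card_range] at this
        omega
      have h2 : (m', σ m) ∈ rotheDiagram σ :=
        mem_rotheDiagram.2 ⟨by omega, by rw [Equiv.symm_apply_apply]; omega⟩
      have := (hσ _ _).1 h2
      omega
    have := Finset.card_le_card hsub
    rwa [Finset.card_range] at this
  have hsub : ∀ D ∈ reducedPipeDreams n σ, D ⊆ lam.cells := by
    rintro D hD ⟨i, j⟩ hx
    rw [mem_reducedPipeDreams] at hD
    obtain ⟨a, p, h1, h2, h3⟩ := exists_rothe_of_mem pairwise_readingBiword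
      (fun _ _ => Nat.zero_le _) (readingBiword_le hD.1) hD.2.1
      ((mem_readingBiword hD.1 (a := i) (b := i + j)).2 ⟨j, hx, rfl⟩)
    rw [hD.2.2] at h1
    exact mem_cells_of_le (hrothe _ _ h1) h2 (by simp only; omega)
  have hlen : ∀ D : Finset Box, D ⊆ staircase n →
      ((readingBiword n D).map Prod.snd).length = D.card := by
    intro D hD
    rw [List.length_map, ← List.toFinset_card_of_nodup (nodup_of_pairwise_biLt
      pairwise_readingBiword)]
    refine Finset.card_bij' (fun x _ => (x.1, x.2 - x.1)) (fun x _ => (x.1, x.1 + x.2)) ?_ ?_ ?_ ?_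
    · rintro ⟨a, b⟩ hx
      obtain ⟨j, hj, rfl⟩ := (mem_readingBiword hD).1 (List.mem_toFinset.1 hx)
      simpa using hj
    · rintro ⟨a, b⟩ hx
      exact List.mem_toFinset.2 ((mem_readingBiword hD).2 ⟨b, hx, rfl⟩)
    · rintro ⟨a, b⟩ hx
      obtain ⟨j, hj, rfl⟩ := (mem_readingBiword hD).1 (List.mem_toFinset.1 hx)
      simp
    · rintro ⟨a, b⟩ hx
      simp
  have hcc : ∀ F ⊆ lam.cells, (complementary lam F).card + F.card = lam.cells.card :=
    fun F hF => Finset.card_sdiff_add_card_eq_card hF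
  have lower : ∀ G, AvoidsNE lam k G →
      (removeHook lam k).cells.card ≤ (complementary lam G).card ∧
      ((complementary lam G).card = (removeHook lam k).cells.card →
        complementary lam G ∈ reducedPipeDreams n σ) := by
    intro G hG
    have hD : complementary lam G ⊆ staircase n := Finset.sdiff_subset.trans hn
    have h1 := (avoidsNE_iff hn hG.1).1 hG
    obtain ⟨v, hv, hr, hp⟩ := exists_sublist_demazure
      ((readingBiword n (complementary lam G)).map Prod.snd)
    rw [← hp] at h1
    have h2 := (card_le_invNum h1).1
    have h3 := red_iff_invNum_eq.1 hr
    have h4 := hv.length_le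
    rw [hlen _ hD] at h4
    refine ⟨by omega, fun he => ?_⟩
    have h5 := hv.eq_of_length (by rw [hlen _ hD]; omega)
    rw [mem_reducedPipeDreams, ← h5]
    exact ⟨hD, hr, eq_of_invNum_eq h1 (by omega) hσ⟩
  have hmem : ∀ D ∈ reducedPipeDreams n σ, AvoidsNE lam k (lam.cells \ D) ∧
      complementary lam (lam.cells \ D) = D ∧ D.card = (removeHook lam k).cells.card := by
    intro D hD
    have hDl := hsub D hD
    have hcomp : complementary lam (lam.cells \ D) = D := by
      rw [complementary, Finset.sdiff_sdiff_eq_self hDl]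
    rw [mem_reducedPipeDreams] at hD
    refine ⟨?_, hcomp, ?_⟩
    · rw [avoidsNE_iff hn Finset.sdiff_subset, hcomp, demazure_of_asc (red_iff_asc.1 hD.2.1),
        hD.2.2]
      exact hrank
    · rw [← hlen D hD.1, ← red_iff_invNum_eq.1 hD.2.1, hD.2.2, ← ncard_rotheDiagram,
        ← Set.ncard_coe_finset]
      symm
      refine Set.ncard_congr (fun x _ => (x.1 + k, x.2 + k)) ?_ ?_ ?_
      · rintro ⟨i, j⟩ hx
        rw [hσ]
        simpa using hx
      · rintro ⟨i, j⟩ ⟨i', j'⟩ - - hx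
        simp only [Prod.mk.injEq, Nat.add_right_cancel_iff] at hx
        rw [hx.1, hx.2]
      · rintro ⟨i, j⟩ hx
        obtain ⟨h1, h2, h3⟩ := (hσ i j).1 hx
        exact ⟨_, h3, by rw [Nat.sub_add_cancel h1, Nat.sub_add_cancel h2]⟩
  obtain ⟨D₀, hD₀⟩ := hne
  refine ⟨?_, ?_, ?_⟩
  · rintro F ⟨hF, hmax⟩
    obtain ⟨h1, h2, h3⟩ := hmem D₀ hD₀
    have h4 := hmax _ h1
    have h5 := hcc _ h1.1
    have h6 := hcc _ hF.1
    rw [h2] at h5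
    have h7 := lower F hF
    exact h7.2 (by omega)
  · intro F hF G hG h
    have h1 : lam.cells \ (lam.cells \ F) = lam.cells \ (lam.cells \ G) := congrArg _ h
    rwa [Finset.sdiff_sdiff_eq_self hF.1.1, Finset.sdiff_sdiff_eq_self hG.1.1] at h1
  · intro D hD
    obtain ⟨h1, h2, h3⟩ := hmem D hD
    refine ⟨lam.cells \ D, ⟨h1, fun G hG => ?_⟩, h2⟩
    have h5 := hcc _ h1.1
    have h6 := hcc _ hG.1
    have h7 := (lower G hG).1
    rw [h2] at h5
    omega


/-! ### The dominant permutation of a shape -/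

/-- The column reading word of a tableau given by its columns: from the last column to the first,
each from top to bottom. -/
def readTab : List (List ℕ) → List ℕ
  | [] => []
  | C :: P => readTab P ++ C

/-- The tableau with column lengths `hs` and entry `k + i + j` in the box `(i, j)`. -/
def minTab : ℕ → List ℕ → List (List ℕ)
  | _, [] => []
  | k, h :: hs => List.range' k h :: minTab (k + 1) hs

theorem readTab_minTab_add (k m : ℕ) (hs : List ℕ) :
    readTab (minTab (m + k) hs) = (readTab (minTab m hs)).map (· + k) := by
  induction hs generalizing m with
  | nil => rfl
  | cons h hs ih =>
    have h1 : (List.range' m h).map (· + k) = List.range' (m + k) h := by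
      rw [show (fun x => x + k) = (k + ·) from funext fun x => Nat.add_comm x k,
        List.map_add_range', Nat.add_comm]
    rw [minTab, readTab, minTab, readTab, List.map_append, ← ih, Nat.add_right_comm, h1]

theorem mem_readTab_minTab {k b : ℕ} {hs : List ℕ} (h : b ∈ readTab (minTab k hs)) :
    ∃ i j, i < hs.getD j 0 ∧ b = k + i + j := by
  induction hs generalizing k with
  | nil => simp [minTab, readTab] at h
  | cons a hs ih =>
    rw [minTab, readTab, List.mem_append] at h
    rcases h with h | h
    · obtain ⟨i, j, h1, h2⟩ := ih h
      exact ⟨i, j + 1, by simpa using h1, by omega⟩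
    · rw [List.mem_range'_1] at h
      exact ⟨b - k, 0, by simp; omega, by omega⟩

theorem length_readTab_minTab (k : ℕ) (hs : List ℕ) :
    (readTab (minTab k hs)).length = hs.sum := by
  induction hs generalizing k with
  | nil => rfl
  | cons h hs ih =>
    rw [minTab, readTab, List.length_append, ih, List.length_range', List.sum_cons, Nat.add_comm]

theorem shiftPerm_apply (k : ℕ) (τ : Equiv.Perm ℕ) (m : ℕ) :
    shiftPerm k τ m = if m < k then m else τ (m - k) + k := rfl

theorem shiftPerm_symm_apply (k : ℕ) (τ : Equiv.Perm ℕ) (m : ℕ) :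
    (shiftPerm k τ).symm m = if m < k then m else τ.symm (m - k) + k := rfl

theorem wordProd_map_add (k : ℕ) (w : List ℕ) :
    wordProd (w.map (· + k)) = shiftPerm k (wordProd w) := by
  induction w with
  | nil =>
    ext m
    rw [List.map_nil, wordProd_nil, shiftPerm_apply]
    split_ifs
    · rfl
    · simp only [Equiv.Perm.one_apply]
      omega
  | cons b w ih =>
    ext m
    rw [List.map_cons, wordProd_cons, wordProd_cons, ih, Equiv.Perm.mul_apply, shiftPerm_apply,
      shiftPerm_apply]
    split_ifs with h
    · rw [Equiv.swap_apply_of_ne_of_ne] <;> omega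
    · rw [Equiv.Perm.mul_apply, Equiv.swap_apply_def, Equiv.swap_apply_def]
      split_ifs <;> omega

theorem wordProd_range'_apply (h m : ℕ) :
    wordProd (List.range' 0 h) m = if m < h then m + 1 else if m = h then 0 else m := by
  induction h generalizing m with
  | zero =>
    simp only [List.range'_zero, wordProd_nil, Equiv.Perm.one_apply]
    split_ifs <;> omega
  | succ h ih =>
    rw [List.range'_concat, wordProd_concat, Equiv.Perm.mul_apply, ih, Nat.zero_add, Nat.one_mul,
      Equiv.swap_apply_def]
    split_ifs <;> omega

theorem wordProd_range'_symm_apply (h v : ℕ) :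
    (wordProd (List.range' 0 h)).symm v = if v = 0 then h else if v ≤ h then v - 1 else v := by
  rw [Equiv.symm_apply_eq, wordProd_range'_apply]
  split_ifs <;> omega

/-- The reading word of the tableau with entries `i + j` represents the permutation whose Rothe
diagram is the shape. Prepending a column of length `h` to the shape makes `0` the value at
position `h`. -/
theorem mem_rotheDiagram_minTab {hs : List ℕ} (hp : hs.Pairwise (· ≥ ·)) (i v : ℕ) :
    (i, v) ∈ rotheDiagram (wordProd (readTab (minTab 0 hs))) ↔ i < hs.getD v 0 := by
  induction hs generalizing i v with
  | nil =>
    rw [minTab, readTab, wordProd_nil, mem_rotheDiagram]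
    simp only [Equiv.Perm.one_apply, List.getD_nil, Nat.not_lt_zero, iff_false, not_and]
    intro h
    change ¬ i < v
    omega
  | cons h hs ih =>
    rw [List.pairwise_cons] at hp
    rw [minTab, readTab, readTab_minTab_add 1 0, wordProd_append, wordProd_map_add,
      mem_rotheDiagram]
    set τ := wordProd (readTab (minTab 0 hs))
    have e1 : ∀ m, (shiftPerm 1 τ * wordProd (List.range' 0 h)) m =
      shiftPerm 1 τ (wordProd (List.range' 0 h) m) := fun m => rfl
    have e2 : ∀ m, (shiftPerm 1 τ * wordProd (List.range' 0 h)).symm m =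
      (wordProd (List.range' 0 h)).symm ((shiftPerm 1 τ).symm m) := fun m => rfl
    rw [e1, e2, wordProd_range'_apply, wordProd_range'_symm_apply, shiftPerm_apply,
      shiftPerm_symm_apply]
    cases v with
    | zero =>
      simp only [List.getD_cons_zero]
      split_ifs <;> omega
    | succ v =>
      have hle : hs.getD v 0 ≤ h := by
        rcases Nat.lt_or_ge v hs.length with hv | hv
        · rw [List.getD_eq_getElem _ _ hv]
          exact hp.1 _ (List.getElem_mem hv)
        · rw [List.getD_eq_default _ _ hv]
          exact Nat.zero_le _
      have h1 := ih hp.2 i v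
      have h2 := ih hp.2 (i - 1) v
      rw [mem_rotheDiagram] at h1 h2
      simp only [List.getD_cons_succ, show ¬ (v + 1 < 1) by omega, if_false, Nat.add_sub_cancel,
        Nat.add_one_ne_zero]
      have e3 : i + 1 - 1 = i := rfl
      rcases lt_trichotomy i h with hi | hi | hi
      · simp only [hi, if_true, show ¬ (i + 1 < 1) by omega, if_false, e3]
        split_ifs <;> omega
      · subst hi
        simp only [lt_irrefl, if_true, if_false, show (0 : ℕ) < 1 by omega]
        omega
      · simp only [show ¬ i < h by omega, show ¬ i = h by omega, show ¬ i < 1 by omega, if_false]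
        split_ifs <;> omega

/-- The column lengths of a Young diagram. -/
def colLens (μ : YoungDiagram) : List ℕ := (List.range (μ.rowLen 0)).map μ.colLen

theorem colLens_getD (μ : YoungDiagram) (j : ℕ) : (colLens μ).getD j 0 = μ.colLen j := by
  rcases Nat.lt_or_ge j (μ.rowLen 0) with h | h
  · rw [List.getD_eq_getElem _ _ (by simpa [colLens] using h)]
    simp [colLens]
  · rw [List.getD_eq_default _ _ (by simpa [colLens] using h)]
    by_contra hne
    have : (0, j) ∈ μ := YoungDiagram.mem_iff_lt_colLen.2 (by omega)
    rw [YoungDiagram.mem_iff_lt_rowLen] at this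
    omega

theorem lt_colLens_getD {μ : YoungDiagram} {i j : ℕ} :
    i < (colLens μ).getD j 0 ↔ (i, j) ∈ μ.cells := by
  rw [colLens_getD, YoungDiagram.mem_cells, YoungDiagram.mem_iff_lt_colLen]

theorem colLens_pairwise (μ : YoungDiagram) : (colLens μ).Pairwise (· ≥ ·) := by
  rw [colLens, List.pairwise_map]
  exact (List.pairwise_lt_range (n := μ.rowLen 0)).imp fun h => μ.colLen_anti _ _ h.le

/-- The permutation whose Rothe diagram is the shape. -/
def dominantPerm (μ : YoungDiagram) : Equiv.Perm ℕ := wordProd (readTab (minTab 0 (colLens μ)))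

theorem rotheDiagram_dominantPerm (μ : YoungDiagram) :
    rotheDiagram (dominantPerm μ) = (μ.cells : Set Box) := by
  ext ⟨i, j⟩
  rw [dominantPerm, mem_rotheDiagram_minTab (colLens_pairwise μ), lt_colLens_getD, Finset.mem_coe]

/-- Existence and uniqueness of the permutation in `S_n` with Rothe diagram `μ`. -/
theorem isDominantOf_iff {n : ℕ} {μ : YoungDiagram} (hμ : μ.cells ⊆ staircase n)
    {τ : Equiv.Perm ℕ} : IsDominantOf n μ τ ↔ τ = dominantPerm μ := by
  constructor
  · rintro ⟨-, h⟩
    exact eq_of_rotheDiagram_eq (h.trans (rotheDiagram_dominantPerm μ).symm)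
  · rintro rfl
    refine ⟨fun m hm => ?_, rotheDiagram_dominantPerm μ⟩
    have hlt : ∀ b ∈ readTab (minTab 0 (colLens μ)), b + 1 < n := by
      intro b hb
      obtain ⟨i, j, h1, rfl⟩ := mem_readTab_minTab hb
      have := mem_staircase.1 (hμ (lt_colLens_getD.1 h1))
      simp only at this
      omega
    rcases Nat.eq_zero_or_pos m with rfl | hpos
    · have : readTab (minTab 0 (colLens μ)) = [] := by
        rw [List.eq_nil_iff_forall_not_mem]
        intro b hb
        have := hlt b hb
        omega
      rw [dominantPerm, this, wordProd_nil]
      rfl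
    · refine wordProd_apply_of_gt (β := m - 1) ?_ (by omega)
      intro b hb
      have := hlt b hb
      omega

theorem wordProd_readTab_minTab (k : ℕ) (μ : YoungDiagram) :
    wordProd (readTab (minTab k (colLens μ))) = shiftPerm k (dominantPerm μ) := by
  rw [← Nat.zero_add k, readTab_minTab_add, wordProd_map_add, Nat.zero_add]
  rfl

theorem mem_rotheDiagram_shiftPerm_dominantPerm {k : ℕ} {μ : YoungDiagram} {i j : ℕ} :
    (i, j) ∈ rotheDiagram (shiftPerm k (dominantPerm μ)) ↔
      k ≤ i ∧ k ≤ j ∧ (i - k, j - k) ∈ μ.cells := by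
  rw [rotheDiagram_shiftPerm, rotheDiagram_dominantPerm, Finset.mem_coe]

theorem invNum_shiftPerm_dominantPerm (k : ℕ) (μ : YoungDiagram) :
    invNum (shiftPerm k (dominantPerm μ)) = μ.cells.card := by
  rw [← ncard_rotheDiagram, ← Set.ncard_coe_finset]
  symm
  refine Set.ncard_congr (fun x _ => (x.1 + k, x.2 + k)) ?_ ?_ ?_
  · rintro ⟨i, j⟩ hx
    rw [mem_rotheDiagram_shiftPerm_dominantPerm]
    simpa using hx
  · rintro ⟨i, j⟩ ⟨i', j'⟩ - - hx
    simp only [Prod.mk.injEq, Nat.add_right_cancel_iff] at hx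
    rw [hx.1, hx.2]
  · rintro ⟨i, j⟩ hx
    obtain ⟨h1, h2, h3⟩ := mem_rotheDiagram_shiftPerm_dominantPerm.1 hx
    exact ⟨_, h3, by rw [Nat.sub_add_cancel h1, Nat.sub_add_cancel h2]⟩


/-! ### Column insertion into one column -/

theorem wordProd_append_append (u v w : List ℕ) :
    wordProd (u ++ v ++ w) = wordProd u * wordProd v * wordProd w := by
  rw [wordProd_append, wordProd_append]

theorem swap_mul_swap_comm {b x : ℕ} (h : b + 2 ≤ x ∨ x + 2 ≤ b) :
    Equiv.swap b (b + 1) * Equiv.swap x (x + 1) = Equiv.swap x (x + 1) * Equiv.swap b (b + 1) := by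
  refine (Equiv.Perm.disjoint_swap_swap ?_).commute.eq
  simp
  omega

theorem wordProd_concat_eq_cons {L : List ℕ} {x : ℕ} (h : ∀ l ∈ L, l + 2 ≤ x ∨ x + 2 ≤ l) :
    wordProd (L ++ [x]) = wordProd (x :: L) := by
  induction L with
  | nil => rfl
  | cons l L ih =>
    rw [List.cons_append, wordProd_cons, ih fun c hc => h c (by simp [hc]), wordProd_cons,
      wordProd_cons, wordProd_cons, ← mul_assoc, ← mul_assoc,
      swap_mul_swap_comm (h l (by simp))]

theorem wordProd_append_comm {L M : List ℕ} (h : ∀ l ∈ L, ∀ m ∈ M, l + 2 ≤ m ∨ m + 2 ≤ l) :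
    wordProd (L ++ M) = wordProd (M ++ L) := by
  induction M with
  | nil => simp
  | cons m M ih =>
    have h1 := ih fun l hl c hc => h l hl c (by simp [hc])
    have h2 := wordProd_concat_eq_cons fun l hl => h l hl m (by simp)
    rw [show L ++ m :: M = (L ++ [m]) ++ M by simp, wordProd_append, h2, ← wordProd_append,
      List.cons_append, wordProd_cons, h1, ← wordProd_cons, List.cons_append]

theorem wordProd_braid (x : ℕ) : wordProd [x, x + 1, x] = wordProd [x + 1, x, x + 1] := by
  ext m
  simp only [wordProd_cons, wordProd_nil, mul_one, Equiv.Perm.mul_apply]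
  simp only [Equiv.swap_apply_def]
  split_ifs <;> omega

theorem not_red_of_commute {u : List ℕ} {x : ℕ} (L R : List ℕ)
    (h : ∀ l ∈ L, l + 2 ≤ x ∨ x + 2 ≤ l) (hu : u = x :: L ++ x :: R) : ¬ Red u := by
  intro hr
  have h1 := hr (L ++ R) (by
    rw [hu, show x :: L ++ x :: R = (x :: L) ++ [x] ++ R by simp, wordProd_append_append,
      ← wordProd_concat_eq_cons h, wordProd_concat, wordProd_append]
    simp [wordProd])
  rw [hu] at h1
  simp only [List.length_append, List.length_cons] at h1
  omega

/-- The number of entries of a column that are smaller than `v`. -/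
def cnt (C : List ℕ) (v : ℕ) : ℕ := C.countP (· < v)

theorem cnt_append (C D : List ℕ) (v : ℕ) : cnt (C ++ D) v = cnt C v + cnt D v :=
  List.countP_append

theorem cnt_cons (c : ℕ) (C : List ℕ) (v : ℕ) :
    cnt (c :: C) v = cnt C v + if c < v then 1 else 0 := by
  rw [cnt, List.countP_cons]
  simp [cnt]

theorem cnt_nil (v : ℕ) : cnt [] v = 0 := rfl

theorem cnt_mono (C : List ℕ) {v w : ℕ} (h : v ≤ w) : cnt C v ≤ cnt C w :=
  List.countP_mono_left fun c _ hc => by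
    simp only [decide_eq_true_eq] at hc ⊢
    omega

theorem cnt_le_of_forall {C : List ℕ} {v w : ℕ} (h : ∀ c ∈ C, c < v → c < w) :
    cnt C v ≤ cnt C w :=
  List.countP_mono_left fun c hm hc => by
    simp only [decide_eq_true_eq] at hc ⊢
    exact h c hm hc

theorem cnt_lt_of_mem {C : List ℕ} {v : ℕ} (h : v ∈ C) : cnt C v + 1 ≤ cnt C (v + 1) := by
  obtain ⟨L, R, rfl⟩ := List.append_of_mem h
  simp only [cnt_append, cnt_cons]
  have h1 := cnt_mono L (Nat.le_succ v)
  have h2 := cnt_mono R (Nat.le_succ v)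
  simp only [Nat.succ_eq_add_one] at h1 h2
  split_ifs <;> omega

theorem cnt_le_length (C : List ℕ) (v : ℕ) : cnt C v ≤ C.length := List.countP_le_length

theorem cnt_eq_length {C : List ℕ} {v : ℕ} (h : ∀ c ∈ C, c < v) : cnt C v = C.length :=
  List.countP_eq_length.2 fun c hc => by simpa using h c hc

theorem cnt_add_le {C : List ℕ} (hC : C.Pairwise (· < ·)) {k v : ℕ} (hk : ∀ c ∈ C, k ≤ c)
    (hv : k ≤ v) : cnt C v + k ≤ v := by
  have h1 : cnt C v = (C.filter (· < v)).toFinset.card := by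
    rw [List.toFinset_card_of_nodup ((hC.imp fun h => ne_of_lt h).filter _), cnt,
      List.countP_eq_length_filter]
  have h2 : (C.filter (· < v)).toFinset ⊆ Finset.Ico k v := by
    intro c hc
    simp only [List.mem_toFinset, List.mem_filter, decide_eq_true_eq] at hc
    exact Finset.mem_Ico.2 ⟨hk c hc.1, hc.2⟩
  have h3 := Finset.card_le_card h2
  rw [Nat.card_Ico] at h3
  omega

/-- Inserting `x` into the strictly increasing column `C` gives the column `E` and bumps `y`. Either
`x` takes the place of `y`, or `x` and `y = x + 1` are both in the column. -/
inductive Bump (x : ℕ) (C E : List ℕ) (y : ℕ) : Prop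
  | replace (L R : List ℕ) (hC : C = L ++ y :: R) (hE : E = L ++ x :: R)
      (hL : ∀ l ∈ L, l < x) (hR : ∀ r ∈ R, y < r) (hxy : x < y)
  | keep (L R : List ℕ) (hC : C = L ++ x :: y :: R) (hE : E = C) (hL : ∀ l ∈ L, l < x)
      (hR : ∀ r ∈ R, y < r) (hxy : y = x + 1)

namespace Bump
variable {x y : ℕ} {C E : List ℕ}

theorem lt (h : Bump x C E y) : x < y := by
  cases h <;> omega

theorem length_eq (h : Bump x C E y) : E.length = C.length := by
  cases h <;> simp_all

theorem mem (h : Bump x C E y) : x ∈ E := by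
  cases h <;> simp_all

theorem mem_left (h : Bump x C E y) : y ∈ C := by
  cases h <;> simp_all

theorem le_or_le (h : Bump x C E y) {c : ℕ} (hc : c ∈ C) : c ≤ x ∨ y ≤ c := by
  cases h with
  | replace L R hC hE hL hR hxy =>
    rw [hC, List.mem_append, List.mem_cons] at hc
    rcases hc with hc | rfl | hc
    · exact Or.inl (hL c hc).le
    · exact Or.inr le_rfl
    · exact Or.inr (hR c hc).le
  | keep L R hC hE hL hR hxy => omega

theorem eq_succ_of_mem (h : Bump x C E y) (hx : x ∈ C) : y = x + 1 := by
  cases h with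
  | replace L R hC hE hL hR hxy =>
    rw [hC, List.mem_append, List.mem_cons] at hx
    rcases hx with hx | rfl | hx
    · have := hL x hx
      omega
    · omega
    · have := hR x hx
      omega
  | keep L R hC hE hL hR hxy => exact hxy

theorem le_of_lt (h : Bump x C E y) {e : ℕ} (he : e ∈ E) (hx : x < e) :
    y < e ∨ (e = y ∧ y = x + 1) := by
  cases h with
  | replace L R hC hE hL hR hxy =>
    rw [hE, List.mem_append, List.mem_cons] at he
    rcases he with he | rfl | he
    · have := hL e he
      omega
    · omega
    · exact Or.inl (hR e he)
  | keep L R hC hE hL hR hxy => omega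

theorem pairwise_right (h : Bump x C E y) (hC' : C.Pairwise (· < ·)) : E.Pairwise (· < ·) := by
  cases h with
  | replace L R hC hE hL hR hxy =>
    subst hC hE
    rw [List.pairwise_append, List.pairwise_cons] at hC' ⊢
    refine ⟨hC'.1, ⟨fun r hr => hxy.trans (hR r hr), hC'.2.1.2⟩, fun l hl r hr => ?_⟩
    rcases List.mem_cons.1 hr with rfl | hr
    · exact hL l hl
    · exact hC'.2.2 l hl r (by simp [hr])
  | keep L R hC hE hL hR hxy => rwa [hE]

theorem pairwise_left (h : Bump x C E y) (hE' : E.Pairwise (· < ·)) : C.Pairwise (· < ·) := by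
  cases h with
  | replace L R hC hE hL hR hxy =>
    subst hC hE
    rw [List.pairwise_append, List.pairwise_cons] at hE' ⊢
    refine ⟨hE'.1, ⟨hR, hE'.2.1.2⟩, fun l hl r hr => ?_⟩
    rcases List.mem_cons.1 hr with rfl | hr
    · exact (hL l hl).trans hxy
    · exact hE'.2.2 l hl r (by simp [hr])
  | keep L R hC hE hL hR hxy => rwa [← hE]

/-- The bumped letter, moved to the front of the new column, gives the same product: this is a
sequence of commutations and, if `x` was in the column, one braid relation. -/
theorem wordProd_eq (h : Bump x C E y) : wordProd (C ++ [x]) = wordProd (y :: E) := by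
  cases h with
  | replace L R hC hE hL hR hxy =>
    subst hC hE
    have h1 : wordProd (R ++ [x]) = wordProd (x :: R) :=
      wordProd_concat_eq_cons fun r hr => by have := hR r hr; omega
    have h2 : wordProd (L ++ [y]) = wordProd (y :: L) :=
      wordProd_concat_eq_cons fun l hl => by have := hL l hl; omega
    rw [show L ++ y :: R ++ [x] = (L ++ [y]) ++ (R ++ [x]) by simp, wordProd_append, h1, h2,
      ← wordProd_append, List.cons_append]
  | keep L R hC hE hL hR hxy =>
    subst hE hC hxy
    have h1 : wordProd (R ++ [x]) = wordProd (x :: R) :=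
      wordProd_concat_eq_cons fun r hr => by have := hR r hr; omega
    have h2 : wordProd (L ++ [x + 1]) = wordProd ((x + 1) :: L) :=
      wordProd_concat_eq_cons fun l hl => by have := hL l hl; omega
    rw [show L ++ x :: (x + 1) :: R ++ [x] = (L ++ [x, x + 1]) ++ (R ++ [x]) by simp,
      wordProd_append, h1, ← wordProd_append,
      show L ++ [x, x + 1] ++ x :: R = L ++ [x, x + 1, x] ++ R by simp, wordProd_append_append,
      wordProd_braid, ← wordProd_append_append,
      show L ++ [x + 1, x, x + 1] ++ R = L ++ [x + 1] ++ (x :: (x + 1) :: R) by simp,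
      wordProd_append, h2, ← wordProd_append, List.cons_append]

theorem egColumn_eq (h : Bump x C E y) : egColumn x C = (E, some y) := by
  cases h with
  | replace L R hC hE hL hR hxy =>
    subst hC hE
    induction L with
    | nil => simp [egColumn, hxy]
    | cons l L ih =>
      have hl : l < x := hL l (by simp)
      rw [List.cons_append, egColumn, if_neg (by omega), if_neg (by omega),
        ih fun c hc => hL c (by simp [hc])]
      rfl
  | keep L R hC hE hL hR hxy =>
    subst hE hC hxy
    induction L with
    | nil => simp [egColumn]
    | cons l L ih =>
      have hl : l < x := hL l (by simp)
      rw [List.cons_append, egColumn, if_neg (by omega), if_neg (by omega),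
        ih fun c hc => hL c (by simp [hc])]

theorem cnt_right (h : Bump x C E y) :
    (x ∉ C ∧ ∀ v, cnt E v = cnt C v + if x < v ∧ v ≤ y then 1 else 0) ∨
      (E = C ∧ y = x + 1 ∧ x ∈ C ∧ y ∈ C) := by
  cases h with
  | replace L R hC hE hL hR hxy =>
    left
    subst hC hE
    refine ⟨fun hx => ?_, fun v => ?_⟩
    · rcases List.mem_append.1 hx with hx | hx
      · exact lt_irrefl _ (hL x hx)
      · rcases List.mem_cons.1 hx with rfl | hx
        · omega
        · have := hR x hx
          omega
    simp only [cnt_append, cnt_cons]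
    split_ifs <;> omega
  | keep L R hC hE hL hR hxy =>
    right
    subst hE hC
    exact ⟨rfl, hxy, by simp, by simp⟩

theorem inj {x' : ℕ} {C' : List ℕ} (h : Bump x C E y) (h' : Bump x' C' E y) :
    x = x' ∧ C = C' := by
  have notMem : ∀ {x L R}, E = L ++ x :: R → (∀ l ∈ L, l < x) → (∀ r ∈ R, y < r) → x < y →
      y ∉ E := by
    rintro x L R rfl hL hR hxy hy
    rcases List.mem_append.1 hy with hy | hy
    · have := hL y hy
      omega
    · rcases List.mem_cons.1 hy with rfl | hy
      · omega
      · exact lt_irrefl _ (hR y hy)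
  cases h with
  | replace L R hC hE hL hR hxy =>
    cases h' with
    | replace L' R' hC' hE' hL' hR' hxy' =>
      have hm : ∀ {x L R x' L' R'}, E = L ++ x :: R → E = L' ++ x' :: R' → (∀ l ∈ L, l < x) →
          (∀ r ∈ R, y < r) → x' < y → x' ≤ x := by
        rintro x L R x' L' R' h1 h2 hL hR hx'
        have h3 : x' ∈ E := by simp [h2]
        rw [h1, List.mem_append, List.mem_cons] at h3
        rcases h3 with h3 | rfl | h3
        · exact (hL _ h3).le
        · exact le_rfl
        · have := hR _ h3
          omega
      have hxx : x = x' := le_antisymm (hm hE' hE hL' hR' hxy) (hm hE hE' hL hR hxy')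
      subst hxx
      refine ⟨rfl, ?_⟩
      have hLL : ∀ {L L' R R' : List ℕ}, (∀ l ∈ L, l < x) → (∀ l ∈ L', l < x) →
          L ++ x :: R = L' ++ x :: R' → L = L' := by
        intro L
        induction L with
        | nil =>
          intro L' R R' h1 h2 h3
          cases L' with
          | nil => rfl
          | cons a L' =>
            simp only [List.nil_append, List.cons_append, List.cons.injEq] at h3
            have := h2 a (by simp)
            omega
        | cons b L ih =>
          intro L' R R' h1 h2 h3
          cases L' with
          | nil =>
            simp only [List.nil_append, List.cons_append, List.cons.injEq] at h3
            have := h1 b (by simp)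
            omega
          | cons a L' =>
            simp only [List.cons_append, List.cons.injEq] at h3
            rw [h3.1, ih (fun l hl => h1 l (by simp [hl])) (fun l hl => h2 l (by simp [hl])) h3.2]
      have h1 := hLL hL hL' (hE.symm.trans hE')
      subst h1
      have h2 := hE.symm.trans hE'
      simp only [List.append_cancel_left_eq, List.cons.injEq, true_and] at h2
      rw [hC, hC', h2]
    | keep L' R' hC' hE' hL' hR' hxy' =>
      exact absurd (show y ∈ E by rw [hE', hC']; simp) (notMem hE hL hR hxy)
  | keep L R hC hE hL hR hxy =>
    cases h' with
    | replace L' R' hC' hE' hL' hR' hxy' =>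
      exact absurd (show y ∈ E by rw [hE, hC]; simp) (notMem hE' hL' hR' hxy')
    | keep L' R' hC' hE' hL' hR' hxy' => exact ⟨by omega, hE.symm.trans hE'⟩

end Bump

theorem egColumn_of_forall_lt {C : List ℕ} {x : ℕ} (h : ∀ c ∈ C, c < x) :
    egColumn x C = (C ++ [x], none) := by
  induction C with
  | nil => rfl
  | cons c C ih =>
    have hc := h c (by simp)
    rw [egColumn, if_neg (by omega), if_neg (by omega), ih fun c hc => h c (by simp [hc])]
    rfl

/-- If the column followed by `x` is a reduced word, then inserting `x` appends it or bumps. -/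
theorem forall_lt_or_bump {C : List ℕ} {x : ℕ} (hC : C.Pairwise (· < ·)) (hr : Red (C ++ [x])) :
    (∀ c ∈ C, c < x) ∨ ∃ E y, Bump x C E y := by
  induction C with
  | nil => simp
  | cons c C ih =>
    rw [List.pairwise_cons] at hC
    rcases lt_trichotomy x c with hx | rfl | hx
    · exact Or.inr ⟨_, _, Bump.replace [] C rfl rfl (by simp) hC.1 hx⟩
    · by_cases hd : C.head? = some (x + 1)
      · obtain ⟨R, rfl⟩ : ∃ R, C = (x + 1) :: R := by
          cases C with
          | nil => simp at hd
          | cons a R => exact ⟨R, by simpa using hd⟩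
        exact Or.inr ⟨_, _, Bump.keep [] R rfl rfl (by simp) (List.pairwise_cons.1 hC.2).1 rfl⟩
      · refine absurd hr (not_red_of_commute (x := x) C [] (fun l hl => ?_) (by simp))
        right
        cases C with
        | nil => simp at hl
        | cons a R =>
          have h1 := hC.1 a (by simp)
          have h2 : a ≠ x + 1 := by simpa using hd
          rcases List.mem_cons.1 hl with rfl | hl
          · omega
          · have := (List.pairwise_cons.1 hC.2).1 l hl
            omega
    · rcases ih hC.2 (Red.right (u := [c]) hr) with h | ⟨E, y, h⟩
      · exact Or.inl fun a ha => by
          rcases List.mem_cons.1 ha with rfl | ha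
          · exact hx
          · exact h a ha
      · right
        have hl : ∀ {L : List ℕ}, (∀ l ∈ L, l < x) → ∀ l ∈ c :: L, l < x := by
          intro L hL l hl
          rcases List.mem_cons.1 hl with rfl | hl
          · exact hx
          · exact hL l hl
        cases h with
        | replace L R hC hE hL hR hxy =>
          exact ⟨_, _, Bump.replace (c :: L) R (by simp [hC]) rfl (hl hL) hR hxy⟩
        | keep L R hC hE hL hR hxy =>
          exact ⟨_, _, Bump.keep (c :: L) R (by simp [hC]) rfl (hl hL) hR hxy⟩

/-- Two strictly increasing columns can be adjacent in a tableau: the second one is not longer and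
its entries are larger than the neighbours to their left. This is expressed by counting the entries
below each bound. -/
def RowLt (C C' : List ℕ) : Prop := ∀ v, cnt C' (v + 1) ≤ cnt C v

theorem rowLt_nil (C : List ℕ) : RowLt C [] := fun _ => Nat.zero_le _

theorem RowLt.length_le {C C' : List ℕ} (h : RowLt C C') : C'.length ≤ C.length := by
  have h1 := h C'.sum
  rw [cnt_eq_length fun c hc => Nat.lt_succ_of_le (List.le_sum_of_mem hc)] at h1
  exact h1.trans (cnt_le_length _ _)

theorem RowLt.append_left {C C' : List ℕ} (h : RowLt C C') (x : ℕ) : RowLt (C ++ [x]) C' := by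
  intro v
  rw [cnt_append]
  exact (h v).trans (Nat.le_add_right _ _)

/-- Insertion into a column changes the next column `H` into `H'` by inserting `y`. -/
def Inserted (y : ℕ) (H H' : List ℕ) : Prop :=
  ((∀ c ∈ H, c < y) ∧ H' = H ++ [y]) ∨ ∃ z, Bump y H H' z

theorem Inserted.mem {y : ℕ} {H H' : List ℕ} (h : Inserted y H H') : y ∈ H' := by
  rcases h with ⟨-, rfl⟩ | ⟨z, h⟩
  · simp
  · exact h.mem

/-- Insertion keeps adjacent columns adjacent: the letter `y` bumped from the first column is
inserted into the second one. -/
theorem Bump.rowLt {x y : ℕ} {C E H H' : List ℕ} (h : Bump x C E y) (h' : Inserted y H H')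
    (hr : RowLt C H) : RowLt E H' := by
  have hlt := h.lt
  have hle : ∀ v, cnt C v ≤ cnt E v := by
    intro v
    rcases h.cnt_right with h1 | h1
    · rw [h1.2]
      exact Nat.le_add_right _ _
    · rw [h1.1]
  have hy := cnt_lt_of_mem h.mem_left
  -- in the interval where the next column gains an entry there is room for it
  have key : ∀ v, y ≤ v → cnt H (v + 1) ≤ cnt H y → cnt H (v + 1) + 1 ≤ cnt E v := by
    intro v hv hH
    have h4 := hr y
    have h5 := cnt_mono H (Nat.le_succ y)
    rw [Nat.succ_eq_add_one] at h5
    rcases h.cnt_right with h1 | ⟨rfl, rfl, h2, h3⟩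
    · rcases hv.lt_or_eq with hv | rfl
      · have := cnt_mono C (show y + 1 ≤ v from hv)
        have := hle v
        omega
      · have := h1.2 y
        rw [if_pos ⟨hlt, le_rfl⟩] at this
        omega
    · have h6 := hr x
      have h7 := cnt_lt_of_mem h2
      have h8 := cnt_mono E hv
      omega
  intro v
  have hv := (hr v).trans (hle v)
  rcases h' with ⟨h1, rfl⟩ | ⟨z, h1⟩
  · rw [cnt_append, cnt_cons, cnt_nil]
    split_ifs with h2
    · have := key v (by omega) (cnt_le_of_forall fun c hc _ => h1 c hc)
      omega
    · omega
  · rcases h1.cnt_right with h2 | h2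
    · rw [h2.2]
      split_ifs with h3
      · refine key v (by omega) (cnt_le_of_forall fun c hc hcv => ?_)
        have h4 := h1.le_or_le hc
        by_contra hcy
        have h5 : c = y := by omega
        exact h2.1 (h5 ▸ hc)
      · omega
    · rw [h2.1]
      exact hv

/-- Reverse insertion keeps adjacent columns adjacent. -/
theorem Bump.rowLt_left {x y : ℕ} {C E H H' : List ℕ} (h : Bump x C E y) (h' : Inserted y H H')
    (hr : RowLt E H') : RowLt C H := by
  have hlt := h.lt
  have hH : ∀ v, cnt H v ≤ cnt H' v := by
    intro v
    rcases h' with ⟨-, rfl⟩ | ⟨z, h1⟩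
    · rw [cnt_append]
      exact Nat.le_add_right _ _
    · rcases h1.cnt_right with h2 | h2
      · rw [h2.2]
        exact Nat.le_add_right _ _
      · rw [h2.1]
  have hy : cnt H (y + 1) + 1 ≤ cnt H' (y + 1) ∨ (H' = H ∧ y + 1 ∈ H) := by
    rcases h' with ⟨-, rfl⟩ | ⟨z, h1⟩
    · left
      rw [cnt_append, cnt_cons, cnt_nil, if_pos (Nat.lt_succ_self y)]
    · have := h1.lt
      rcases h1.cnt_right with h2 | h2
      · left
        rw [h2.2, if_pos (by omega)]
      · right
        exact ⟨h2.1, h2.2.1 ▸ h2.2.2.2⟩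
  intro v
  have hv := (hH (v + 1)).trans (hr v)
  cases h with
  | keep L R hC hE hL hR hxy => rwa [← hE]
  | replace L R hC hE hL hR hxy =>
    have h1 : ∀ v, cnt E v = cnt C v + if x < v ∧ v ≤ y then 1 else 0 := by
      intro v
      subst hC hE
      simp only [cnt_append, cnt_cons]
      split_ifs <;> omega
    have h2 : cnt E (y + 1) ≤ cnt E y := by
      refine cnt_le_of_forall fun c hc hcy => ?_
      rw [hE, List.mem_append, List.mem_cons] at hc
      rcases hc with hc | rfl | hc
      · exact (hL c hc).trans hxy
      · exact hxy
      · have := hR c hc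
        omega
    have h3 := h1 v
    split_ifs at h3 with h4
    · have h5 : cnt E y ≤ cnt E v := by
        refine cnt_le_of_forall fun c hc hcy => ?_
        rw [hE, List.mem_append, List.mem_cons] at hc
        rcases hc with hc | rfl | hc
        · exact (hL c hc).trans h4.1
        · exact h4.1
        · have := hR c hc
          omega
      have h6 := cnt_mono H (show v + 1 ≤ y + 1 by omega)
      have h7 := hr y
      rcases hy with hy | ⟨rfl, hy⟩
      · omega
      · have h8 := cnt_lt_of_mem hy
        have h9 := hr (y + 1)
        omega
    · omega


/-! ### Edelman–Greene insertion into a tableau -/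

/-- A tableau with strictly increasing rows and columns, given by its nonempty columns. -/
def IsTab : List (List ℕ) → Prop
  | [] => True
  | C :: P => C.Pairwise (· < ·) ∧ C ≠ [] ∧ RowLt C (P.headD []) ∧ IsTab P

/-- The length of column `j`. -/
def height (P : List (List ℕ)) (j : ℕ) : ℕ := (P.getD j []).length

theorem height_zero (P : List (List ℕ)) : height P 0 = (P.headD []).length := by
  cases P <;> rfl

theorem height_cons_zero (C : List ℕ) (P : List (List ℕ)) : height (C :: P) 0 = C.length := rfl

theorem height_cons_succ (C : List ℕ) (P : List (List ℕ)) (j : ℕ) :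
    height (C :: P) (j + 1) = height P j := rfl

theorem height_nil (j : ℕ) : height [] j = 0 := rfl

theorem egInsert_of_forall_lt {C : List ℕ} {x : ℕ} (P : List (List ℕ)) (h : ∀ c ∈ C, c < x) :
    egInsert x (C :: P) = ((C ++ [x]) :: P, (C.length, 0)) := by
  simp only [egInsert, egColumn_of_forall_lt h]

theorem Bump.egInsert_eq {C E : List ℕ} {x y : ℕ} (P : List (List ℕ)) (h : Bump x C E y) :
    egInsert x (C :: P) =
      (E :: (egInsert y P).1, ((egInsert y P).2.1, (egInsert y P).2.2 + 1)) := by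
  simp only [egInsert, h.egColumn_eq]

theorem Bump.red {C E : List ℕ} {x y : ℕ} {w : List ℕ} (h : Bump x C E y)
    (hr : Red (w ++ C ++ [x])) : Red (w ++ [y] ++ E) := by
  refine hr.congr ?_ ?_
  · rw [List.append_assoc, List.append_assoc, wordProd_append, wordProd_append w, h.wordProd_eq,
      List.singleton_append]
  · simp only [List.length_append, List.length_cons, List.length_nil, h.length_eq]
    omega

theorem IsTab.pairwise_headD {P : List (List ℕ)} (h : IsTab P) :
    (P.headD []).Pairwise (· < ·) := by
  cases P with
  | nil => exact List.Pairwise.nil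
  | cons C P => exact h.1

/-- The effect of an insertion: the result is a tableau with the same product, it has one more box,
the bumped letters do not move down, and the row of the new box is at most the row of the inserted
letter. -/
structure InsertSpec (x : ℕ) (P P' : List (List ℕ)) (z : Box) : Prop where
  isTab : IsTab P'
  wordProd_eq : wordProd (readTab P') = wordProd (readTab P ++ [x])
  length_eq : (readTab P').length = (readTab P).length + 1
  inserted : Inserted x (P.headD []) (P'.headD [])
  row_le : z.1 ≤ cnt (P.headD []) x
  height_box : height P z.2 = z.1
  height_eq : ∀ j, height P' j = height P j + if j = z.2 then 1 else 0

theorem insertSpec_egInsert {P : List (List ℕ)} {x : ℕ} (hP : IsTab P)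
    (hr : Red (readTab P ++ [x])) : InsertSpec x P (egInsert x P).1 (egInsert x P).2 := by
  induction P generalizing x with
  | nil =>
    refine ⟨⟨by simp, by simp, rowLt_nil _, trivial⟩, rfl, rfl, Or.inl ⟨by simp, rfl⟩,
      Nat.zero_le _, rfl, fun j => ?_⟩
    cases j with
    | zero => rfl
    | succ j => simp [egInsert, height]
  | cons C P ih =>
    obtain ⟨hC, hne, hrow, hP⟩ := hP
    rw [readTab] at hr
    have hr' : Red (C ++ [x]) := Red.right (u := readTab P) (by simpa using hr)
    rcases forall_lt_or_bump hC hr' with h | ⟨E, y, h⟩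
    · rw [egInsert_of_forall_lt P h]
      refine ⟨⟨?_, by simp, hrow.append_left x, hP⟩, ?_, ?_, Or.inl ⟨h, rfl⟩, ?_, rfl, ?_⟩
      · rw [List.pairwise_append]
        exact ⟨hC, by simp, fun c hc d hd => by simp at hd; subst hd; exact h c hc⟩
      · simp [readTab]
      · simp only [readTab, List.length_append, List.length_singleton]
        omega
      · exact (cnt_eq_length h).ge
      · intro j
        cases j with
        | zero => simp [height]
        | succ j => simp [height]
    · rw [h.egInsert_eq P]
      have h1 := h.red hr
      have s := ih hP h1.left
      refine ⟨⟨h.pairwise_right hC, ?_, h.rowLt s.inserted hrow, s.isTab⟩, ?_, ?_,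
        Or.inr ⟨y, h⟩, ?_, s.height_box, ?_⟩
      · rw [Ne, ← List.length_eq_zero_iff, h.length_eq, List.length_eq_zero_iff]
        exact hne
      · rw [readTab, readTab, wordProd_append, s.wordProd_eq, ← wordProd_append, List.append_assoc,
          List.append_assoc, wordProd_append, wordProd_append (readTab P), h.wordProd_eq,
          List.singleton_append]
      · rw [readTab, readTab, List.length_append, List.length_append, s.length_eq, h.length_eq]
        omega
      · refine s.row_le.trans ?_
        have h2 := hrow (y - 1)
        have h3 := h.lt
        rw [Nat.sub_add_cancel (by omega)] at h2
        refine h2.trans (cnt_le_of_forall fun c hc hcy => ?_)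
        have h4 := h.le_or_le hc
        rcases eq_or_ne c x with rfl | hcx
        · have := h.eq_succ_of_mem hc
          omega
        · omega
      · intro j
        cases j with
        | zero => simp [height, h.length_eq]
        | succ j =>
          rw [height_cons_succ, height_cons_succ, s.height_eq]
          simp

theorem InsertSpec.red {x : ℕ} {P P' : List (List ℕ)} {z : Box} (s : InsertSpec x P P' z)
    {w : List ℕ} (hr : Red (readTab P ++ x :: w)) : Red (readTab P' ++ w) := by
  rw [show readTab P ++ x :: w = (readTab P ++ [x]) ++ w by simp] at hr
  refine hr.congr ?_ ?_
  · rw [wordProd_append, s.wordProd_eq, ← wordProd_append]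
  · simp only [List.length_append, s.length_eq, List.length_singleton]

/-- After a larger letter the new box is weakly to the left, after a smaller one strictly to the
right. -/
theorem col_egInsert_egInsert {P : List (List ℕ)} {x x' : ℕ} (hP : IsTab P)
    (hr : Red (readTab P ++ [x, x'])) :
    (x < x' → (egInsert x' (egInsert x P).1).2.2 ≤ (egInsert x P).2.2) ∧
      (x' < x → (egInsert x P).2.2 < (egInsert x' (egInsert x P).1).2.2) := by
  induction P generalizing x x' with
  | nil =>
    constructor
    · intro h
      have h1 : ∀ c ∈ [x], c < x' := by simpa using h
      simp [egInsert, egColumn_of_forall_lt h1]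
    · intro h
      simp [egInsert, egColumn, h]
  | cons C P ih =>
    have hP' := hP
    obtain ⟨hC, hne, hrow, hP⟩ := hP
    have hr1 : Red (readTab (C :: P) ++ [x]) := Red.left (v := [x']) (by simpa using hr)
    have s := insertSpec_egInsert hP' hr1
    have hr2 : Red (readTab (egInsert x (C :: P)).1 ++ [x']) := s.red hr
    have hr3 : Red (C ++ [x]) := Red.right (u := readTab P) (by simpa [readTab] using hr1)
    rcases forall_lt_or_bump hC hr3 with h | ⟨E, y, h⟩
    · rw [egInsert_of_forall_lt P h] at hr2 s ⊢
      have hr4 : Red (C ++ [x] ++ [x']) := Red.right (u := readTab P) (by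
        simpa [readTab] using hr2)
      rcases forall_lt_or_bump s.isTab.1 hr4 with h' | ⟨E', y', h'⟩
      · rw [egInsert_of_forall_lt P h']
        refine ⟨fun _ => le_rfl, fun hlt => ?_⟩
        have := h' x (by simp)
        omega
      · rw [h'.egInsert_eq P]
        refine ⟨fun hlt => ?_, fun _ => Nat.succ_pos _⟩
        have h1 := h'.mem_left
        have h2 := h'.lt
        rw [List.mem_append, List.mem_singleton] at h1
        rcases h1 with h1 | h1
        · have := h _ h1
          omega
        · omega
    · rw [h.egInsert_eq P] at hr2 s ⊢
      have hr4 : Red (E ++ [x']) := Red.right (u := readTab (egInsert y P).1) (by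
        simpa [readTab] using hr2)
      rcases forall_lt_or_bump s.isTab.1 hr4 with h' | ⟨E', y', h'⟩
      · rw [egInsert_of_forall_lt _ h']
        refine ⟨fun _ => Nat.zero_le _, fun hlt => ?_⟩
        have := h' x h.mem
        omega
      · rw [h'.egInsert_eq]
        have hry := h.red hr1
        have s1 := insertSpec_egInsert hP hry.left
        have hr5 := h'.red hr2
        have hr6 : Red (readTab P ++ [y, y']) := by
          refine hr5.left.congr ?_ ?_
          · rw [wordProd_append (readTab (egInsert y P).1), s1.wordProd_eq, ← wordProd_append]
            simp
          · simp [s1.length_eq]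
        have h1 := h'.lt
        have h2 := h.lt
        constructor
        · intro hlt
          refine Nat.succ_le_succ ((ih hP hr6).1 ?_)
          have h3 := h.le_of_lt h'.mem_left (by omega)
          omega
        · intro hlt
          refine Nat.succ_lt_succ ((ih hP hr6).2 ?_)
          have h3 := h'.le_or_le h.mem
          omega

/-- An insertion can be undone: the tableau before it and the letter are determined by the tableau
after it and the new box. -/
theorem egInsert_inj {P P' : List (List ℕ)} {x x' : ℕ} (hP : IsTab P) (hP' : IsTab P')
    (hr : Red (readTab P ++ [x])) (hr' : Red (readTab P' ++ [x']))
    (h : egInsert x P = egInsert x' P') : x = x' ∧ P = P' := by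
  induction P generalizing x x' P' with
  | nil =>
    cases P' with
    | nil => simpa [egInsert] using h
    | cons C' P' =>
      exfalso
      have hr2 : Red (C' ++ [x']) := Red.right (u := readTab P') (by simpa [readTab] using hr')
      rcases forall_lt_or_bump hP'.1 hr2 with h1 | ⟨E, y, h1⟩
      · rw [egInsert_of_forall_lt P' h1] at h
        have h2 := hP'.2.1
        have h3 := congrArg Prod.fst (congrArg Prod.snd h)
        simp only [egInsert] at h3
        exact h2 (List.length_eq_zero_iff.1 h3.symm)
      · rw [h1.egInsert_eq P'] at h
        have h3 := congrArg Prod.snd (congrArg Prod.snd h)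
        simp [egInsert] at h3
  | cons C P ih =>
    have hr1 : Red (C ++ [x]) := Red.right (u := readTab P) (by simpa [readTab] using hr)
    cases P' with
    | nil =>
      exfalso
      rcases forall_lt_or_bump hP.1 hr1 with h1 | ⟨E, y, h1⟩
      · rw [egInsert_of_forall_lt P h1] at h
        have h2 := hP.2.1
        have h3 := congrArg Prod.fst (congrArg Prod.snd h)
        simp only [egInsert] at h3
        exact h2 (List.length_eq_zero_iff.1 h3)
      · rw [h1.egInsert_eq P] at h
        have h3 := congrArg Prod.snd (congrArg Prod.snd h)
        simp [egInsert] at h3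
    | cons C' P' =>
      have hr2 : Red (C' ++ [x']) := Red.right (u := readTab P') (by simpa [readTab] using hr')
      rcases forall_lt_or_bump hP.1 hr1 with h1 | ⟨E, y, h1⟩ <;>
      rcases forall_lt_or_bump hP'.1 hr2 with h2 | ⟨E', y', h2⟩
      · rw [egInsert_of_forall_lt P h1, egInsert_of_forall_lt P' h2] at h
        simp only [Prod.mk.injEq, List.cons.injEq] at h
        obtain ⟨⟨h3, rfl⟩, -⟩ := h
        obtain ⟨rfl, h4⟩ := List.append_inj' h3 rfl
        exact ⟨by simpa using h4, rfl⟩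
      · rw [egInsert_of_forall_lt P h1, h2.egInsert_eq P'] at h
        simp at h
      · rw [egInsert_of_forall_lt P' h2, h1.egInsert_eq P] at h
        simp at h
      · rw [h1.egInsert_eq P, h2.egInsert_eq P'] at h
        simp only [Prod.mk.injEq, List.cons.injEq, Nat.add_right_cancel_iff] at h
        obtain ⟨⟨rfl, h3⟩, h4, h5⟩ := h
        obtain ⟨rfl, rfl⟩ := ih hP.2.2.2 hP'.2.2.2 (h1.red hr).left (h2.red hr').left
          (Prod.ext h3 (Prod.ext h4 h5))
        obtain ⟨rfl, rfl⟩ := h1.inj h2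
        exact ⟨rfl, rfl⟩

theorem exists_split {E : List ℕ} (hE : E.Pairwise (· < ·)) (y : ℕ) :
    ∃ A B, E = A ++ B ∧ (∀ a ∈ A, a < y) ∧ ∀ b ∈ B, y ≤ b := by
  induction E with
  | nil => exact ⟨[], [], rfl, by simp, by simp⟩
  | cons e E ih =>
    rw [List.pairwise_cons] at hE
    rcases Nat.lt_or_ge e y with h | h
    · obtain ⟨A, B, rfl, hA, hB⟩ := ih hE.2
      refine ⟨e :: A, B, rfl, fun a ha => ?_, hB⟩
      rcases List.mem_cons.1 ha with rfl | ha
      · exact h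
      · exact hA a ha
    · refine ⟨[], e :: E, rfl, by simp, fun b hb => ?_⟩
      rcases List.mem_cons.1 hb with rfl | hb
      · exact h
      · exact h.trans (hE.1 b hb).le

/-- Reverse insertion into one column: a letter can be pushed back into a column with a smaller
entry. -/
theorem exists_bump {E : List ℕ} {y : ℕ} (hE : E.Pairwise (· < ·)) (hr : Red (y :: E))
    (hy : 0 < cnt E y) : ∃ x C, Bump x C E y := by
  obtain ⟨A, B, rfl, hA, hB⟩ := exists_split hE y
  rw [List.pairwise_append] at hE
  rcases List.eq_nil_or_concat A with rfl | ⟨L, x, rfl⟩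
  · rw [List.nil_append, cnt, List.countP_pos_iff] at hy
    obtain ⟨b, hb, hby⟩ := hy
    have := hB b hb
    simp only [decide_eq_true_eq] at hby
    omega
  · rw [List.concat_eq_append] at *
    rw [List.pairwise_append] at hE
    have hL : ∀ l ∈ L, l < x := fun l hl => hE.1.2.2 l hl x (by simp)
    have hx : x < y := hA x (by simp)
    by_cases hyB : y ∈ B
    · cases B with
      | nil => simp at hyB
      | cons b R =>
        have hR := List.pairwise_cons.1 hE.2.1
        have hby : b = y := by
          rcases List.mem_cons.1 hyB with h | h
          · exact h.symm
          · have h1 := hR.1 y h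
            have h2 := hB b (by simp)
            omega
        subst hby
        refine ⟨x, L ++ x :: b :: R, Bump.keep L R rfl (by simp) hL hR.1 ?_⟩
        by_contra hne
        refine not_red_of_commute (x := b) (L ++ [x]) R (fun l hl => ?_) (by simp) hr
        left
        rcases List.mem_append.1 hl with hl | hl
        · have := hL l hl
          omega
        · rw [List.mem_singleton] at hl
          omega
    · refine ⟨x, L ++ y :: B, Bump.replace L B rfl (by simp) hL (fun r hr => ?_) hx⟩
      exact lt_of_le_of_ne (hB r hr) fun h => hyB (h ▸ hr)

/-- Reverse insertion: every corner of a tableau with reduced reading word is the new box of an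
insertion. -/
theorem exists_egInsert_eq {P' : List (List ℕ)} {z : Box} (hP' : IsTab P')
    (hr : Red (readTab P')) (hz : height P' z.2 = z.1 + 1) (hz' : height P' (z.2 + 1) ≤ z.1) :
    ∃ x P, IsTab P ∧ egInsert x P = (P', z) ∧ Red (readTab P ++ [x]) ∧
      Inserted x (P.headD []) (P'.headD []) := by
  obtain ⟨r, c⟩ := z
  simp only at hz hz'
  induction P' generalizing c with
  | nil => simp [height] at hz
  | cons E Q ih =>
    obtain ⟨hE, hne, hrow, hQ⟩ := hP'
    cases c with
    | zero =>
      rw [height_cons_zero] at hz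
      rw [height_cons_succ, height_zero] at hz'
      rcases List.eq_nil_or_concat E with rfl | ⟨C, x, rfl⟩
      · exact absurd rfl hne
      · rw [List.concat_eq_append] at *
        have hlen : C.length = r := by simpa using hz
        rw [List.pairwise_append] at hE
        have hC : ∀ c ∈ C, c < x := fun c hc => hE.2.2 c hc x (by simp)
        rcases eq_or_ne C [] with rfl | hCne
        · have hQn : Q = [] := by
            cases Q with
            | nil => rfl
            | cons D Q =>
              simp only [List.length_nil] at hlen
              simp only [List.headD_cons] at hz'
              exact absurd (List.length_eq_zero_iff.1 (by omega)) hQ.2.1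
          subst hQn hlen
          exact ⟨x, [], trivial, rfl, by simpa [readTab] using hr, Or.inl ⟨by simp, rfl⟩⟩
        · refine ⟨x, C :: Q, ⟨hE.1, hCne, fun v => ?_, hQ⟩, ?_, by simpa [readTab] using hr,
            Or.inl ⟨hC, rfl⟩⟩
          · have h1 := hrow v
            rw [cnt_append, cnt_cons, cnt_nil] at h1
            split_ifs at h1 with hxv
            · rw [cnt_eq_length fun c hc => (hC c hc).trans hxv, hlen]
              exact (cnt_le_length _ _).trans hz'
            · exact h1
          · rw [egInsert_of_forall_lt Q hC, hlen]
    | succ c =>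
      rw [height_cons_succ] at hz hz'
      have hrQ : Red (readTab Q) := Red.left (v := E) hr
      obtain ⟨y, Q₁, hQ₁, heq, hry, hins⟩ := ih hQ hrQ c hz hz'
      have s := insertSpec_egInsert hQ₁ hry
      rw [heq] at s
      have hr2 : Red (readTab Q₁ ++ y :: E) := by
        refine hr.congr ?_ ?_
        · rw [readTab, wordProd_append (readTab Q), s.wordProd_eq, ← wordProd_append]
          simp
        · simp only [readTab, List.length_append, s.length_eq, List.length_cons]
          omega
      have hcnt : 0 < cnt E y := by
        have h1 := hrow y
        have h2 := cnt_lt_of_mem s.inserted.mem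
        simp only at h2
        omega
      obtain ⟨x, C, hb⟩ := exists_bump hE hr2.right hcnt
      refine ⟨x, C :: Q₁, ⟨hb.pairwise_left hE, ?_, hb.rowLt_left s.inserted hrow, hQ₁⟩, ?_, ?_,
        Or.inr ⟨y, hb⟩⟩
      · rw [Ne, ← List.length_eq_zero_iff, ← hb.length_eq, List.length_eq_zero_iff]
        exact hne
      · rw [hb.egInsert_eq, heq]
      · refine hr2.congr ?_ ?_
        · rw [readTab, List.append_assoc, wordProd_append, hb.wordProd_eq, ← wordProd_append]
        · simp only [readTab, List.length_append, List.length_cons, List.length_nil, hb.length_eq]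
          omega


/-! ### The insertion tableau of a word of `1_k × τ` -/

theorem IsTab.height_anti {P : List (List ℕ)} (hP : IsTab P) {j j' : ℕ} (h : j ≤ j') :
    height P j' ≤ height P j := by
  have succ : ∀ {P : List (List ℕ)}, IsTab P → ∀ j, height P (j + 1) ≤ height P j := by
    intro P hP
    induction P with
    | nil => simp [height]
    | cons C P ih =>
      intro j
      cases j with
      | zero =>
        rw [height_cons_succ, height_cons_zero, height_zero]
        exact hP.2.2.1.length_le
      | succ j => exact ih hP.2.2.2 j
  exact antitone_nat_of_succ_le (succ hP) h

theorem RowLt.lt_of_forall_le {C C' : List ℕ} (h : RowLt C C') {a : ℕ} (hC : ∀ c ∈ C, a ≤ c) :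
    ∀ c ∈ C', a + 1 ≤ c := by
  intro c hc
  have h1 := cnt_lt_of_mem hc
  have h2 := h c
  have h3 : 0 < cnt C c := by omega
  rw [cnt, List.countP_pos_iff] at h3
  obtain ⟨d, hd, hdc⟩ := h3
  have := hC d hd
  simp only [decide_eq_true_eq] at hdc
  omega

/-- The column reading word, reversed, with the number of the column (counted from `a`) above each
letter. -/
def colBiword : ℕ → List (List ℕ) → List (ℕ × ℕ)
  | _, [] => []
  | a, C :: P => C.reverse.map (fun b => (a, b)) ++ colBiword (a + 1) P

theorem map_snd_colBiword (a : ℕ) (P : List (List ℕ)) :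
    (colBiword a P).map Prod.snd = (readTab P).reverse := by
  induction P generalizing a with
  | nil => rfl
  | cons C P ih =>
    rw [colBiword, readTab, List.map_append, ih, List.reverse_append, List.map_map]
    congr 1
    exact List.map_id _

theorem mem_colBiword {a : ℕ} {P : List (List ℕ)} {x : ℕ × ℕ} :
    x ∈ colBiword a P ↔ ∃ j, x.1 = a + j ∧ x.2 ∈ P.getD j [] := by
  induction P generalizing a with
  | nil => simp [colBiword]
  | cons C P ih =>
    rw [colBiword, List.mem_append, ih, List.mem_map]
    constructor
    · rintro (⟨b, hb, rfl⟩ | ⟨j, h1, h2⟩)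
      · exact ⟨0, rfl, by simpa using hb⟩
      · exact ⟨j + 1, by omega, h2⟩
    · rintro ⟨j, h1, h2⟩
      cases j with
      | zero => exact Or.inl ⟨x.2, by simpa using h2, by ext <;> simp [h1]⟩
      | succ j => exact Or.inr ⟨j, by omega, h2⟩

theorem IsTab.pairwise_colBiword {P : List (List ℕ)} (hP : IsTab P) (a : ℕ) :
    (colBiword a P).Pairwise BiLt := by
  induction P generalizing a with
  | nil => exact List.Pairwise.nil
  | cons C P ih =>
    rw [colBiword, List.pairwise_append]
    refine ⟨?_, ih hP.2.2.2 _, ?_⟩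
    · rw [List.pairwise_map, List.pairwise_reverse]
      exact hP.1.imp fun h => Or.inr ⟨rfl, h⟩
    · intro x hx y hy
      obtain ⟨b, -, rfl⟩ := List.mem_map.1 hx
      obtain ⟨j, hj, -⟩ := mem_colBiword.1 hy
      left
      simp only
      omega

theorem IsTab.le_of_mem {P : List (List ℕ)} (hP : IsTab P) {k : ℕ} (hk : ∀ c ∈ P.headD [], k ≤ c)
    {j c : ℕ} (hc : c ∈ P.getD j []) : k + j ≤ c := by
  induction P generalizing k j with
  | nil => simp at hc
  | cons C P ih =>
    cases j with
    | zero => exact hk c hc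
    | succ j =>
      have := ih hP.2.2.2 (k := k + 1) (hP.2.2.1.lt_of_forall_le hk) hc
      omega

theorem mem_readTab_of_mem_headD {P : List (List ℕ)} {c : ℕ} (h : c ∈ P.headD []) :
    c ∈ readTab P := by
  cases P with
  | nil => simp at h
  | cons C P => exact List.mem_append_right _ h

theorem shiftPerm_apply_of_lt {k m : ℕ} (τ : Equiv.Perm ℕ) (h : m < k) : shiftPerm k τ m = m := by
  rw [shiftPerm_apply, if_pos h]

theorem eq_range'_of_pairwise {C : List ℕ} {k h : ℕ} (hC : C.Pairwise (· < ·))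
    (hb : ∀ c ∈ C, k ≤ c ∧ c < k + h) (hl : C.length = h) : C = List.range' k h := by
  refine List.Pairwise.eq_of_mem_iff hC List.pairwise_lt_range' fun c => ?_
  have h1 : C.toFinset = Finset.Ico k (k + h) := by
    refine Finset.eq_of_subset_of_card_le (fun c hc => ?_) ?_
    · exact Finset.mem_Ico.2 (hb c (List.mem_toFinset.1 hc))
    · rw [Nat.card_Ico, List.toFinset_card_of_nodup (hC.imp fun h => ne_of_lt h)]
      omega
  rw [← List.mem_toFinset, h1, Finset.mem_Ico, List.mem_range'_1]

theorem length_le_of_pairwise {C : List ℕ} {k h : ℕ} (hC : C.Pairwise (· < ·))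
    (hb : ∀ c ∈ C, k ≤ c ∧ c < k + h) : C.length ≤ h := by
  have h1 := Finset.card_le_card (s := C.toFinset) (t := Finset.Ico k (k + h)) fun c hc =>
    Finset.mem_Ico.2 (hb c (List.mem_toFinset.1 hc))
  rw [Nat.card_Ico, List.toFinset_card_of_nodup (hC.imp fun h => ne_of_lt h)] at h1
  omega

theorem IsTab.eq_minTab {P : List (List ℕ)} (hP : IsTab P) {k : ℕ} {hs : List ℕ}
    (hpos : ∀ h ∈ hs, 0 < h)
    (hb : ∀ j, ∀ c ∈ P.getD j [], k + j ≤ c ∧ c < k + j + hs.getD j 0)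
    (hl : hs.sum ≤ (readTab P).length) : P = minTab k hs := by
  have le : ∀ {P : List (List ℕ)} {k : ℕ} {hs : List ℕ}, IsTab P →
      (∀ j, ∀ c ∈ P.getD j [], k + j ≤ c ∧ c < k + j + hs.getD j 0) →
      (readTab P).length ≤ hs.sum := by
    intro P
    induction P with
    | nil => simp [readTab]
    | cons C P ih =>
      intro k hs hP hb
      have h0 := length_le_of_pairwise hP.1 (k := k) (h := hs.getD 0 0) fun c hc => hb 0 c hc
      have h1 := ih (k := k + 1) (hs := hs.tail) hP.2.2.2 fun j c hc => by
        have h2 := hb (j + 1) c hc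
        rw [List.getD_eq_getElem?_getD, List.getElem?_tail, ← List.getD_eq_getElem?_getD]
        omega
      rw [readTab, List.length_append]
      cases hs with
      | nil =>
        simp at h0 h1
        simp [h0, h1]
      | cons h hs =>
        simp only [List.getD_cons_zero, List.tail_cons] at h0 h1
        rw [List.sum_cons]
        omega
  induction P generalizing k hs with
  | nil =>
    cases hs with
    | nil => rfl
    | cons h hs =>
      have := hpos h (by simp)
      simp only [List.sum_cons, readTab, List.length_nil] at hl
      omega
  | cons C P ih =>
    have h0 := length_le_of_pairwise hP.1 (k := k) (h := hs.getD 0 0) fun c hc => hb 0 c hc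
    cases hs with
    | nil => exact absurd (List.length_eq_zero_iff.1 (by simpa using h0)) hP.2.1
    | cons h hs =>
      have hb' : ∀ j, ∀ c ∈ P.getD j [], k + 1 + j ≤ c ∧ c < k + 1 + j + hs.getD j 0 := by
        intro j c hc
        have h2 := hb (j + 1) c hc
        rw [List.getD_cons_succ] at h2
        omega
      have h1 := le hP.2.2.2 hb'
      rw [List.getD_cons_zero] at h0
      rw [readTab, List.length_append, List.sum_cons] at hl
      rw [minTab, ← ih hP.2.2.2 (fun h hh => hpos h (by simp [hh])) hb' (by omega),
        ← eq_range'_of_pairwise hP.1 (k := k) (h := h) (fun c hc => hb 0 c hc) (by omega)]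

theorem colLens_pos (μ : YoungDiagram) : ∀ h ∈ colLens μ, 0 < h := by
  intro h hh
  obtain ⟨j, hj, rfl⟩ := List.mem_map.1 hh
  rw [List.mem_range, ← YoungDiagram.mem_iff_lt_rowLen] at hj
  exact YoungDiagram.mem_iff_lt_colLen.1 hj

theorem sum_colLens (μ : YoungDiagram) : (colLens μ).sum = μ.cells.card := by
  rw [Finset.card_eq_sum_card_fiberwise (f := Prod.snd) (t := Finset.range (μ.rowLen 0))]
  · rw [colLens, Finset.sum_list_map_count]
    rw [List.toFinset_range]
    refine Finset.sum_congr rfl fun j hj => ?_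
    rw [List.count_eq_one_of_mem List.nodup_range (by simpa using hj), one_smul,
      YoungDiagram.colLen_eq_card]
    rfl
  · rintro ⟨i, j⟩ hx
    rw [Finset.coe_range, Set.mem_Iio, ← YoungDiagram.mem_iff_lt_rowLen]
    exact μ.up_left_mem (Nat.zero_le _) le_rfl ((YoungDiagram.mem_cells _).1 hx)

/-- A tableau whose reading word is a reduced word of `1_k × τ` is determined. Its transposed
reading is a compatible sequence of the inverse permutation, whose columns are bounded by the boxes
of the Rothe diagram. -/
theorem IsTab.eq_minTab_colLens {P : List (List ℕ)} (hP : IsTab P) (hr : Red (readTab P)) {k : ℕ}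
    {μ : YoungDiagram} (hp : wordProd (readTab P) = shiftPerm k (dominantPerm μ)) :
    P = minTab k (colLens μ) := by
  have hk : ∀ c ∈ P.headD [], k ≤ c := fun c hc =>
    hr.le_of_mem (fun m hm => by rw [hp, shiftPerm_apply_of_lt _ hm]) c
      (mem_readTab_of_mem_headD hc)
  refine hP.eq_minTab (colLens_pos μ) (fun j c hc => ?_) ?_
  · have hle := hP.le_of_mem hk hc
    refine ⟨hle, ?_⟩
    obtain ⟨i, p, h1, h2, h3⟩ := exists_rothe_of_mem (t := colBiword k P) (a₀ := k) (a := k + j)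
      (b := c) (hP.pairwise_colBiword k)
      (fun u hu => by obtain ⟨j, hj, -⟩ := mem_colBiword.1 hu; omega)
      (fun u hu => by
        obtain ⟨j, hj, hu⟩ := mem_colBiword.1 hu
        rw [hj]
        exact hP.le_of_mem hk hu)
      (by rw [map_snd_colBiword]; exact hr.reverse) (mem_colBiword.2 ⟨j, rfl, hc⟩)
    rw [map_snd_colBiword, wordProd_reverse, hp, rotheDiagram_inv,
      mem_rotheDiagram_shiftPerm_dominantPerm] at h1
    have h4 : c - j - k < (colLens μ).getD j 0 :=
      lt_colLens_getD.2 (mem_cells_of_le h1.2.2 (by simp only; omega) (by simp only; omega))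
    omega
  · rw [sum_colLens, ← invNum_shiftPerm_dominantPerm k, ← hp]
    exact invNum_le_length _

theorem cnt_range' (k h v : ℕ) : cnt (List.range' k h) v = min h (v - k) := by
  induction h generalizing k with
  | zero => simp [cnt]
  | succ h ih =>
    rw [List.range'_succ, cnt_cons, ih]
    split_ifs <;> omega

theorem isTab_minTab {hs : List ℕ} (hp : hs.Pairwise (· ≥ ·)) (hpos : ∀ h ∈ hs, 0 < h) (k : ℕ) :
    IsTab (minTab k hs) := by
  induction hs generalizing k with
  | nil => trivial
  | cons h hs ih =>
    rw [List.pairwise_cons] at hp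
    refine ⟨List.pairwise_lt_range', ?_, ?_, ih hp.2 (fun h hh => hpos h (by simp [hh])) _⟩
    · have := hpos h (by simp)
      rw [Ne, ← List.length_eq_zero_iff, List.length_range']
      omega
    · cases hs with
      | nil => exact rowLt_nil _
      | cons h' hs =>
        intro v
        have := hp.1 h' (by simp)
        simp only [minTab, List.headD_cons, cnt_range']
        omega

theorem height_minTab (k : ℕ) (hs : List ℕ) (j : ℕ) : height (minTab k hs) j = hs.getD j 0 := by
  induction hs generalizing k j with
  | nil => rfl
  | cons h hs ih =>
    cases j with
    | zero => simp [minTab, height]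
    | succ j =>
      rw [minTab, height_cons_succ, ih]
      rfl

theorem red_readTab_minTab (k : ℕ) (μ : YoungDiagram) : Red (readTab (minTab k (colLens μ))) := by
  rw [red_iff_invNum_eq, wordProd_readTab_minTab, invNum_shiftPerm_dominantPerm,
    length_readTab_minTab, sum_colLens]

/-! ### Full rows of the insertion tableau -/

theorem readTab_map_append (f g : List ℕ → List ℕ) {P : List (List ℕ)}
    (h : ∀ C ∈ P, f C ++ g C = C)
    (hc : ∀ (P₁ P₂ : List (List ℕ)) (C : List ℕ), P = P₁ ++ C :: P₂ →
      ∀ l ∈ readTab (P₂.map g), ∀ m ∈ f C, l + 2 ≤ m ∨ m + 2 ≤ l) :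
    wordProd (readTab P) = wordProd (readTab (P.map f) ++ readTab (P.map g)) := by
  induction P with
  | nil => rfl
  | cons C P ih =>
    have h1 := ih (fun D hD => h D (by simp [hD])) fun P₁ P₂ D hP =>
      hc (C :: P₁) P₂ D (by simp [hP])
    have h2 := wordProd_append_comm (hc [] P C rfl)
    rw [readTab, wordProd_append, h1, ← wordProd_append]
    conv_lhs => rw [← h C (by simp)]
    rw [List.map_cons, List.map_cons, readTab, readTab,
      show readTab (P.map f) ++ readTab (P.map g) ++ (f C ++ g C) =
        readTab (P.map f) ++ (readTab (P.map g) ++ f C) ++ g C by simp,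
      wordProd_append_append, h2, ← wordProd_append_append]
    simp

theorem le_cnt_of_mem_drop {C : List ℕ} (hC : C.Pairwise (· < ·)) {r l : ℕ} (hl : l ∈ C.drop r) :
    r ≤ cnt C l := by
  have h1 : C.take r ++ C.drop r = C := List.take_append_drop r C
  have h2 : ∀ c ∈ C.take r, c < l := by
    rw [← h1, List.pairwise_append] at hC
    exact fun c hc => hC.2.2 c hc l hl
  have h3 : r < C.length := by
    by_contra hlt
    rw [List.drop_eq_nil_of_le (by omega)] at hl
    simp at hl
  rw [← h1, cnt_append, cnt_eq_length h2, List.length_take]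
  omega

theorem lt_of_mem_take {C : List ℕ} (hC : C.Pairwise (· < ·)) {r v m : ℕ} (hv : r ≤ cnt C v)
    (hm : m ∈ C.take r) : m < v := by
  by_contra hle
  push Not at hle
  have h1 : C.take r ++ C.drop r = C := List.take_append_drop r C
  have h2 : cnt (C.drop r) v = 0 := by
    rw [← h1, List.pairwise_append] at hC
    rw [cnt, List.countP_eq_zero]
    intro c hc
    have := hC.2.2 m hm c hc
    simp only [decide_eq_true_eq]
    omega
  have h3 : cnt (C.take r) v < (C.take r).length := by
    refine lt_of_le_of_ne (cnt_le_length _ _) fun h => ?_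
    have := List.countP_eq_length.1 h m hm
    simp only [decide_eq_true_eq] at this
    omega
  rw [← h1, cnt_append, h2] at hv
  rw [List.length_take] at h3
  omega

theorem IsTab.le_cnt_of_mem {P : List (List ℕ)} (hP : IsTab P) {r l : ℕ}
    (hl : l ∈ readTab (P.map (List.drop r))) : r ≤ cnt (P.headD []) l := by
  induction P with
  | nil => simp [readTab] at hl
  | cons C P ih =>
    rw [List.map_cons, readTab, List.mem_append] at hl
    rcases hl with hl | hl
    · have h1 := ih hP.2.2.2 hl
      have h2 := hP.2.2.1 l
      have h3 := cnt_mono (P.headD []) (Nat.le_succ l)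
      rw [Nat.succ_eq_add_one] at h3
      exact h1.trans (h3.trans h2)
    · exact le_cnt_of_mem_drop hP.1 hl

theorem IsTab.right {P₁ P₂ : List (List ℕ)} (h : IsTab (P₁ ++ P₂)) : IsTab P₂ := by
  induction P₁ with
  | nil => exact h
  | cons C P₁ ih => exact ih h.2.2.2

/-- The first `r` rows and the other rows can be read separately: the entries that have to pass each
other differ by at least two. -/
theorem IsTab.wordProd_readTab_take_drop {P : List (List ℕ)} (hP : IsTab P) (r : ℕ) :
    wordProd (readTab P) =
      wordProd (readTab (P.map (List.take r)) ++ readTab (P.map (List.drop r))) := by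
  refine readTab_map_append _ _ (fun C _ => List.take_append_drop r C) ?_
  rintro P₁ P₂ C rfl l hl m hm
  right
  have h := hP.right
  have h1 := h.2.2.2.le_cnt_of_mem hl
  rcases Nat.eq_zero_or_pos r with rfl | hr
  · simp at hm
  · have h2 := h.2.2.1 (l - 1)
    rcases Nat.eq_zero_or_pos l with rfl | hl0
    · have : cnt (P₂.headD []) 0 = 0 := by simp [cnt]
      omega
    · rw [Nat.sub_add_cancel hl0] at h2
      have := lt_of_mem_take h.1 (h1.trans h2) hm
      omega

theorem length_readTab_le_card {P : List (List ℕ)} {T : Finset Box}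
    (h : ∀ i j, i < height P j → (i, j) ∈ T) : (readTab P).length ≤ T.card := by
  have h1 : (readTab P).length = ∑ j ∈ Finset.range P.length, height P j := by
    clear h
    induction P with
    | nil => rfl
    | cons C P ih =>
      rw [readTab, List.length_append, ih, List.length_cons, Finset.sum_range_succ']
      rfl
  have h2 : (readTab P).length =
      ((Finset.range P.length).sigma fun j => Finset.range (height P j)).card := by
    rw [h1, Finset.card_sigma]
    simp
  rw [h2]
  refine Finset.card_le_card_of_injOn (fun x => (x.2, x.1)) ?_ ?_
  · rintro ⟨j, i⟩ hx
    simp only [Finset.coe_sigma, Set.mem_sigma_iff, Finset.coe_range, Set.mem_Iio] at hx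
    exact h _ _ hx.2
  · rintro ⟨j, i⟩ - ⟨j', i'⟩ - hx
    simp only [Prod.mk.injEq] at hx
    rw [hx.1, hx.2]

theorem height_map_take (P : List (List ℕ)) (r j : ℕ) :
    height (P.map (List.take r)) j = min r (height P j) := by
  induction P generalizing j with
  | nil => simp [height]
  | cons C P ih =>
    cases j with
    | zero => simp [height]
    | succ j => exact ih j

theorem mem_rotheDiagram_mul_wordProd {f : Equiv.Perm ℕ} {w : List ℕ} {β i v : ℕ}
    (hw : ∀ b ∈ w, β ≤ b) (hi : i < β) :
    (i, v) ∈ rotheDiagram (f * wordProd w) ↔ (i, v) ∈ rotheDiagram f := by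
  rw [mem_rotheDiagram, mem_rotheDiagram, Equiv.Perm.mul_apply, wordProd_apply_of_lt hw hi]
  refine and_congr_right fun _ => ?_
  change i < (wordProd w).symm (f.symm v) ↔ _
  rcases Nat.lt_or_ge (f.symm v) β with h | h
  · rw [wordProd_symm_apply_of_lt hw h]
  · have := le_wordProd_symm_apply hw h
    omega

/-- If no letter below `k + r` is left to be inserted, then the first `r` rows are complete: they
have to account for all inversions in the first `k + r` positions. -/
theorem IsTab.lt_height_of_forall_le {P : List (List ℕ)} (hP : IsTab P) {w : List ℕ} {k r : ℕ}
    {μ : YoungDiagram} (hr : Red (readTab P ++ w))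
    (hp : wordProd (readTab P ++ w) = shiftPerm k (dominantPerm μ))
    (hw : ∀ b ∈ w, k + r ≤ b) (hsub : ∀ i j, i < height P j → (i, j) ∈ μ.cells)
    {i j : ℕ} (hij : (i, j) ∈ μ.cells) (hi : i < r) : i < height P j := by
  have hk : ∀ c ∈ P.headD [], k ≤ c := fun c hc =>
    hr.le_of_mem (fun m hm => by rw [hp, shiftPerm_apply_of_lt _ hm]) c
      (List.mem_append_left _ (mem_readTab_of_mem_headD hc))
  set A := readTab (P.map (List.take r))
  have hbot : ∀ b ∈ readTab (P.map (List.drop r)) ++ w, k + r ≤ b := by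
    intro b hb
    rcases List.mem_append.1 hb with hb | hb
    · have h1 := hP.le_cnt_of_mem hb
      have hkb : k ≤ b := by
        rw [cnt] at h1
        have h2 : 0 < (P.headD []).countP (· < b) := by omega
        obtain ⟨c, hc, hcb⟩ := List.countP_pos_iff.1 h2
        have := hk c hc
        simp only [decide_eq_true_eq] at hcb
        omega
      have := cnt_add_le hP.pairwise_headD hk hkb
      omega
    · exact hw b hb
  have hA : ∀ i j, i < k + r →
      ((i, j) ∈ rotheDiagram (wordProd A) ↔ k ≤ i ∧ k ≤ j ∧ (i - k, j - k) ∈ μ.cells) := by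
    intro i j hi
    rw [← mem_rotheDiagram_shiftPerm_dominantPerm, ← hp, wordProd_append,
      hP.wordProd_readTab_take_drop r, wordProd_append, mul_assoc, ← wordProd_append,
      mem_rotheDiagram_mul_wordProd hbot hi]
  set S := μ.cells.filter (fun x => x.1 < r) with hS
  set T := S.filter (fun x => x.1 < height P x.2) with hT
  have h1 : S.card ≤ A.length := by
    refine le_trans ?_ (invNum_le_length A)
    rw [← ncard_rotheDiagram, ← Set.ncard_coe_finset]
    refine Set.ncard_le_ncard_of_injOn (fun x => (x.1 + k, x.2 + k)) ?_ ?_ (rotheDiagram_finite A)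
    · rintro ⟨i, j⟩ hx
      simp only [hS, Finset.coe_filter, Set.mem_ofPred_eq] at hx
      rw [hA _ _ (by omega)]
      simpa using hx.1
    · rintro ⟨i, j⟩ - ⟨i', j'⟩ - hx
      simp only [Prod.mk.injEq, Nat.add_right_cancel_iff] at hx
      rw [hx.1, hx.2]
  have h2 : A.length ≤ T.card := by
    refine length_readTab_le_card fun i j hlt => ?_
    rw [height_map_take] at hlt
    simp only [hT, hS, Finset.mem_filter]
    exact ⟨⟨hsub i j (by omega), by omega⟩, by omega⟩
  have h3 : T = S := Finset.eq_of_subset_of_card_le (Finset.filter_subset _ _) (h1.trans h2)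
  have h4 : (i, j) ∈ T := by
    rw [h3, hS, Finset.mem_filter]
    exact ⟨hij, hi⟩
  exact (Finset.mem_filter.1 h4).2


/-! ### Recording tableaux -/

/-- The insertion and the recording tableau of a biword. -/
def egState (t : List (ℕ × ℕ)) : List (List ℕ) × Tableau := t.foldl egStep ([], fun _ => none)

theorem recordingTableau_eq (t : List (ℕ × ℕ)) : recordingTableau t = (egState t).2 := rfl

theorem egState_concat (t : List (ℕ × ℕ)) (x : ℕ × ℕ) :
    egState (t ++ [x]) = egStep (egState t) x := by
  simp [egState]

/-- The box that is added to the tableaux of `s` by the column `x`. -/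
def newBox (s : List (ℕ × ℕ)) (x : ℕ × ℕ) : Box := (egInsert x.2 (egState s).1).2

theorem egState_concat_fst (s : List (ℕ × ℕ)) (x : ℕ × ℕ) :
    (egState (s ++ [x])).1 = (egInsert x.2 (egState s).1).1 := by
  rw [egState_concat]
  rfl

theorem egState_concat_snd (s : List (ℕ × ℕ)) (x : ℕ × ℕ) :
    (egState (s ++ [x])).2 = Function.update (egState s).2 (newBox s x) (some x.1) := by
  rw [egState_concat]
  rfl

/-- The tableau is filled exactly in the boxes of the shape of `P`. -/
def HasShape (P : List (List ℕ)) (Q : Tableau) : Prop :=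
  ∀ x, (Q x).isSome = true ↔ x.1 < height P x.2

/-- Weakly increasing rows and strictly increasing columns. -/
def IsSemistandard (Q : Tableau) : Prop :=
  (∀ x y m l, x.1 ≤ y.1 → x.2 ≤ y.2 → Q x = some m → Q y = some l → m ≤ l) ∧
    ∀ i i' j m l, i < i' → Q (i, j) = some m → Q (i', j) = some l → m < l

theorem egState_spec {t : List (ℕ × ℕ)} (hr : Red (t.map Prod.snd)) :
    IsTab (egState t).1 ∧ wordProd (readTab (egState t).1) = wordProd (t.map Prod.snd) ∧
      (readTab (egState t).1).length = t.length ∧ HasShape (egState t).1 (egState t).2 := by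
  induction t using List.reverseRecOn with
  | nil => exact ⟨trivial, rfl, rfl, fun x => by simp [egState, height]⟩
  | append_singleton t x ih =>
    rw [List.map_append] at hr
    obtain ⟨h1, h2, h3, h4⟩ := ih hr.left
    have hr' : Red (readTab (egState t).1 ++ [x.2]) := by
      refine hr.congr ?_ ?_
      · rw [wordProd_append, h2, ← wordProd_append]
        rfl
      · simp [h3]
    have s := insertSpec_egInsert h1 hr'
    rw [egState_concat_fst, egState_concat_snd]
    refine ⟨s.isTab, ?_, ?_, fun y => ?_⟩
    · rw [s.wordProd_eq, wordProd_append, h2, ← wordProd_append, List.map_append]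
      rfl
    · rw [s.length_eq, h3, List.length_append, List.length_singleton]
    · rw [s.height_eq]
      change (Function.update (egState t).2 (newBox t x) (some x.1) y).isSome = true ↔ y.1 <
        height (egState t).1 y.2 + if y.2 = (newBox t x).2 then 1 else 0
      have h5 : height (egState t).1 (newBox t x).2 = (newBox t x).1 := s.height_box
      rcases eq_or_ne y (newBox t x) with rfl | hne
      · rw [Function.update_self, if_pos rfl]
        simp only [Option.isSome_some, true_iff]
        omega
      · rw [Function.update_of_ne hne, h4]
        split_ifs with h6
        · have h7 : y.1 ≠ (newBox t x).1 := fun h => hne (Prod.ext h h6)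
          rw [h6]
          omega
        · rfl

theorem red_egState_append {t : List (ℕ × ℕ)} {w : List ℕ} (hr : Red (t.map Prod.snd ++ w)) :
    Red (readTab (egState t).1 ++ w) := by
  obtain ⟨-, h2, h3, -⟩ := egState_spec hr.left
  refine hr.congr ?_ ?_
  · rw [wordProd_append, h2, ← wordProd_append]
  · simp [h3]

theorem insertSpec_egState {t : List (ℕ × ℕ)} {x : ℕ × ℕ} (hr : Red ((t ++ [x]).map Prod.snd)) :
    InsertSpec x.2 (egState t).1 (egState (t ++ [x])).1 (newBox t x) := by
  rw [List.map_append] at hr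
  rw [egState_concat_fst]
  exact insertSpec_egInsert (egState_spec hr.left).1 (red_egState_append hr)

/-- The recording tableau of a biword is semistandard. The last box contains a maximal entry, and
among the boxes with this entry it is the rightmost one. -/
theorem isSemistandard_egState {t : List (ℕ × ℕ)} (ht : t.Pairwise BiLt)
    (hr : Red (t.map Prod.snd)) : IsSemistandard (egState t).2 ∧
      ∀ s x, t = s ++ [x] → ∀ y m, (egState t).2 y = some m →
        m ≤ x.1 ∧ (m = x.1 → y.2 ≤ (newBox s x).2) := by
  induction t using List.reverseRecOn with
  | nil =>
    refine ⟨⟨fun _ _ _ _ _ _ h => ?_, fun _ _ _ _ _ _ h => ?_⟩, fun s x h => ?_⟩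
    · simp [egState] at h
    · simp [egState] at h
    · simp at h
  | append_singleton s x ih =>
    have hr' := hr
    rw [List.map_append] at hr'
    rw [List.pairwise_append] at ht
    obtain ⟨⟨ih1, ih2⟩, ih3⟩ := ih ht.1 hr'.left
    obtain ⟨hT, -, -, hS⟩ := egState_spec hr'.left
    have sp := insertSpec_egState hr
    set z := newBox s x with hz
    have old : ∀ y m, (egState s).2 y = some m → m ≤ x.1 ∧ (m = x.1 → y.2 < z.2) := by
      intro y m hy
      rcases List.eq_nil_or_concat' s with rfl | ⟨s', x', rfl⟩
      · simp [egState] at hy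
      · have h1 := ih3 s' x' rfl y m hy
        have h2 := ht.2.2 x' (by simp) x (by simp)
        have h3 := col_egInsert_egInsert (x := x'.2) (x' := x.2)
          (egState_spec (t := s') (by
            rw [List.map_append] at hr'
            exact hr'.left.left)).1
          (red_egState_append (t := s') (w := [x'.2, x.2]) (by simpa using hr'))
        rw [← egState_concat_fst] at h3
        have h4 : x.2 < x'.2 → (newBox s' x').2 < (newBox (s' ++ [x']) x).2 := h3.2
        rw [← hz] at h4
        simp only [BiLt] at h2
        omega
    have notLe : ∀ y m, (egState s).2 y = some m → ¬ (z.1 ≤ y.1 ∧ z.2 ≤ y.2) := by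
      rintro y m hy ⟨h1, h2⟩
      have h3 := (hS y).1 (by rw [hy]; rfl)
      have h4 := hT.height_anti h2
      have h5 := sp.height_box
      omega
    rw [egState_concat_snd, ← hz]
    refine ⟨⟨?_, ?_⟩, ?_⟩
    · intro y y' m l h1 h2 hy hy'
      rcases eq_or_ne y z with he | hne
      · rw [he] at h1 h2 hy
        rcases eq_or_ne y' z with he' | hne'
        · rw [he', hy] at hy'
          exact (Option.some.inj hy').le
        · rw [Function.update_of_ne hne'] at hy'
          exact absurd ⟨h1, h2⟩ (notLe _ _ hy')
      · rw [Function.update_of_ne hne] at hy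
        rcases eq_or_ne y' z with he' | hne'
        · rw [he', Function.update_self] at hy'
          exact Option.some.inj hy' ▸ (old _ _ hy).1
        · rw [Function.update_of_ne hne'] at hy'
          exact ih1 _ _ _ _ h1 h2 hy hy'
    · intro i i' j m l h1 hy hy'
      rcases eq_or_ne (i, j) z with he | hne
      · rw [Function.update_of_ne (fun h => by
          have h2 := congrArg Prod.fst (he.trans h.symm)
          simp only at h2
          omega)] at hy'
        refine absurd ⟨?_, ?_⟩ (notLe _ _ hy') <;> rw [← he]
        exact h1.le
      · rw [Function.update_of_ne hne] at hy
        rcases eq_or_ne (i', j) z with he | hne'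
        · rw [he, Function.update_self] at hy'
          have h2 := old _ _ hy
          rw [← he] at h2
          have h3 := Option.some.inj hy'
          simp only at h2
          omega
        · rw [Function.update_of_ne hne'] at hy'
          exact ih2 _ _ _ _ _ h1 hy hy'
    · intro s' x' hs y m hy
      obtain ⟨rfl, hx⟩ := List.append_inj' hs rfl
      obtain rfl : x = x' := by simpa using hx
      rcases eq_or_ne y z with rfl | hne
      · rw [Function.update_self] at hy
        exact ⟨(Option.some.inj hy).ge, fun _ => le_rfl⟩
      · rw [Function.update_of_ne hne] at hy
        have := old _ _ hy
        exact ⟨this.1, fun h => (this.2 h).le⟩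

/-- A biword is determined by its insertion and recording tableaux: the last box that was added is
the rightmost one with a maximal entry, and its insertion can be undone. -/
theorem egState_inj {t t' : List (ℕ × ℕ)} (ht : t.Pairwise BiLt) (ht' : t'.Pairwise BiLt)
    (hr : Red (t.map Prod.snd)) (hr' : Red (t'.map Prod.snd)) (h : egState t = egState t') :
    t = t' := by
  have hlen : ∀ {t t' : List (ℕ × ℕ)}, Red (t.map Prod.snd) → Red (t'.map Prod.snd) →
      egState t = egState t' → t.length = t'.length := by
    intro t t' hr hr' h
    rw [← (egState_spec hr).2.2.1, ← (egState_spec hr').2.2.1, h]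
  induction t using List.reverseRecOn generalizing t' with
  | nil => exact (List.length_eq_zero_iff.1 (hlen hr hr' h).symm).symm
  | append_singleton s x ih =>
    rcases List.eq_nil_or_concat t' with rfl | ⟨s', x', rfl⟩
    · have := hlen hr hr' h
      simp at this
    · rw [List.concat_eq_append] at *
      have sp := insertSpec_egState hr
      have sp' := insertSpec_egState hr'
      have m1 : (egState (s ++ [x])).2 (newBox s x) = some x.1 := by
        rw [egState_concat_snd, Function.update_self]
      have m2 : (egState (s' ++ [x'])).2 (newBox s' x') = some x'.1 := by
        rw [egState_concat_snd, Function.update_self]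
      have k1 := (isSemistandard_egState ht hr).2 s x rfl (newBox s' x') x'.1 (by rw [h, m2])
      have k2 := (isSemistandard_egState ht' hr').2 s' x' rfl (newBox s x) x.1 (by rw [← h, m1])
      have e1 : x.1 = x'.1 := le_antisymm k2.1 k1.1
      have e2 : (newBox s x).2 = (newBox s' x').2 := le_antisymm (k2.2 e1) (k1.2 e1.symm)
      have e3 : newBox s x = newBox s' x' := by
        refine Prod.ext ?_ e2
        have h1 := sp.height_eq (newBox s x).2
        have h2 := sp'.height_eq (newBox s' x').2
        rw [if_pos rfl, sp.height_box, h] at h1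
        rw [if_pos rfl, sp'.height_box, ← e2] at h2
        omega
      have hs : Red (s.map Prod.snd) := by
        rw [List.map_append] at hr
        exact hr.left
      have hs' : Red (s'.map Prod.snd) := by
        rw [List.map_append] at hr'
        exact hr'.left
      rw [List.map_append] at hr hr'
      have e4 := egInsert_inj (egState_spec hs).1 (egState_spec hs').1
        (red_egState_append (w := [x.2]) hr) (red_egState_append (w := [x'.2]) hr')
        (Prod.ext (by rw [← egState_concat_fst, ← egState_concat_fst, h]) e3)
      have none_of : ∀ {s : List (ℕ × ℕ)} {x : ℕ × ℕ}, Red ((s ++ [x]).map Prod.snd) →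
          Red (s.map Prod.snd) → (egState s).2 = Function.update (egState (s ++ [x])).2
            (newBox s x) none := by
        intro s x h1 h2
        have h3 : (egState s).2 (newBox s x) = none := by
          rw [← Option.not_isSome_iff_eq_none, (egState_spec h2).2.2.2]
          have := (insertSpec_egState h1).height_box
          omega
        rw [egState_concat_snd, Function.update_idem, ← h3, Function.update_eq_self]
      have e5 : egState s = egState s' := by
        refine Prod.ext e4.2 ?_
        rw [none_of (x := x) (by simpa using hr) hs, none_of (x := x') (by simpa using hr') hs', h,
          e3]
      rw [ih (List.pairwise_append.1 ht).1 (List.pairwise_append.1 ht').1 hs hs' e5,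
        Prod.ext e1 e4.1]

theorem IsTab.eq_nil {P : List (List ℕ)} (hP : IsTab P) (h : (readTab P).length = 0) : P = [] := by
  cases P with
  | nil => rfl
  | cons C P =>
    rw [readTab, List.length_append] at h
    exact absurd (List.length_eq_zero_iff.1 (by omega)) hP.2.1

/-- In a nonempty semistandard tableau there is a rightmost box with a maximal entry. -/
theorem exists_last_box {P : List (List ℕ)} {Q : Tableau} (hne : P ≠ []) (hP : IsTab P)
    (hS : HasShape P Q) : ∃ z a, Q z = some a ∧
      ∀ y m, Q y = some m → m ≤ a ∧ (m = a → y.2 ≤ z.2) := by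
  have hfin : {x : Box | x.1 < height P x.2}.Finite := by
    refine Set.Finite.subset (Set.finite_Iic ((height P 0, P.length) : ℕ × ℕ)) ?_
    rintro ⟨i, j⟩ hx
    have h1 : i < height P j := hx
    refine Prod.mk_le_mk.2 ⟨(h1.trans_le (hP.height_anti (Nat.zero_le j))).le, ?_⟩
    by_contra hj
    rw [height, List.getD_eq_default _ _ (by omega)] at h1
    simp at h1
  obtain ⟨z, hz, hmax⟩ := Set.exists_max_image _
    (fun x : Box => (toLex ((Q x).getD 0, x.2) : ℕ ×ₗ ℕ)) hfin (by
      cases P with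
      | nil => exact absurd rfl hne
      | cons C P => exact ⟨(0, 0), List.length_pos_iff.2 hP.2.1⟩)
  obtain ⟨a, ha⟩ := Option.isSome_iff_exists.1 ((hS z).2 hz)
  refine ⟨z, a, ha, fun y m hy => ?_⟩
  have h1 := hmax y ((hS y).1 (by rw [hy]; rfl))
  rw [hy, ha, Prod.Lex.le_iff] at h1
  simp only [ofLex_toLex, Option.getD_some] at h1
  omega

/-- Every semistandard tableau on the shape of a tableau with reduced reading word is a recording
tableau. -/
theorem exists_egState_eq {P : List (List ℕ)} {Q : Tableau} (hP : IsTab P) (hr : Red (readTab P))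
    (hS : HasShape P Q) (hQ : IsSemistandard Q) :
    ∃ t : List (ℕ × ℕ), t.Pairwise BiLt ∧ Red (t.map Prod.snd) ∧ egState t = (P, Q) := by
  induction hn : (readTab P).length generalizing P Q with
  | zero =>
    obtain rfl := hP.eq_nil hn
    refine ⟨[], List.Pairwise.nil, fun _ _ => Nat.zero_le _, ?_⟩
    refine Prod.ext rfl (funext fun x => ?_)
    have := hS x
    rw [height_nil] at this
    have h2 : (Q x).isSome = false := by simpa using this
    exact (Option.isSome_eq_false_iff.1 h2 |> Option.isNone_iff_eq_none.1).symm
  | succ n ih =>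
    obtain ⟨z, a, hz, hmax⟩ := exists_last_box (by rintro rfl; simp [readTab] at hn) hP hS
    have hzS := (hS z).1 (by rw [hz]; rfl)
    have c1 : height P z.2 = z.1 + 1 := by
      by_contra hne
      obtain ⟨m, hm⟩ := Option.isSome_iff_exists.1 ((hS (z.1 + 1, z.2)).2 (by simp only; omega))
      have h1 := hQ.2 z.1 (z.1 + 1) z.2 a m (by omega) hz hm
      have h2 := (hmax _ _ hm).1
      omega
    have c2 : height P (z.2 + 1) ≤ z.1 := by
      by_contra hne
      obtain ⟨m, hm⟩ := Option.isSome_iff_exists.1 ((hS (z.1, z.2 + 1)).2 (by simp only; omega))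
      have h1 := hQ.1 z (z.1, z.2 + 1) a m le_rfl (Nat.le_succ _) hz hm
      have h2 := hmax _ _ hm
      simp only at h2
      omega
    obtain ⟨b, P₁, hP₁, heq, hr₁, -⟩ := exists_egInsert_eq hP hr c1 c2
    have sp := insertSpec_egInsert hP₁ hr₁
    rw [heq] at sp
    have hb1 : height P₁ z.2 = z.1 := sp.height_box
    have hsub : ∀ {y m}, Function.update Q z none y = some m → y ≠ z ∧ Q y = some m := by
      intro y m hy
      rcases eq_or_ne y z with rfl | hne
      · rw [Function.update_self] at hy
        simp at hy
      · exact ⟨hne, by rwa [Function.update_of_ne hne] at hy⟩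
    have hS₁ : HasShape P₁ (Function.update Q z none) := by
      intro y
      have h1 : height P y.2 = height P₁ y.2 + if y.2 = z.2 then 1 else 0 := sp.height_eq y.2
      rcases eq_or_ne y z with rfl | hne
      · rw [Function.update_self]
        simp only [Option.isSome_none, Bool.false_eq_true, false_iff]
        omega
      · rw [Function.update_of_ne hne, hS, h1]
        split_ifs with h2
        · have : y.1 ≠ z.1 := fun h => hne (Prod.ext h h2)
          rw [h2]
          omega
        · rfl
    have hlen : (readTab P).length = (readTab P₁).length + 1 := sp.length_eq
    obtain ⟨s, hs1, hs2, hs3⟩ := ih hP₁ hr₁.left hS₁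
      ⟨fun x y m l h1 h2 h3 h4 => hQ.1 x y m l h1 h2 (hsub h3).2 (hsub h4).2,
        fun i i' j m l h1 h3 h4 => hQ.2 i i' j m l h1 (hsub h3).2 (hsub h4).2⟩ (by omega)
    have hrt : Red ((s ++ [(a, b)]).map Prod.snd) := by
      obtain ⟨-, h1, h2, -⟩ := egState_spec hs2
      rw [hs3] at h1 h2
      refine hr₁.congr ?_ ?_
      · rw [List.map_append, wordProd_append, ← h1, ← wordProd_append]
        rfl
      · simp [← h2]
    refine ⟨s ++ [(a, b)], ?_, hrt, ?_⟩
    · rw [List.pairwise_append]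
      refine ⟨hs1, by simp, fun u hu v hv => ?_⟩
      obtain rfl : v = (a, b) := by simpa using hv
      rcases List.eq_nil_or_concat s with rfl | ⟨s', x', rfl⟩
      · simp at hu
      · rw [List.concat_eq_append] at *
        -- for equal upper entries, an increase of the lower ones would put the new box weakly to the
        -- left of the previous one, into the same column
        have hlast : BiLt x' (a, b) := by
          have m1 : (egState (s' ++ [x'])).2 (newBox s' x') = some x'.1 := by
            rw [egState_concat_snd, Function.update_self]
          rw [hs3] at m1
          have m2 := hsub m1
          have m3 := hmax _ _ m2.2
          have hr' : Red (s'.map Prod.snd ++ [x'.2, b]) := by simpa using hrt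
          have h3 := col_egInsert_egInsert (x := x'.2) (x' := b)
            (egState_spec (t := s') hr'.left).1 (red_egState_append hr')
          rw [← egState_concat_fst, hs3, heq] at h3
          have h4 : x'.2 < b → z.2 ≤ (newBox s' x').2 := h3.1
          rcases m3.1.lt_or_eq with h5 | h5
          · exact Or.inl h5
          · right
            refine ⟨h5, ?_⟩
            by_contra hle
            push Not at hle
            rcases hle.lt_or_eq with h6 | h6
            · have h7 : (newBox s' x').2 = z.2 := le_antisymm (m3.2 h5) (h4 h6)
              have h8 : (newBox s' x').1 ≠ z.1 := fun h => m2.1 (Prod.ext h h7)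
              have h9 := hQ.2 (newBox s' x').1 z.1 z.2 x'.1 a
              have h10 := hQ.2 z.1 (newBox s' x').1 z.2 a x'.1
              rw [← h7] at h9 h10
              rcases Nat.lt_or_gt_of_ne h8 with h11 | h11
              · have := h9 h11 m2.2 (by rw [h7]; exact hz)
                omega
              · have := h10 h11 (by rw [h7]; exact hz) m2.2
                omega
            · simp only at h6
              rw [h6] at hr'
              exact not_red_cons_cons _ hr'.right
        rcases List.mem_append.1 hu with hu | hu
        · exact _root_.trans ((List.pairwise_append.1 hs1).2.2 u hu x' (by simp)) hlast
        · obtain rfl : u = x' := by simpa using hu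
          exact hlast
    · rw [egState_concat, hs3, egStep]
      simp only [heq, Function.update_idem]
      rw [← hz, Function.update_eq_self]

/-! ### Flagged tableaux -/

theorem height_le_of_append {s w : List (ℕ × ℕ)} (hr : Red ((s ++ w).map Prod.snd)) (j : ℕ) :
    height (egState s).1 j ≤ height (egState (s ++ w)).1 j := by
  induction w using List.reverseRecOn with
  | nil => simp
  | append_singleton w x ih =>
    rw [← List.append_assoc] at hr ⊢
    rw [(insertSpec_egState hr).height_eq]
    rw [List.map_append] at hr
    exact (ih hr.left).trans (Nat.le_add_right _ _)

theorem egState_append_snd {s w : List (ℕ × ℕ)} (hr : Red ((s ++ w).map Prod.snd)) {y : Box} {m : ℕ}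
    (hy : (egState s).2 y = some m) : (egState (s ++ w)).2 y = some m := by
  induction w using List.reverseRecOn with
  | nil => simpa using hy
  | append_singleton w x ih =>
    rw [← List.append_assoc] at hr ⊢
    have h1 := (insertSpec_egState hr).height_box
    rw [List.map_append] at hr
    have h2 := ih hr.left
    rw [egState_concat_snd, Function.update_of_ne, h2]
    rintro rfl
    have h3 := ((egState_spec hr.left).2.2.2 _).1 (by rw [h2]; rfl)
    omega

/-- The recording tableau of a compatible sequence is flagged. If the entry put into a new box in
row `i` were larger than `i + k`, then all letters inserted from this moment on would be larger than
`i + k`, and the rows up to `i` would have been complete already. -/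
theorem flag_le {k : ℕ} {μ : YoungDiagram} {t : List (ℕ × ℕ)} (ht : t.Pairwise BiLt)
    (hab : ∀ u ∈ t, u.1 ≤ u.2) (hr : Red (t.map Prod.snd))
    (hp : wordProd (t.map Prod.snd) = shiftPerm k (dominantPerm μ))
    (hsub : ∀ i j, i < height (egState t).1 j ↔ (i, j) ∈ μ.cells) {s w : List (ℕ × ℕ)}
    (hsw : t = s ++ w) {y : Box} {m : ℕ} (hy : (egState s).2 y = some m) : m ≤ y.1 + k := by
  induction s using List.reverseRecOn generalizing w with
  | nil => simp [egState] at hy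
  | append_singleton s x ih =>
    have hsw' : t = s ++ x :: w := by simp [hsw]
    rw [egState_concat_snd] at hy
    rcases eq_or_ne y (newBox s x) with rfl | hne
    · rw [Function.update_self] at hy
      obtain rfl := Option.some.inj hy
      by_contra hlt
      push Not at hlt
      -- all remaining letters are large, so the row of the new box was already complete
      have hs : Red (s.map Prod.snd) := by
        rw [hsw', List.map_append] at hr
        exact hr.left
      have hsx : Red ((s ++ [x]).map Prod.snd) := by
        rw [hsw, List.map_append] at hr
        exact hr.left
      obtain ⟨hT, h1, h2, h3⟩ := egState_spec hs
      have sp := insertSpec_egState hsx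
      have hbox := sp.height_box
      have hz : newBox s x ∈ μ.cells := by
        have h4 := sp.height_eq (newBox s x).2
        rw [if_pos rfl] at h4
        have h5 : (newBox s x).1 < height (egState (s ++ [x])).1 (newBox s x).2 := by omega
        exact (hsub _ _).1 (h5.trans_le
          (hsw ▸ height_le_of_append (s := s ++ [x]) (w := w) (hsw ▸ hr) _))
      have hr2 : Red (s.map Prod.snd ++ (x :: w).map Prod.snd) := by
        rw [← List.map_append, ← hsw']
        exact hr
      have key := hT.lt_height_of_forall_le (w := (x :: w).map Prod.snd) (k := k)
        (r := (newBox s x).1 + 1) (μ := μ) (red_egState_append hr2) (by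
          rw [wordProd_append, h1, ← wordProd_append, ← List.map_append, ← hsw', hp]) (by
          intro b hb
          obtain ⟨u, hu, rfl⟩ := List.mem_map.1 hb
          have h4 := hab u (by rw [hsw']; exact List.mem_append_right _ hu)
          rcases List.mem_cons.1 hu with rfl | hu
          · omega
          · rw [hsw', List.pairwise_append, List.pairwise_cons] at ht
            have h5 := ht.2.1.1 u hu
            simp only [BiLt] at h5
            omega)
        (fun i j hij => (hsub i j).1 (hij.trans_le
          (hsw' ▸ height_le_of_append (s := s) (w := x :: w) (hsw' ▸ hr) j)))
        (i := (newBox s x).1) (j := (newBox s x).2) hz (Nat.lt_succ_self _)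
      omega
    · rw [Function.update_of_ne hne] at hy
      exact ih hsw' hy

/-- A letter is larger than the row of its new box by at least `k`, because the first column of the
insertion tableau is strictly increasing and has no entry below `k`. -/
theorem newBox_le {k : ℕ} {s w : List (ℕ × ℕ)} {x : ℕ × ℕ}
    (hr : Red ((s ++ x :: w).map Prod.snd))
    (hf : ∀ m < k, wordProd ((s ++ x :: w).map Prod.snd) m = m) : (newBox s x).1 + k ≤ x.2 := by
  have hsx : Red ((s ++ [x]).map Prod.snd) := by
    rw [show s ++ x :: w = (s ++ [x]) ++ w by simp, List.map_append] at hr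
    exact hr.left
  have sp := insertSpec_egState hsx
  have hs : Red (s.map Prod.snd) := by
    rw [List.map_append] at hr
    exact hr.left
  obtain ⟨hT, h1, -, -⟩ := egState_spec hs
  rw [List.map_append] at hr hf
  have hr2 := red_egState_append hr
  have hlet := hr2.le_of_mem (k := k) fun m hm => by
    rw [wordProd_append, h1, ← wordProd_append]
    exact hf m hm
  have h2 := sp.row_le
  have h3 := cnt_add_le hT.pairwise_headD (k := k) (v := x.2)
    (fun c hc => hlet c (List.mem_append_left _ (mem_readTab_of_mem_headD hc)))
    (hlet _ (by simp))
  omega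

/-- The insertion tableau of a compatible sequence is always the same tableau of shape `μ`, so that
the sequences correspond to the semistandard tableaux; the condition `a ≤ b` on the columns of a
sequence corresponds to the flag condition. -/
theorem bijOn_recordingTableau (μ : YoungDiagram) (k : ℕ) :
    Set.BijOn recordingTableau (compatibleSequences (shiftPerm k (dominantPerm μ)))
      (flaggedTableaux μ k) := by
  have hfst : ∀ t : List (ℕ × ℕ), Red (t.map Prod.snd) →
      wordProd (t.map Prod.snd) = shiftPerm k (dominantPerm μ) →
      (egState t).1 = minTab k (colLens μ) := by
    intro t hr hp
    obtain ⟨h1, h2, h3, -⟩ := egState_spec hr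
    exact h1.eq_minTab_colLens (hr.congr h2 (by simp [h3])) (h2.trans hp)
  have hshape : ∀ i j, i < height (minTab k (colLens μ)) j ↔ (i, j) ∈ μ.cells := by
    intro i j
    rw [height_minTab, lt_colLens_getD]
  refine ⟨?_, ?_, ?_⟩
  · intro t ht
    obtain ⟨h1, h2, h3, h4⟩ := mem_compatibleSequences.1 ht
    have hP := hfst t h3 h2
    have hS := (egState_spec h3).2.2.2
    have hQ := (isSemistandard_egState h1 h3).1
    have hmem : ∀ i j, (i, j) ∈ μ → ∃ m, (egState t).2 (i, j) = some m := by
      intro i j hij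
      rw [← Option.isSome_iff_exists, hS, hP, hshape]
      exact hij
    rw [recordingTableau_eq]
    refine ⟨⟨fun i j => ((egState t).2 (i, j)).getD 0, ?_, ?_, ?_⟩, ?_, ?_⟩
    · intro i j j' hj hij
      obtain ⟨m, hm⟩ := hmem i j' hij
      obtain ⟨l, hl⟩ := hmem i j (μ.up_left_mem le_rfl hj.le hij)
      simp only [hm, hl, Option.getD_some]
      exact hQ.1 _ _ _ _ (le_refl i) hj.le hl hm
    · intro i i' j hi hij
      obtain ⟨m, hm⟩ := hmem i' j hij
      obtain ⟨l, hl⟩ := hmem i j (μ.up_left_mem hi.le le_rfl hij)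
      simp only [hm, hl, Option.getD_some]
      exact hQ.2 _ _ _ _ _ hi hl hm
    · intro i j hij
      have h5 : ¬ ((egState t).2 (i, j)).isSome = true := by
        rw [hS, hP, hshape]
        exact hij
      rw [Option.not_isSome_iff_eq_none] at h5
      rw [h5]
      rfl
    · rintro ⟨i, j⟩ hx
      obtain ⟨m, hm⟩ := hmem i j hx
      change ((egState t).2 (i, j)).getD 0 ≤ i + k
      rw [hm, Option.getD_some]
      exact flag_le h1 h4 h3 h2 (fun i j => by rw [hP, hshape]) (List.append_nil t).symm hm
    · ext1 x
      split_ifs with hx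
      · obtain ⟨m, hm⟩ := hmem x.1 x.2 hx
        change (egState t).2 x = some (((egState t).2 x).getD 0)
        rw [hm]
        rfl
      · rw [← Option.not_isSome_iff_eq_none, hS, hP, hshape]
        exact hx
  · intro t ht t' ht' h
    obtain ⟨h1, h2, h3, h4⟩ := mem_compatibleSequences.1 ht
    obtain ⟨h1', h2', h3', h4'⟩ := mem_compatibleSequences.1 ht'
    exact egState_inj h1 h1' h3 h3' (Prod.ext (by rw [hfst t h3 h2, hfst t' h3' h2']) h)
  · rintro T ⟨S, hflag, rfl⟩
    set Q : Tableau := fun x => if x ∈ μ.cells then some (S x.1 x.2) else none with hQdef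
    have hQ : ∀ {x m}, Q x = some m → x ∈ μ.cells ∧ S x.1 x.2 = m := by
      intro x m hx
      simp only [hQdef] at hx
      split_ifs at hx with h
      exact ⟨h, Option.some.inj hx⟩
    have hS : HasShape (minTab k (colLens μ)) Q := by
      intro x
      rw [hshape]
      by_cases hx : x ∈ μ.cells
      · simp only [hQdef, if_pos hx, Option.isSome_some, true_iff]
        exact hx
      · simp only [hQdef, if_neg hx, Option.isSome_none, Bool.false_eq_true, false_iff]
        exact hx
    obtain ⟨t, h1, h2, h3⟩ := exists_egState_eq
      (isTab_minTab (colLens_pairwise μ) (colLens_pos μ) k) (red_readTab_minTab k μ) hS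
      ⟨fun x y m l hx hy hm hl => by
        obtain ⟨-, rfl⟩ := hQ hm
        obtain ⟨hm2, rfl⟩ := hQ hl
        have hmid : (y.1, x.2) ∈ μ := μ.up_left_mem le_rfl hy ((YoungDiagram.mem_cells _).1 hm2)
        exact (S.col_weak hx hmid).trans (S.row_weak_of_le hy ((YoungDiagram.mem_cells _).1 hm2)),
      fun i i' j m l hi hm hl => by
        obtain ⟨-, rfl⟩ := hQ hm
        obtain ⟨hm2, rfl⟩ := hQ hl
        exact S.col_strict hi ((YoungDiagram.mem_cells _).1 hm2)⟩
    have hp : wordProd (t.map Prod.snd) = shiftPerm k (dominantPerm μ) := by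
      rw [← (egState_spec h2).2.1, h3, wordProd_readTab_minTab]
    refine ⟨t, mem_compatibleSequences.2 ⟨h1, hp, h2, ?_⟩, by rw [recordingTableau_eq, h3]⟩
    -- the flag condition for the box that `x` creates
    intro x hx
    obtain ⟨s, w, rfl⟩ := List.append_of_mem hx
    have h4 := newBox_le (k := k) h2 fun m hm => by rw [hp, shiftPerm_apply_of_lt _ hm]
    have h5 : (egState (s ++ x :: w)).2 (newBox s x) = some x.1 := by
      rw [show s ++ x :: w = (s ++ [x]) ++ w by simp] at h2 ⊢
      refine egState_append_snd h2 ?_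
      rw [egState_concat_snd, Function.update_self]
    rw [h3] at h5
    obtain ⟨h6, h7⟩ := hQ h5
    have h8 := hflag _ h6
    omega


/-! ### Flagged tableaux and reverse plane partitions -/

/-- Columns are strictly increasing, so entries grow by at least one in every row. -/
theorem ssyt_add_le {μ : YoungDiagram} (S : SemistandardYoungTableau μ) {i d j : ℕ}
    (h : (i + d, j) ∈ μ) : S i j + d ≤ S (i + d) j := by
  induction d with
  | zero => simp
  | succ d ih =>
    have h1 := ih (μ.up_left_mem (by omega) le_rfl h)
    have h2 := S.col_strict (i1 := i + d) (i2 := i + (d + 1)) (by omega) h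
    omega

theorem le_ssyt {μ : YoungDiagram} (S : SemistandardYoungTableau μ) {i j : ℕ}
    (h : (i, j) ∈ μ) : i ≤ S i j := by
  have := ssyt_add_le S (i := 0) (d := i) (j := j) (by simpa using h)
  rw [Nat.zero_add] at this
  omega

theorem bijOn_subtractRows (μ : YoungDiagram) (k : ℕ) :
    Set.BijOn subtractRows (flaggedTableaux μ k) (reversePlanePartitions μ k) := by
  refine ⟨?_, ?_, ?_⟩
  · rintro T ⟨S, hS, rfl⟩
    have key : ∀ x m, subtractRows (fun x => if x ∈ μ.cells then some (S x.1 x.2) else none) x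
        = some m → x ∈ μ.cells ∧ m = S x.1 x.2 - x.1 := by
      intro x m h
      by_cases hx : x ∈ μ.cells
      · simp only [subtractRows, hx, if_true, Option.map_some, Option.some.injEq] at h
        exact ⟨hx, h.symm⟩
      · simp [subtractRows, hx] at h
    refine ⟨fun x => ?_, fun x m h => ?_, fun x y m l hxy h h' => ?_⟩
    · by_cases hx : x ∈ μ.cells <;> simp [subtractRows, hx]
    · obtain ⟨hx, rfl⟩ := key x m h
      have := hS x hx
      omega
    · obtain ⟨hx, rfl⟩ := key x m h
      obtain ⟨hy, rfl⟩ := key y l h'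
      obtain ⟨d, hd⟩ := Nat.exists_eq_add_of_le hxy.1
      have h1 : (y.1, x.2) ∈ μ := μ.up_left_mem le_rfl hxy.2 hy
      have h2 := S.row_weak_of_le hxy.2 hy
      rw [hd] at h1 h2
      have h3 := ssyt_add_le S h1
      rw [hd]
      omega
  · rintro T ⟨S, hS, rfl⟩ T' ⟨S', hS', rfl⟩ h
    funext x
    by_cases hx : x ∈ μ.cells
    · have h1 := congrFun h x
      simp only [subtractRows, hx, if_true, Option.map_some, Option.some.injEq] at h1
      have h2 := le_ssyt S (i := x.1) (j := x.2) hx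
      have h3 := le_ssyt S' (i := x.1) (j := x.2) hx
      simp only [hx, if_true, Option.some.injEq]
      omega
    · simp [hx]
  · rintro R ⟨h1, h2, h3⟩
    have ex : ∀ {i j}, (i, j) ∈ μ → ∃ m, R (i, j) = some m := fun h =>
      Option.isSome_iff_exists.1 ((h1 _).2 h)
    refine ⟨_, ⟨⟨fun i j => if (i, j) ∈ μ then (R (i, j)).getD 0 + i else 0, ?_, ?_, ?_⟩, ?_, rfl⟩, ?_⟩
    · intro i j1 j2 hj hm
      have hm' : (i, j1) ∈ μ := μ.up_left_mem le_rfl hj.le hm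
      obtain ⟨m, e⟩ := ex hm
      obtain ⟨m', e'⟩ := ex hm'
      have := h3 (i, j1) (i, j2) m' m ⟨le_rfl, hj.le⟩ e' e
      simp [hm, hm', e, e', this]
    · intro i1 i2 j hi hm
      have hm' : (i1, j) ∈ μ := μ.up_left_mem hi.le le_rfl hm
      obtain ⟨m, e⟩ := ex hm
      obtain ⟨m', e'⟩ := ex hm'
      have := h3 (i1, j) (i2, j) m' m ⟨hi.le, le_rfl⟩ e' e
      simp only [hm, hm', e, e', if_true, Option.getD_some]
      omega
    · intro i j hm
      simp [hm]
    · intro x hx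
      obtain ⟨m, e⟩ := ex (i := x.1) (j := x.2) hx
      have := h2 _ _ e
      change (if (x.1, x.2) ∈ μ then (R (x.1, x.2)).getD 0 + x.1 else 0) ≤ x.1 + k
      have hx' : (x.1, x.2) ∈ μ := hx
      rw [if_pos hx', e, Option.getD_some]
      omega
    · funext x
      by_cases hx : x ∈ μ.cells
      · obtain ⟨m, e⟩ := ex (i := x.1) (j := x.2) hx
        have hx' : (x.1, x.2) ∈ μ := hx
        change ((if x ∈ μ.cells then some (if (x.1, x.2) ∈ μ then (R (x.1, x.2)).getD 0 + x.1 else 0)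
          else none).map fun m => m - x.1) = R x
        rw [if_pos hx, if_pos hx', e, Option.getD_some, Option.map_some, Nat.add_sub_cancel]
      · have h4 : R x = none := by
          rw [← Option.not_isSome_iff_eq_none, h1]
          exact hx
        rw [h4]
        simp [subtractRows, hx]

/-! ### Lattice paths and the boxes to their north-west -/

/-- A unit step of a lattice path, to the north or to the east. -/
abbrev PathStep (u v : ℕ × ℕ) : Prop :=
  (u.1 = v.1 + 1 ∧ u.2 = v.2) ∨ (u.1 = v.1 ∧ v.2 = u.2 + 1)

/-- The boxes strictly to the north-west of some lattice point of the path. -/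
def nwRegion (p : List (ℕ × ℕ)) (x : Box) : Bool :=
  decide (∃ u ∈ p, x.1 < u.1 ∧ x.2 < u.2)

/-- The lattice point `u` is on the south-east boundary of `N`: its south-east box is outside of
`N` and its north-west box is in `N`, or off the quadrant. -/
def OnBoundary (N : Box → Bool) (u : ℕ × ℕ) : Prop :=
  N u = false ∧ (u.1 = 0 ∨ u.2 = 0 ∨ N (u.1 - 1, u.2 - 1) = true)

theorem nwRegion_eq_true {p : List (ℕ × ℕ)} {x : Box} :
    nwRegion p x = true ↔ ∃ u ∈ p, x.1 < u.1 ∧ x.2 < u.2 := by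
  simp [nwRegion]

/-- Every step moves on to the next diagonal. -/
theorem getElem_content {p : List (ℕ × ℕ)} (h : p.IsChain PathStep) (s : ℕ) (hs : s < p.length) :
    p[s].2 + (p[0]'(by omega)).1 = p[s].1 + (p[0]'(by omega)).2 + s := by
  induction s with
  | zero => omega
  | succ s ih =>
    have h1 := ih (by omega)
    have h2 := List.isChain_iff_getElem.1 h s hs
    rcases h2 with h2 | h2 <;> omega

theorem pairwise_of_isChain {p : List (ℕ × ℕ)} (h : p.IsChain PathStep) :
    p.Pairwise fun u v => v.1 ≤ u.1 ∧ u.2 ≤ v.2 := by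
  have : IsTrans (ℕ × ℕ) fun u v => v.1 ≤ u.1 ∧ u.2 ≤ v.2 :=
    ⟨fun a b c h1 h2 => ⟨h2.1.trans h1.1, h1.2.trans h2.2⟩⟩
  refine List.isChain_iff_pairwise.1 (h.imp fun u v huv => ?_)
  rcases huv with h | h <;> omega

/-- No point of a path is strictly to the south-east of another one. -/
theorem onBoundary_nwRegion {p : List (ℕ × ℕ)} (h : p.IsChain PathStep) {u : ℕ × ℕ} (hu : u ∈ p) :
    OnBoundary (nwRegion p) u := by
  constructor
  · rw [← Bool.not_eq_true, nwRegion_eq_true]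
    rintro ⟨v, hv, h1, h2⟩
    obtain ⟨a, ha, rfl⟩ := List.getElem_of_mem hu
    obtain ⟨b, hb, rfl⟩ := List.getElem_of_mem hv
    have h5 := List.pairwise_iff_getElem.1 (pairwise_of_isChain h)
    rcases lt_trichotomy a b with hab | rfl | hab
    · have := h5 a b ha hb hab
      omega
    · omega
    · have := h5 b a hb ha hab
      omega
  · by_cases h1 : u.1 = 0
    · exact Or.inl h1
    by_cases h2 : u.2 = 0
    · exact Or.inr (Or.inl h2)
    exact Or.inr (Or.inr (nwRegion_eq_true.2 ⟨u, hu, by simp only; omega, by simp only; omega⟩))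

/-- A path on the boundary of `N` has no choice: it is the boundary walk. -/
theorem eq_boundaryWalk {N : Box → Bool} {u : ℕ × ℕ} {l : List (ℕ × ℕ)}
    (h : (u :: l).IsChain PathStep) (hb : ∀ v ∈ u :: l, OnBoundary N v) :
    u :: l = boundaryWalk N l.length u := by
  induction l generalizing u with
  | nil => rfl
  | cons v l ih =>
    rw [List.isChain_cons_cons] at h
    have h1 := ih h.2 (fun w hw => hb w (List.mem_cons_of_mem _ hw))
    have h2 := hb v (by simp)
    obtain ⟨hs, -⟩ := h
    obtain ⟨i, j⟩ := u
    obtain ⟨i', j'⟩ := v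
    simp only [PathStep] at hs
    rw [List.length_cons]
    cases i with
    | zero =>
      obtain ⟨rfl, rfl⟩ : i' = 0 ∧ j' = j + 1 := by omega
      rw [boundaryWalk, ← h1]
    | succ i =>
      rw [boundaryWalk]
      rcases hs with ⟨h3, rfl⟩ | ⟨rfl, rfl⟩
      · obtain rfl : i = i' := by omega
        rw [if_neg (by rw [h2.1]; simp), ← h1]
      · have h4 : N (i, j) = true := by
          rcases h2.2 with h5 | h5 | h5
          · simp at h5
          · simp at h5
          · simpa using h5
        rw [if_pos h4, ← h1]

theorem boundaryWalk_eq_cons (N : Box → Bool) (s : ℕ) (u : ℕ × ℕ) :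
    ∃ l, boundaryWalk N s u = u :: l ∧ l.length = s := by
  induction s generalizing u with
  | zero => exact ⟨[], rfl, rfl⟩
  | succ s ih =>
    obtain ⟨_ | i, j⟩ := u
    · obtain ⟨l, h1, h2⟩ := ih (0, j + 1)
      exact ⟨_, rfl, by rw [h1, List.length_cons, h2]⟩
    · obtain ⟨l, h1, h2⟩ := ih (if N (i, j) then (i + 1, j + 1) else (i, j))
      exact ⟨_, rfl, by rw [h1, List.length_cons, h2]⟩

theorem isChain_boundaryWalk {N : Box → Bool} {s : ℕ} {u : ℕ × ℕ} :
    (boundaryWalk N s u).IsChain PathStep := by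
  induction s generalizing u with
  | zero => exact List.isChain_singleton _
  | succ s ih =>
    obtain ⟨_ | i, j⟩ := u
    · obtain ⟨l, h1, -⟩ := boundaryWalk_eq_cons N s (0, j + 1)
      have := ih (u := (0, j + 1))
      rw [h1] at this
      rw [boundaryWalk, h1]
      exact List.isChain_cons_cons.2 ⟨Or.inr ⟨rfl, rfl⟩, this⟩
    · obtain ⟨l, h1, -⟩ := boundaryWalk_eq_cons N s (if N (i, j) then (i + 1, j + 1) else (i, j))
      have := ih (u := if N (i, j) then (i + 1, j + 1) else (i, j))
      rw [h1] at this
      rw [boundaryWalk, h1]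
      refine List.isChain_cons_cons.2 ⟨?_, this⟩
      by_cases hN : N (i, j) = true
      · rw [if_pos hN]
        exact Or.inr ⟨rfl, rfl⟩
      · rw [if_neg hN]
        exact Or.inl ⟨rfl, rfl⟩

/-- `N` is a Ferrers shape contained in `μ`. -/
structure IsSubshape (μ : YoungDiagram) (N : Box → Bool) : Prop where
  mem : ∀ {x}, N x = true → x ∈ μ.cells
  anti : ∀ {x y : Box}, x.1 ≤ y.1 → x.2 ≤ y.2 → N y = true → N x = true

theorem IsSubshape.eq_false {μ : YoungDiagram} {N : Box → Bool} (hN : IsSubshape μ N) {x y : Box}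
    (h1 : x.1 ≤ y.1) (h2 : x.2 ≤ y.2) (h : N x = false) : N y = false := by
  rw [← Bool.not_eq_true] at h ⊢
  exact fun hy => h (hN.anti h1 h2 hy)

theorem IsSubshape.onBoundary {μ : YoungDiagram} {N : Box → Bool} (hN : IsSubshape μ N) {s : ℕ}
    {u : ℕ × ℕ} (hu : OnBoundary N u) : ∀ v ∈ boundaryWalk N s u, OnBoundary N v := by
  induction s generalizing u with
  | zero =>
    intro v hv
    rw [boundaryWalk, List.mem_singleton] at hv
    exact hv ▸ hu
  | succ s ih =>
    obtain ⟨_ | i, j⟩ := u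
    · rw [boundaryWalk, List.forall_mem_cons]
      refine ⟨hu, ih ⟨hN.eq_false (x := (0, j)) le_rfl (Nat.le_succ j) hu.1, Or.inl rfl⟩⟩
    · rw [boundaryWalk, List.forall_mem_cons]
      refine ⟨hu, ?_⟩
      by_cases h : N (i, j) = true
      · rw [if_pos h]
        exact ih ⟨hN.eq_false (x := (i + 1, j)) le_rfl (Nat.le_succ j) hu.1, Or.inr (Or.inr h)⟩
      · rw [if_neg h]
        refine ih ⟨by simpa using h, ?_⟩
        rcases hu.2 with h1 | h1 | h1
        · simp at h1
        · exact Or.inr (Or.inl h1)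
        · exact Or.inr (Or.inr (hN.anti (y := (i, j - 1)) (Nat.sub_le _ _) le_rfl h1))

theorem notMem_colLen {μ : YoungDiagram} {c : ℕ} : (μ.colLen 0, c) ∉ μ.cells := by
  intro h
  have h1 : (μ.colLen 0, c) ∈ μ := h
  rw [YoungDiagram.mem_iff_lt_colLen] at h1
  exact absurd (μ.colLen_anti 0 c (Nat.zero_le _)) (by omega)

theorem IsSubshape.onBoundary_start {μ : YoungDiagram} {N : Box → Bool} (hN : IsSubshape μ N) :
    OnBoundary N (μ.colLen 0, 0) :=
  ⟨by rw [← Bool.not_eq_true]; exact fun h => notMem_colLen (hN.mem h), Or.inr (Or.inl rfl)⟩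

/-- The boundary walk that starts at the south-west corner of the rectangle around `μ`. -/
abbrev fullWalk (μ : YoungDiagram) (N : Box → Bool) : List (ℕ × ℕ) :=
  boundaryWalk N (μ.colLen 0 + μ.rowLen 0) (μ.colLen 0, 0)

theorem fullWalk_zero {μ : YoungDiagram} {N : Box → Bool} (h : 0 < (fullWalk μ N).length) :
    (fullWalk μ N)[0] = (μ.colLen 0, 0) := by
  obtain ⟨l, h1, -⟩ := boundaryWalk_eq_cons N (μ.colLen 0 + μ.rowLen 0) (μ.colLen 0, 0)
  simp [fullWalk, h1]

theorem length_fullWalk (μ : YoungDiagram) (N : Box → Bool) :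
    (fullWalk μ N).length = μ.colLen 0 + μ.rowLen 0 + 1 := by
  obtain ⟨l, h1, h2⟩ := boundaryWalk_eq_cons N (μ.colLen 0 + μ.rowLen 0) (μ.colLen 0, 0)
  rw [fullWalk, h1, List.length_cons, h2]

theorem IsSubshape.isPathInside {μ : YoungDiagram} {N : Box → Bool} (hN : IsSubshape μ N) :
    IsPathInside μ (fullWalk μ N) := by
  have hb := hN.onBoundary (s := μ.colLen 0 + μ.rowLen 0) hN.onBoundary_start
  have hlen := length_fullWalk μ N
  refine ⟨?_, ?_, isChain_boundaryWalk, ?_⟩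
  · obtain ⟨l, h1, -⟩ := boundaryWalk_eq_cons N (μ.colLen 0 + μ.rowLen 0) (μ.colLen 0, 0)
    rw [fullWalk, h1, List.head?_cons]
  · have h0 : μ.colLen 0 + μ.rowLen 0 < (fullWalk μ N).length := by omega
    have h1 := getElem_content (isChain_boundaryWalk (N := N) (s := μ.colLen 0 + μ.rowLen 0)
      (u := (μ.colLen 0, 0))) (μ.colLen 0 + μ.rowLen 0) h0
    rw [fullWalk_zero] at h1
    have h2 := hb _ (List.getElem_mem h0)
    rw [List.getLast?_eq_getElem?, hlen, Nat.add_sub_cancel, List.getElem?_eq_getElem h0]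
    congr 1
    generalize (fullWalk μ N)[μ.colLen 0 + μ.rowLen 0] = v at h1 h2
    obtain ⟨r, c⟩ := v
    simp only at h1
    have h3 : r = 0 := by
      by_contra hr
      rcases h2.2 with h3 | h3 | h3
      · exact hr h3
      · simp only at h3
        omega
      · have h4 : (r - 1, c - 1) ∈ μ := hN.mem h3
        rw [YoungDiagram.mem_iff_lt_rowLen] at h4
        have := μ.rowLen_anti 0 (r - 1) (Nat.zero_le _)
        omega
    subst h3
    congr 1
    omega
  · intro i j hij
    rcases (hb _ hij).2 with h | h | h
    · simp at h
    · simp at h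
    · exact hN.mem h

/-! ### Paths inside a shape -/

theorem IsPathInside.ne_nil {μ : YoungDiagram} {p : List (ℕ × ℕ)} (hp : IsPathInside μ p) :
    0 < p.length := by
  rw [List.length_pos_iff]
  rintro rfl
  simpa using hp.1

theorem IsPathInside.getElem_zero {μ : YoungDiagram} {p : List (ℕ × ℕ)} (hp : IsPathInside μ p)
    (h : 0 < p.length) : p[0] = (μ.colLen 0, 0) := by
  have := hp.1
  rw [List.head?_eq_getElem?, List.getElem?_eq_getElem h] at this
  exact Option.some.inj this

theorem IsPathInside.diagonal {μ : YoungDiagram} {p : List (ℕ × ℕ)} (hp : IsPathInside μ p)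
    {s : ℕ} (hs : s < p.length) : p[s].2 + μ.colLen 0 = p[s].1 + s := by
  have := getElem_content hp.2.2.1 s hs
  rw [hp.getElem_zero] at this
  simpa using this

theorem IsPathInside.length {μ : YoungDiagram} {p : List (ℕ × ℕ)} (hp : IsPathInside μ p) :
    p.length = μ.colLen 0 + μ.rowLen 0 + 1 := by
  have h0 := hp.ne_nil
  have h1 := hp.diagonal (s := p.length - 1) (by omega)
  have h2 := hp.2.1
  rw [List.getLast?_eq_getElem?, List.getElem?_eq_getElem (by omega)] at h2
  rw [Option.some.inj h2] at h1
  simp only at h1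
  omega

theorem IsPathInside.isSubshape {μ : YoungDiagram} {p : List (ℕ × ℕ)} (hp : IsPathInside μ p) :
    IsSubshape μ (nwRegion p) := by
  constructor
  · rintro x h
    obtain ⟨⟨i, j⟩, hu, h1, h2⟩ := nwRegion_eq_true.1 h
    simp only at h1 h2
    have h3 := hp.2.2.2 (i - 1) (j - 1) (by
      rwa [Nat.sub_add_cancel (by omega), Nat.sub_add_cancel (by omega)])
    exact mem_cells_of_le h3 (by simp only; omega) (by simp only; omega)
  · intro x y h1 h2 h
    obtain ⟨u, hu, h3, h4⟩ := nwRegion_eq_true.1 h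
    exact nwRegion_eq_true.2 ⟨u, hu, by omega, by omega⟩

/-- Every path is the boundary walk of the boxes to its north-west. -/
theorem IsPathInside.eq_fullWalk {μ : YoungDiagram} {p : List (ℕ × ℕ)} (hp : IsPathInside μ p) :
    p = fullWalk μ (nwRegion p) := by
  have h1 := hp.length
  have h2 := hp.1
  have h3 := hp.2.2.1
  have h4 : ∀ u ∈ p, OnBoundary (nwRegion p) u := fun u hu => onBoundary_nwRegion h3 hu
  generalize hN : nwRegion p = N at h4
  cases p with
  | nil => simp at h2
  | cons u l =>
    rw [List.head?_cons, Option.some.injEq] at h2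
    rw [eq_boundaryWalk h3 h4, h2]
    rw [List.length_cons, Nat.add_right_cancel_iff] at h1
    rw [h1]

/-- Walking along the boundary of a shape recovers the shape. -/
theorem nwRegion_fullWalk {μ : YoungDiagram} {N : Box → Bool} (hN : IsSubshape μ N) :
    nwRegion (fullWalk μ N) = N := by
  have hb := hN.onBoundary (s := μ.colLen 0 + μ.rowLen 0) hN.onBoundary_start
  have hp := hN.isPathInside
  funext x
  rw [Bool.eq_iff_iff, nwRegion_eq_true]
  constructor
  · rintro ⟨u, hu, h1, h2⟩
    rcases (hb u hu).2 with h | h | h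
    · omega
    · omega
    · exact hN.anti (by simp only; omega) (by simp only; omega) h
  · intro h
    -- the point of the walk on the diagonal through `x`
    have hx : (x.1, x.2) ∈ μ := hN.mem h
    have h1 := hx
    rw [YoungDiagram.mem_iff_lt_colLen] at hx
    rw [YoungDiagram.mem_iff_lt_rowLen] at h1
    have h2 := μ.colLen_anti 0 x.2 (Nat.zero_le _)
    have h3 := μ.rowLen_anti 0 x.1 (Nat.zero_le _)
    have hs : μ.colLen 0 + x.2 - x.1 < (fullWalk μ N).length := by
      rw [length_fullWalk]
      omega
    have h4 := hp.diagonal hs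
    have h5 := List.getElem_mem hs
    refine ⟨_, h5, ?_⟩
    by_contra hlt
    have h6 : N _ = true := hN.anti (x := (fullWalk μ N)[μ.colLen 0 + x.2 - x.1]) (by omega)
      (by omega) h
    rw [(hb _ h5).1] at h6
    exact Bool.false_ne_true h6

/-- One path is weakly south-east of another if it has more boxes to its north-west. -/
theorem IsPathInside.forall₂_iff {μ : YoungDiagram} {p q : List (ℕ × ℕ)} (hp : IsPathInside μ p)
    (hq : IsPathInside μ q) :
    List.Forall₂ (fun u v : ℕ × ℕ => v.1 ≤ u.1) p q ↔
      ∀ x, nwRegion q x = true → nwRegion p x = true := by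
  have hlen : p.length = q.length := hp.length.trans hq.length.symm
  rw [List.forall₂_iff_get]
  constructor
  · rintro ⟨-, h⟩ x hx
    obtain ⟨u, hu, h1, h2⟩ := nwRegion_eq_true.1 hx
    obtain ⟨s, hs, rfl⟩ := List.getElem_of_mem hu
    have h3 := h s (hlen ▸ hs) hs
    simp only [List.get_eq_getElem] at h3
    have h4 := hp.diagonal (s := s) (hlen ▸ hs)
    have h5 := hq.diagonal hs
    exact nwRegion_eq_true.2 ⟨_, List.getElem_mem (hlen ▸ hs), by omega, by omega⟩
  · intro h
    refine ⟨hlen, fun s hs hs' => ?_⟩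
    simp only [List.get_eq_getElem]
    by_contra hlt
    have h4 := hp.diagonal hs
    have h5 := hq.diagonal hs'
    have h6 := h p[s] (nwRegion_eq_true.2 ⟨_, List.getElem_mem hs', by omega, by omega⟩)
    rw [(onBoundary_nwRegion hp.2.2.1 (List.getElem_mem hs)).1] at h6
    exact Bool.false_ne_true h6

/-! ### Reverse plane partitions and fans -/

theorem any_eq_true_iff {R : Tableau} {k i : ℕ} {x : Box} :
    ((R x).any fun m => decide (m + i < k)) = true ↔ ∃ m, R x = some m ∧ m + i < k := by
  simp [Option.any_eq_true]

theorem isSubshape_rpp {μ : YoungDiagram} {k : ℕ} {R : Tableau}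
    (hR : R ∈ reversePlanePartitions μ k) (i : ℕ) :
    IsSubshape μ fun x => (R x).any fun m => decide (m + i < k) := by
  constructor
  · intro x h
    obtain ⟨m, h1, -⟩ := any_eq_true_iff.1 h
    exact (hR.1 x).1 (by rw [h1]; rfl)
  · intro x y h1 h2 h
    obtain ⟨m, h3, h4⟩ := any_eq_true_iff.1 h
    have h5 : y ∈ μ.cells := (hR.1 y).1 (by rw [h3]; rfl)
    obtain ⟨l, h6⟩ := Option.isSome_iff_exists.1 ((hR.1 x).2 (mem_cells_of_le h5 h1 h2))
    have := hR.2.2 x y l m ⟨h1, h2⟩ h6 h3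
    exact any_eq_true_iff.2 ⟨l, h6, by omega⟩

/-- A reverse plane partition is a chain of nested subshapes, a fan is the chain of their
boundaries. -/
theorem bijOn_fanOfRPP (μ : YoungDiagram) (k : ℕ) :
    Set.BijOn (fanOfRPP μ k) (reversePlanePartitions μ k) (fans μ k) := by
  refine ⟨?_, ?_, ?_⟩
  · intro R hR
    refine ⟨fun i => (isSubshape_rpp hR i).isPathInside, fun i j hij => ?_⟩
    refine ((isSubshape_rpp hR i).isPathInside.forall₂_iff
      (isSubshape_rpp hR j).isPathInside).2 fun x hx => ?_
    rw [nwRegion_fullWalk (isSubshape_rpp hR _)] at hx ⊢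
    obtain ⟨m, h1, h2⟩ := any_eq_true_iff.1 hx
    exact any_eq_true_iff.2 ⟨m, h1, by have : (i : ℕ) < j := hij; omega⟩
  · intro R hR R' hR' h
    have key : ∀ (i : Fin k) x, (∃ m, R x = some m ∧ m + i < k) ↔
        ∃ m, R' x = some m ∧ m + i < k := by
      intro i x
      have h1 := congrArg nwRegion (congrFun h i)
      simp only [fanOfRPP] at h1
      rw [nwRegion_fullWalk (isSubshape_rpp hR _), nwRegion_fullWalk (isSubshape_rpp hR' _)] at h1
      rw [← any_eq_true_iff, ← any_eq_true_iff]
      exact Bool.eq_iff_iff.1 (congrFun h1 x)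
    funext x
    by_cases hx : x ∈ μ.cells
    · obtain ⟨m, hm⟩ := Option.isSome_iff_exists.1 ((hR.1 x).2 hx)
      obtain ⟨m', hm'⟩ := Option.isSome_iff_exists.1 ((hR'.1 x).2 hx)
      have hk := hR.2.1 x m hm
      have hk' := hR'.2.1 x m' hm'
      have h1 : ∀ i : Fin k, m + i < k ↔ m' + i < k := fun i => by simpa [hm, hm'] using key i x
      rw [hm, hm']
      rcases lt_trichotomy m m' with hlt | rfl | hlt
      · have := h1 ⟨k - 1 - m, by omega⟩
        simp only at this
        omega
      · rfl
      · have := h1 ⟨k - 1 - m', by omega⟩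
        simp only at this
        omega
    · have h1 : R x = none := by
        rw [← Option.not_isSome_iff_eq_none, hR.1]
        exact hx
      have h2 : R' x = none := by
        rw [← Option.not_isSome_iff_eq_none, hR'.1]
        exact hx
      rw [h1, h2]
  · rintro f ⟨hf, hnc⟩
    have hnest : ∀ i j : Fin k, i ≤ j → ∀ x, nwRegion (f j) x = true → nwRegion (f i) x = true := by
      intro i j hij
      rcases hij.lt_or_eq with h | rfl
      · exact ((hf i).forall₂_iff (hf j)).1 (hnc i j h)
      · exact fun _ h => h
    -- the entry of a box is the number of paths that do not have it to their north-west
    let c : Box → ℕ := fun x => (Finset.univ.filter fun i => nwRegion (f i) x = false).card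
    have hc : ∀ x (i : Fin k), c x + i < k ↔ nwRegion (f i) x = true := by
      intro x i
      constructor
      · intro h
        by_contra hi
        rw [Bool.not_eq_true] at hi
        have h1 : (Finset.Ici i).card ≤ c x := Finset.card_le_card fun j hj => by
          rw [Finset.mem_filter, ← Bool.not_eq_true]
          refine ⟨Finset.mem_univ _, fun h2 => ?_⟩
          rw [hnest i j (Finset.mem_Ici.1 hj) x h2] at hi
          exact Bool.true_eq_false_eq_False hi
        rw [Fin.card_Ici] at h1
        omega
      · intro hi
        have h1 : c x ≤ (Finset.Ioi i).card := Finset.card_le_card fun j hj => by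
          rw [Finset.mem_filter] at hj
          rw [Finset.mem_Ioi]
          by_contra h2
          have h3 := hnest j i (not_lt.1 h2) x hi
          rw [hj.2] at h3
          exact Bool.false_ne_true h3
        rw [Fin.card_Ioi] at h1
        omega
    have hR : (fun x => if x ∈ μ.cells then some (c x) else none) ∈ reversePlanePartitions μ k := by
      refine ⟨fun x => ?_, fun x m h => ?_, fun x y m l hxy h h' => ?_⟩
      · by_cases hx : x ∈ μ.cells <;> simp [hx]
      · by_cases hx : x ∈ μ.cells
        · simp only [hx, if_true, Option.some.injEq] at h
          rw [← h]
          exact (Finset.card_le_univ _).trans_eq (Fintype.card_fin k)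
        · simp [hx] at h
      · by_cases hx : x ∈ μ.cells
        · by_cases hy : y ∈ μ.cells
          · simp only [hx, hy, if_true, Option.some.injEq] at h h'
            rw [← h, ← h']
            refine Finset.card_le_card fun i hi => ?_
            rw [Finset.mem_filter] at hi ⊢
            exact ⟨hi.1, (hf i).isSubshape.eq_false hxy.1 hxy.2 hi.2⟩
          · simp [hy] at h'
        · simp [hx] at h
    refine ⟨_, hR, ?_⟩
    funext i
    rw [(hf i).eq_fullWalk]
    simp only [fanOfRPP]
    congr 1
    funext x
    rw [Bool.eq_iff_iff]
    refine (any_eq_true_iff (R := fun x => if x ∈ μ.cells then some (c x) else none)).trans ?_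
    constructor
    · rintro ⟨m, h1, h2⟩
      by_cases hx : x ∈ μ.cells
      · simp only [hx, if_true, Option.some.injEq] at h1
        exact (hc x i).1 (h1 ▸ h2)
      · simp [hx] at h1
    · intro h
      have hx := (hf i).isSubshape.mem h
      exact ⟨c x, by simp [hx], (hc x i).2 h⟩


/-! ### South-east chains -/

/-- The rectangle spanned by a south-east chain needs no attention: it lies to the north-west of
the last box of the chain. -/
theorem isSEChain_iff {lam : YoungDiagram} {k : ℕ} {c : Fin (k + 1) → Box} :
    IsSEChain lam c ↔ IsSE c ∧ ∀ a, c a ∈ lam.cells := by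
  refine ⟨fun h => ⟨h.1, h.2.1⟩, fun h => ⟨h.1, h.2, ?_⟩⟩
  rintro x ⟨-, ⟨a, ha⟩, -, ⟨b, hb⟩⟩
  have key : ∀ a, (c a).1 ≤ (c (Fin.last k)).1 ∧ (c a).2 ≤ (c (Fin.last k)).2 := by
    intro a
    rcases (Fin.le_last a).lt_or_eq with h1 | h1
    · have := h.1 a _ h1
      omega
    · rw [h1]
      omega
  exact mem_cells_of_le (h.2 (Fin.last k)) (ha.trans (key a).1) (hb.trans (key b).2)

/-- Pairwise comparable boxes can be arranged in a south-east chain. -/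
theorem exists_isSE {k : ℕ} {S : Finset Box} (hcard : S.card = k + 1)
    (hS : ∀ x ∈ S, ∀ y ∈ S, x = y ∨ (x.1 < y.1 ∧ x.2 < y.2) ∨ (y.1 < x.1 ∧ y.2 < x.2)) :
    ∃ c : Fin (k + 1) → Box, IsSE c ∧ (∀ a, c a ∈ S) ∧ ∀ x ∈ S, ∃ a, c a = x := by
  have hinj : Set.InjOn Prod.fst (S : Set Box) := fun x hx y hy h => by
    rcases hS x hx y hy with h1 | h1 | h1
    · exact h1
    all_goals omega
  have hc : (S.image Prod.fst).card = k + 1 := by rw [Finset.card_image_of_injOn hinj, hcard]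
  have hex : ∀ a, ∃ x ∈ S, x.1 = ((S.image Prod.fst).orderIsoOfFin hc a : ℕ) := fun a =>
    Finset.mem_image.1 ((S.image Prod.fst).orderIsoOfFin hc a).2
  choose c hc1 hc2 using hex
  refine ⟨c, fun a b hab => ?_, hc1, fun x hx => ?_⟩
  · have h1 : ((S.image Prod.fst).orderIsoOfFin hc a : ℕ) < (S.image Prod.fst).orderIsoOfFin hc b :=
      ((S.image Prod.fst).orderIsoOfFin hc).strictMono hab
    rw [← hc2, ← hc2] at h1
    rcases hS _ (hc1 a) _ (hc1 b) with h2 | h2 | h2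
    · rw [h2] at h1
      omega
    · exact h2
    · omega
  · obtain ⟨a, ha⟩ := ((S.image Prod.fst).orderIsoOfFin hc).surjective
      ⟨x.1, Finset.mem_image_of_mem _ hx⟩
    refine ⟨a, hinj (hc1 a) hx ?_⟩
    rw [hc2, ha]

theorem AvoidsSE.card_le {lam : YoungDiagram} {k : ℕ} {F S : Finset Box} (hF : AvoidsSE lam k F)
    (hSF : S ⊆ F)
    (hS : ∀ x ∈ S, ∀ y ∈ S, x = y ∨ (x.1 < y.1 ∧ x.2 < y.2) ∨ (y.1 < x.1 ∧ y.2 < x.2)) :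
    S.card ≤ k := by
  by_contra h
  obtain ⟨S', h1, h2⟩ := Finset.exists_subset_card_eq (show k + 1 ≤ S.card by omega)
  obtain ⟨c, h3, h4, -⟩ := exists_isSE h2 fun x hx y hy => hS x (h1 hx) y (h1 hy)
  exact hF.2 ⟨c, isSEChain_iff.2 ⟨h3, fun a => hF.1 (hSF (h1 (h4 a)))⟩, fun a => hSF (h1 (h4 a))⟩

/-! ### Diagonals -/

/-- The content of a box, which is constant along diagonals. -/
def content (x : Box) : ℤ := (x.2 : ℤ) - x.1

/-- The rows of the boxes of `F` on the diagonal of content `d`. -/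
def diagRows (F : Finset Box) (d : ℤ) : Finset ℕ :=
  (F.filter fun x => content x = d).image Prod.fst

theorem mem_diagRows {F : Finset Box} {d : ℤ} {i : ℕ} :
    i ∈ diagRows F d ↔ ∃ j, (i, j) ∈ F ∧ (j : ℤ) - i = d := by
  rw [diagRows, Finset.mem_image]
  constructor
  · rintro ⟨⟨i, j⟩, h, rfl⟩
    exact ⟨j, (Finset.mem_filter.1 h).1, (Finset.mem_filter.1 h).2⟩
  · rintro ⟨j, h1, h2⟩
    exact ⟨(i, j), Finset.mem_filter.2 ⟨h1, h2⟩, rfl⟩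

theorem mem_diagRows_content {F : Finset Box} {x : Box} :
    x.1 ∈ diagRows F (content x) ↔ x ∈ F := by
  rw [mem_diagRows]
  constructor
  · rintro ⟨j, h1, h2⟩
    obtain rfl : j = x.2 := by
      simp only [content] at h2
      omega
    exact h1
  · exact fun h => ⟨x.2, h, rfl⟩

theorem diagRows_subset {F G : Finset Box} (h : F ⊆ G) (d : ℤ) : diagRows F d ⊆ diagRows G d :=
  Finset.image_subset_image (Finset.filter_subset_filter _ h)

theorem card_diagRows (F : Finset Box) (d : ℤ) :
    (diagRows F d).card = (F.filter fun x => content x = d).card := by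
  refine Finset.card_image_of_injOn fun x hx y hy h => ?_
  have h1 := (Finset.mem_filter.1 hx).2
  have h2 := (Finset.mem_filter.1 hy).2
  simp only [content] at h1 h2
  exact Prod.ext h (by omega)

theorem card_eq_sum_diagRows {lam : YoungDiagram} {F : Finset Box} (h : F ⊆ lam.cells) :
    F.card = ∑ d ∈ lam.cells.image content, (diagRows F d).card := by
  simp only [card_diagRows]
  exact Finset.card_eq_sum_card_fiberwise fun x hx => Finset.mem_image_of_mem _ (h hx)

/-- The boxes of a diagonal form a chain. -/
theorem AvoidsSE.card_diagRows_le {lam : YoungDiagram} {k : ℕ} {F : Finset Box}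
    (hF : AvoidsSE lam k F) (d : ℤ) : (diagRows F d).card ≤ k := by
  rw [card_diagRows]
  refine hF.card_le (Finset.filter_subset _ _) fun x hx y hy => ?_
  have h1 := (Finset.mem_filter.1 hx).2
  have h2 := (Finset.mem_filter.1 hy).2
  simp only [content] at h1 h2
  rcases lt_trichotomy x.1 y.1 with h | h | h
  · omega
  · exact Or.inl (Prod.ext h (by omega))
  · omega

/-- The diagonals of `lam` that have more than `k` boxes are those that meet the shape obtained by
removing `k` rows and `k` columns. -/
def IsLong (lam : YoungDiagram) (k : ℕ) (d : ℤ) : Prop :=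
  ∃ y ∈ (removeHook lam k).cells, content y = d

/-- A diagonal is long if it has a box outside of the first `k` rows and columns. -/
theorem isLong_iff {lam : YoungDiagram} {k : ℕ} {d : ℤ} :
    IsLong lam k d ↔ ∃ x ∈ lam.cells, k ≤ x.1 ∧ k ≤ x.2 ∧ content x = d := by
  simp only [IsLong, content]
  constructor
  · rintro ⟨⟨i, j⟩, h1, h2⟩
    refine ⟨(i + k, j + k), mem_removeHook.1 h1, Nat.le_add_left _ _, Nat.le_add_left _ _, ?_⟩
    simp only at h2 ⊢
    omega
  · rintro ⟨⟨i, j⟩, h1, h2, h3, h4⟩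
    simp only at h2 h3 h4
    refine ⟨(i - k, j - k), mem_removeHook.2 ?_, ?_⟩
    · rwa [Nat.sub_add_cancel h2, Nat.sub_add_cancel h3]
    · simp only
      omega

/-- On a long diagonal, the first `k` boxes belong to the shape. -/
theorem IsLong.mem {lam : YoungDiagram} {k : ℕ} {d : ℤ} (h : IsLong lam k d) {x : Box}
    (hx : content x = d) (hk : x.1 ≤ k ∨ x.2 ≤ k) : x ∈ lam.cells := by
  obtain ⟨y, h1, h2, h3, h4⟩ := isLong_iff.1 h
  simp only [content] at hx h4
  exact mem_cells_of_le h1 (by omega) (by omega)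

/-- The boxes in the first `k` rows or the first `k` columns. -/
def hook (lam : YoungDiagram) (k : ℕ) : Finset Box :=
  lam.cells.filter fun x => x.1 < k ∨ x.2 < k

theorem avoidsSE_hook (lam : YoungDiagram) (k : ℕ) : AvoidsSE lam k (hook lam k) := by
  refine ⟨Finset.filter_subset _ _, ?_⟩
  rintro ⟨c, hc, h⟩
  have key : ∀ a : ℕ, ∀ h : a < k + 1, a ≤ (c ⟨a, h⟩).1 ∧ a ≤ (c ⟨a, h⟩).2 := by
    intro a
    induction a with
    | zero => intros; omega
    | succ a ih =>
      intro ha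
      have h1 := ih (by omega)
      have h2 := hc.1 ⟨a, by omega⟩ ⟨a + 1, ha⟩ (Nat.lt_succ_self a)
      omega
  have h1 := (Finset.mem_filter.1 (h ⟨k, Nat.lt_succ_self k⟩)).2
  have h2 := key k (Nat.lt_succ_self k)
  omega

theorem diagRows_hook_of_not_isLong {lam : YoungDiagram} {k : ℕ} {d : ℤ} (h : ¬ IsLong lam k d) :
    diagRows (hook lam k) d = diagRows lam.cells d := by
  refine (diagRows_subset (Finset.filter_subset _ _) d).antisymm fun i hi => ?_
  obtain ⟨j, h1, h2⟩ := mem_diagRows.1 hi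
  refine mem_diagRows.2 ⟨j, Finset.mem_filter.2 ⟨h1, ?_⟩, h2⟩
  by_contra h3
  push Not at h3
  exact h (isLong_iff.2 ⟨_, h1, h3.1, h3.2, h2⟩)

theorem IsLong.le_card_diagRows_hook {lam : YoungDiagram} {k : ℕ} {d : ℤ} (h : IsLong lam k d) :
    k ≤ (diagRows (hook lam k) d).card := by
  have h1 : ((Finset.range k).image fun t => t + (-d).toNat).card = k := by
    rw [Finset.card_image_of_injective _ (fun a b h => by simpa using h), Finset.card_range]
  refine h1.symm.le.trans (Finset.card_le_card fun i hi => ?_)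
  obtain ⟨t, ht, rfl⟩ := Finset.mem_image.1 hi
  rw [Finset.mem_range] at ht
  refine mem_diagRows.2 ⟨t + d.toNat, Finset.mem_filter.2 ⟨h.mem ?_ ?_, ?_⟩, ?_⟩
  · simp only [content]
    omega
  all_goals omega

/-- The boxes of the short diagonals are those in no chain of length `k + 1`. -/
theorem mem_passiveBoxes {lam : YoungDiagram} {k : ℕ} {x : Box} :
    x ∈ passiveBoxes lam k ↔ x ∈ lam.cells ∧ ¬ IsLong lam k (content x) := by
  classical
  rw [passiveBoxes, Finset.mem_filter, and_congr_right_iff]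
  intro hx
  rw [not_iff_not]
  constructor
  · rintro ⟨c, hc, a, rfl⟩
    have h1 : ∀ m : ℕ, ∀ h : m < k + 1, m ≤ (c ⟨m, h⟩).1 ∧ m ≤ (c ⟨m, h⟩).2 ∧
        (a ≤ m → (c a).1 + (m - a) ≤ (c ⟨m, h⟩).1 ∧ (c a).2 + (m - a) ≤ (c ⟨m, h⟩).2) := by
      intro m
      induction m with
      | zero =>
        intro h
        refine ⟨Nat.zero_le _, Nat.zero_le _, fun ha => ?_⟩
        obtain rfl : a = ⟨0, h⟩ := Fin.ext (by simpa using ha)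
        simp
      | succ m ih =>
        intro hm
        have h1 := ih (by omega)
        have h2 := hc.1 ⟨m, by omega⟩ ⟨m + 1, hm⟩ (Nat.lt_succ_self m)
        refine ⟨by omega, by omega, fun ha => ?_⟩
        rcases ha.lt_or_eq with h3 | h3
        · have h4 := h1.2.2 (by omega)
          omega
        · obtain rfl : a = ⟨m + 1, hm⟩ := Fin.ext h3
          simp
    obtain ⟨h2, h3, h4⟩ := h1 k (Nat.lt_succ_self k)
    have ha : (a : ℕ) ≤ k := Nat.lt_succ_iff.1 a.2
    obtain ⟨h5, h6, -⟩ := h1 a a.2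
    have h7 := h4 ha
    simp only [Fin.eta] at h5 h6
    refine isLong_iff.2 ⟨((c a).1 + (k - a), (c a).2 + (k - a)),
      mem_cells_of_le (hc.2.1 _) h7.1 h7.2, ?_, ?_, ?_⟩
    · simp only
      omega
    · simp only
      omega
    · simp only [content]
      omega
  · intro h
    -- the first `k` boxes, the next one, and `x`, are all on the same diagonal
    have h1 : k + 1 ≤ (lam.cells.filter fun y => content y = content x).card := by
      rw [← card_diagRows]
      have h2 : ((Finset.range (k + 1)).image fun t => t + (-content x).toNat).card = k + 1 := by
        rw [Finset.card_image_of_injective _ (fun a b h => by simpa using h), Finset.card_range]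
      refine h2.symm.le.trans (Finset.card_le_card fun i hi => ?_)
      obtain ⟨t, ht, rfl⟩ := Finset.mem_image.1 hi
      rw [Finset.mem_range] at ht
      refine mem_diagRows.2 ⟨t + (content x).toNat, h.mem ?_ ?_, ?_⟩
      · generalize content x = d
        simp only [content]
        omega
      all_goals omega
    obtain ⟨S, h2, h3, h4⟩ := Finset.exists_subsuperset_card_eq (s := {x})
      (t := lam.cells.filter fun y => content y = content x) (n := k + 1)
      (by simpa using hx) (by simp) h1
    obtain ⟨c, h5, h6, h7⟩ := exists_isSE h4 fun y hy z hz => by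
      have h8 := (Finset.mem_filter.1 (h3 hy)).2
      have h9 := (Finset.mem_filter.1 (h3 hz)).2
      simp only [content] at h8 h9
      rcases lt_trichotomy y.1 z.1 with h | h | h
      · omega
      · exact Or.inl (Prod.ext h (by omega))
      · omega
    exact ⟨c, isSEChain_iff.2 ⟨h5, fun a => (Finset.mem_filter.1 (h3 (h6 a))).1⟩,
      h7 x (h2 (Finset.mem_singleton_self x))⟩

theorem AvoidsSE.card_diagRows_le_hook {lam : YoungDiagram} {k : ℕ} {F : Finset Box}
    (hF : AvoidsSE lam k F) (d : ℤ) :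
    (diagRows F d).card ≤ (diagRows (hook lam k) d).card := by
  by_cases h : IsLong lam k d
  · exact (hF.card_diagRows_le d).trans h.le_card_diagRows_hook
  · rw [diagRows_hook_of_not_isLong h]
    exact Finset.card_le_card (diagRows_subset hF.1 d)

/-- A filling is maximal if and only if it is maximal on every diagonal, because the hook of the
first `k` rows and columns is. -/
theorem mem_seFillings {lam : YoungDiagram} {k : ℕ} {F : Finset Box} :
    F ∈ seFillings lam k ↔ AvoidsSE lam k F ∧ passiveBoxes lam k ⊆ F ∧
      ∀ d, IsLong lam k d → (diagRows F d).card = k := by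
  constructor
  · rintro ⟨hF, hmax⟩
    have h1 := hmax _ (avoidsSE_hook lam k)
    rw [card_eq_sum_diagRows (avoidsSE_hook lam k).1, card_eq_sum_diagRows hF.1] at h1
    have h2 := (Finset.sum_eq_sum_iff_of_le fun d _ => hF.card_diagRows_le_hook d).1
      ((Finset.sum_le_sum fun d _ => hF.card_diagRows_le_hook d).antisymm h1)
    refine ⟨hF, fun x hx => ?_, fun d hd => ?_⟩
    · rw [mem_passiveBoxes] at hx
      have h3 := h2 _ (Finset.mem_image_of_mem _ hx.1)
      rw [diagRows_hook_of_not_isLong hx.2] at h3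
      rw [← mem_diagRows_content, Finset.eq_of_subset_of_card_le (diagRows_subset hF.1 _) h3.ge]
      exact mem_diagRows_content.2 hx.1
    · obtain ⟨x, hx, -, -, rfl⟩ := isLong_iff.1 hd
      refine (hF.card_diagRows_le _).antisymm ?_
      rw [h2 _ (Finset.mem_image_of_mem _ hx)]
      exact hd.le_card_diagRows_hook
  · rintro ⟨hF, hp, hd⟩
    refine ⟨hF, fun G hG => ?_⟩
    rw [card_eq_sum_diagRows hG.1, card_eq_sum_diagRows hF.1]
    refine Finset.sum_le_sum fun d _ => ?_
    by_cases h : IsLong lam k d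
    · rw [hd d h]
      exact hG.card_diagRows_le d
    · refine Finset.card_le_card fun i hi => ?_
      obtain ⟨j, h1, rfl⟩ := mem_diagRows.1 hi
      exact mem_diagRows.2 ⟨j, hp (mem_passiveBoxes.2 ⟨hG.1 h1, h⟩), rfl⟩

/-! ### Fans and south-east fillings -/

/-- The box of a lattice point `u` of the path number `i` in a fan of `k` paths. -/
abbrev shiftBox (k i : ℕ) (u : ℕ × ℕ) : Box := (u.1 + (k - 1 - i), u.2 + (k - 1 - i))

theorem content_shiftBox (k i : ℕ) (u : ℕ × ℕ) : content (shiftBox k i u) = content u := by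
  simp only [content]
  omega

theorem mem_fillingOfFan {lam : YoungDiagram} {k : ℕ} {f : Fin k → List (ℕ × ℕ)} {x : Box} :
    x ∈ fillingOfFan lam k f ↔ x ∈ passiveBoxes lam k ∨
      x ∈ lam.cells ∧ ∃ i : Fin k, ∃ u ∈ f i, x = shiftBox k i u := by
  rw [fillingOfFan, Finset.mem_union, Finset.mem_filter]

theorem IsPathInside.shiftBox_mem {lam : YoungDiagram} {k : ℕ} {p : List (ℕ × ℕ)}
    (hp : IsPathInside (removeHook lam k) p) {u : ℕ × ℕ} (hu : u ∈ p)
    (hd : IsLong lam k (content u)) {i : ℕ} (hi : i < k) : shiftBox k i u ∈ lam.cells := by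
  by_cases h : u.1 = 0 ∨ u.2 = 0
  · exact hd.mem (content_shiftBox k i u) (by simp only; omega)
  · obtain ⟨r, c⟩ := u
    simp only at h
    have h1 := hp.2.2.2 (r - 1) (c - 1) (by
      rwa [Nat.sub_add_cancel (by omega), Nat.sub_add_cancel (by omega)])
    exact mem_cells_of_le (mem_removeHook.1 h1) (by simp only; omega)
      (by simp only; omega)

/-- The position on all the paths of the points on a long diagonal. -/
theorem IsLong.exists_position {lam : YoungDiagram} {k : ℕ} {d : ℤ} (h : IsLong lam k d) :
    ∃ s : ℕ, (s : ℤ) = d + (removeHook lam k).colLen 0 ∧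
      s < (removeHook lam k).colLen 0 + (removeHook lam k).rowLen 0 + 1 := by
  obtain ⟨⟨i, j⟩, h1, rfl⟩ := h
  have h2 : (i, j) ∈ removeHook lam k := h1
  have h3 := h2
  rw [YoungDiagram.mem_iff_lt_colLen] at h2
  rw [YoungDiagram.mem_iff_lt_rowLen] at h3
  have h4 := (removeHook lam k).colLen_anti 0 j (Nat.zero_le _)
  have h5 := (removeHook lam k).rowLen_anti 0 i (Nat.zero_le _)
  refine ⟨(removeHook lam k).colLen 0 + j - i, ?_, ?_⟩
  · simp only [content]
    omega
  · omega

theorem IsPathInside.content_getElem {μ : YoungDiagram} {p : List (ℕ × ℕ)} (hp : IsPathInside μ p)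
    {s : ℕ} (hs : s < p.length) {d : ℤ} : content p[s] = d ↔ (s : ℤ) = d + μ.colLen 0 := by
  have := hp.diagonal hs
  simp only [content]
  omega

section

variable {lam : YoungDiagram} {k : ℕ} {f : Fin k → List (ℕ × ℕ)}
  (hf : f ∈ fans (removeHook lam k) k)

include hf

/-- The boxes of the different paths on the same diagonal are different. -/
theorem strictAnti_of_mem_fans {s : ℕ}
    (hs : s < (removeHook lam k).colLen 0 + (removeHook lam k).rowLen 0 + 1) :
    StrictAnti fun i : Fin k => ((f i)[s]'((hf.1 i).length ▸ hs)).1 + (k - 1 - i) := by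
  intro i j hij
  have h1 := (List.forall₂_iff_get.1 (hf.2 i j hij)).2 s ((hf.1 i).length ▸ hs)
    ((hf.1 j).length ▸ hs)
  simp only [List.get_eq_getElem] at h1
  have h2 : (i : ℕ) < j := hij
  have h3 := j.2
  simp only
  omega

theorem coe_diagRows_fillingOfFan {d : ℤ} (hd : IsLong lam k d) {s : ℕ}
    (hs : s < (removeHook lam k).colLen 0 + (removeHook lam k).rowLen 0 + 1)
    (hsd : (s : ℤ) = d + (removeHook lam k).colLen 0) :
    (diagRows (fillingOfFan lam k f) d : Set ℕ) =
      Set.range fun i : Fin k => ((f i)[s]'((hf.1 i).length ▸ hs)).1 + (k - 1 - i) := by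
  ext r
  rw [Finset.mem_coe, Set.mem_range]
  constructor
  · intro hr
    obtain ⟨c, h1, h2⟩ := mem_diagRows.1 hr
    rw [mem_fillingOfFan] at h1
    rcases h1 with h1 | ⟨-, i, u, hu, h1⟩
    · have h3 : content (r, c) = d := h2
      exact absurd (h3.symm ▸ hd) (mem_passiveBoxes.1 h1).2
    · obtain ⟨t, ht, rfl⟩ := List.getElem_of_mem hu
      have h3 : content (f i)[t] = d := by
        rw [← content_shiftBox k i, ← h1]
        exact h2
      rw [(hf.1 i).content_getElem] at h3
      obtain rfl : t = s := by omega
      exact ⟨i, (congrArg Prod.fst h1).symm⟩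
  · rintro ⟨i, rfl⟩
    have hs' : s < (f i).length := (hf.1 i).length ▸ hs
    have h1 : content (f i)[s] = d := ((hf.1 i).content_getElem hs').2 hsd
    have h2 := (hf.1 i).shiftBox_mem (List.getElem_mem hs') (h1.symm ▸ hd) i.2
    have h3 : shiftBox k i (f i)[s] ∈ fillingOfFan lam k f :=
      mem_fillingOfFan.2 (Or.inr ⟨h2, i, _, List.getElem_mem hs', rfl⟩)
    rw [← mem_diagRows_content, content_shiftBox, h1] at h3
    exact h3

/-- The boxes of a path form an antichain, and on every long diagonal the `k` paths have one box
each. -/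
theorem fillingOfFan_mem_seFillings : fillingOfFan lam k f ∈ seFillings lam k := by
  have hsub : fillingOfFan lam k f ⊆ lam.cells := fun x hx => by
    rcases mem_fillingOfFan.1 hx with h | h
    · exact (mem_passiveBoxes.1 h).1
    · exact h.1
  refine mem_seFillings.2 ⟨⟨hsub, ?_⟩, fun x hx => mem_fillingOfFan.2 (Or.inl hx),
    fun d hd => ?_⟩
  · -- two of the boxes of a chain of length `k + 1` would come from the same path
    rintro ⟨c, hc, h⟩
    have h1 : ∀ a, ∃ i : Fin k, ∃ u ∈ f i, c a = shiftBox k i u := by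
      intro a
      rcases mem_fillingOfFan.1 (h a) with h1 | h1
      · classical
        rw [passiveBoxes, Finset.mem_filter] at h1
        exact absurd ⟨c, hc, a, rfl⟩ h1.2
      · exact h1.2
    choose i u hu hcu using h1
    obtain ⟨a, b, hab, hi⟩ := Fintype.exists_ne_map_eq_of_card_lt i (by simp)
    have key : ∀ a b, a < b → i a ≠ i b := by
      intro a b hab hi
      have h2 := hc.1 a b hab
      have h3 := hu a
      rw [hcu a, hcu b, hi] at h2
      rw [hi] at h3
      have h4 := (onBoundary_nwRegion (hf.1 (i b)).2.2.1 h3).1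
      rw [← Bool.not_eq_true, nwRegion_eq_true] at h4
      simp only at h2
      exact h4 ⟨u b, hu b, by omega, by omega⟩
    rcases lt_or_gt_of_ne hab with h2 | h2
    · exact key a b h2 hi
    · exact key b a h2 hi.symm
  · obtain ⟨s, h1, h2⟩ := hd.exists_position
    have h3 := coe_diagRows_fillingOfFan hf hd h2 h1
    rw [← Set.ncard_coe_finset, h3, ← Set.image_univ,
      Set.ncard_image_of_injective _ (strictAnti_of_mem_fans hf h2).injective, Set.ncard_univ,
      Nat.card_eq_fintype_card, Fintype.card_fin]

end

/-- All points of a path but its end points are on long diagonals. -/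
theorem isLong_of_position {lam : YoungDiagram} {k s : ℕ} (h0 : 0 < s)
    (hs : s < (removeHook lam k).colLen 0 + (removeHook lam k).rowLen 0) :
    IsLong lam k ((s : ℤ) - (removeHook lam k).colLen 0) := by
  rcases Nat.lt_or_ge s ((removeHook lam k).colLen 0) with h | h
  · refine ⟨((removeHook lam k).colLen 0 - s, 0), ?_, ?_⟩
    · rw [YoungDiagram.mem_cells, YoungDiagram.mem_iff_lt_colLen]
      omega
    · simp only [content]
      omega
  · refine ⟨(0, s - (removeHook lam k).colLen 0), ?_, ?_⟩
    · rw [YoungDiagram.mem_cells, YoungDiagram.mem_iff_lt_rowLen]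
      omega
    · simp only [content]
      omega

/-- On each long diagonal, the points of the paths are determined by the set of their boxes, since
the boxes of different paths come in a fixed order. -/
theorem injOn_fillingOfFan (lam : YoungDiagram) (k : ℕ) :
    Set.InjOn (fillingOfFan lam k) (fans (removeHook lam k) k) := by
  intro f hf g hg h
  funext i
  refine List.ext_getElem ((hf.1 i).length.trans (hg.1 i).length.symm) fun s hs hs' => ?_
  have h1 := (hf.1 i).diagonal hs
  have h2 := (hg.1 i).diagonal hs'
  suffices h3 : (f i)[s].1 = (g i)[s].1 from Prod.ext h3 (by omega)
  have hlen := hs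
  rw [(hf.1 i).length] at hlen
  rcases Nat.eq_zero_or_pos s with rfl | h0
  · rw [(hf.1 i).getElem_zero, (hg.1 i).getElem_zero]
  rcases (Nat.lt_succ_iff.1 hlen).eq_or_lt with h3 | h3
  · have h4 := (hf.1 i).2.1
    have h5 := (hg.1 i).2.1
    rw [List.getLast?_eq_getElem?, (hf.1 i).length, Nat.add_sub_cancel, ← h3,
      List.getElem?_eq_getElem hs] at h4
    rw [List.getLast?_eq_getElem?, (hg.1 i).length, Nat.add_sub_cancel, ← h3,
      List.getElem?_eq_getElem hs'] at h5
    rw [Option.some.inj h4, Option.some.inj h5]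
  · have hd := isLong_of_position h0 h3
    have h4 := coe_diagRows_fillingOfFan hf hd hlen (by omega)
    rw [h, coe_diagRows_fillingOfFan hg hd hlen (by omega),
      (strictAnti_of_mem_fans hg hlen).range_inj (strictAnti_of_mem_fans hf hlen)] at h4
    have h5 := congrFun h4 i
    omega

theorem diagRows_filter (F : Finset Box) (d : ℤ) (p : ℕ → Prop) [DecidablePred p] :
    diagRows (F.filter fun x => p x.1) d = (diagRows F d).filter p := by
  ext i
  rw [Finset.mem_filter, mem_diagRows, mem_diagRows]
  constructor
  · rintro ⟨j, h1, h2⟩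
    obtain ⟨h3, h4⟩ := Finset.mem_filter.1 h1
    exact ⟨⟨j, h3, h2⟩, h4⟩
  · rintro ⟨⟨j, h1, h2⟩, h3⟩
    exact ⟨j, Finset.mem_filter.2 ⟨h1, h3⟩, h2⟩

/-- The boxes of `μ` to the north-west of the path of a filling `F` that corresponds to the boxes
with exactly `a` boxes of `F` to their north-west on the same diagonal: moving `x` by `a` to the
south-east, there are still at most `a` boxes of `F` up to this point. -/
def fillingRegion (μ : YoungDiagram) (F : Finset Box) (a : ℕ) (x : Box) : Bool :=
  decide (x ∈ μ.cells ∧ ((diagRows F (content x)).filter (· ≤ x.1 + a)).card ≤ a)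

theorem fillingRegion_eq_true {μ : YoungDiagram} {F : Finset Box} {a : ℕ} {x : Box} :
    fillingRegion μ F a x = true ↔
      x ∈ μ.cells ∧ ((diagRows F (content x)).filter (· ≤ x.1 + a)).card ≤ a := by
  simp [fillingRegion]

/-- If `y` belongs to the region and `x`, to the north-west of `y`, does not, then `a + 1` boxes on
the diagonal of `x` and `k - a` boxes on the diagonal of `y` form a chain. -/
theorem isSubshape_fillingRegion {lam : YoungDiagram} {k : ℕ} {F : Finset Box}
    (hF : F ∈ seFillings lam k) (a : ℕ) :
    IsSubshape (removeHook lam k) (fillingRegion (removeHook lam k) F a) := by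
  obtain ⟨hF, -, hd⟩ := mem_seFillings.1 hF
  refine ⟨fun h => (fillingRegion_eq_true.1 h).1, fun {x y} h1 h2 h => ?_⟩
  rw [fillingRegion_eq_true] at h ⊢
  have hx := mem_cells_of_le h.1 h1 h2
  refine ⟨hx, ?_⟩
  by_contra hlt
  have hy := Finset.card_filter_add_card_filter_not (s := diagRows F (content y)) (· ≤ y.1 + a)
  rw [hd _ ⟨y, h.1, rfl⟩, ← diagRows_filter, ← diagRows_filter, card_diagRows, card_diagRows] at hy
  have h' := h.2
  rw [← diagRows_filter, card_diagRows] at hlt h'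
  set A := (F.filter fun z => z.1 ≤ x.1 + a).filter fun z => content z = content x with hA
  set B := (F.filter fun z => ¬ z.1 ≤ y.1 + a).filter fun z => content z = content y with hB
  have hmA : ∀ z ∈ A, z ∈ F ∧ z.1 ≤ x.1 + a ∧ content z = content x := fun z hz => by
    simpa [hA, and_assoc] using hz
  have hmB : ∀ z ∈ B, z ∈ F ∧ y.1 + a < z.1 ∧ content z = content y := fun z hz => by
    simpa [hB, and_assoc] using hz
  simp only [content] at hmA hmB
  have hdisj : Disjoint A B := Finset.disjoint_left.2 fun z hz hz' => by
    have := hmA z hz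
    have := hmB z hz'
    omega
  have key := hF.card_le (S := A ∪ B) (Finset.union_subset (fun z hz => (hmA z hz).1)
      fun z hz => (hmB z hz).1) fun u hu v hv => by
    by_cases huv : u = v
    · exact Or.inl huv
    have huv' : u.1 ≠ v.1 ∨ u.2 ≠ v.2 := by
      by_contra hc
      push Not at hc
      exact huv (Prod.ext hc.1 hc.2)
    right
    rcases Finset.mem_union.1 hu with hu | hu <;> rcases Finset.mem_union.1 hv with hv | hv
    · have := hmA u hu
      have := hmA v hv
      omega
    · have := hmA u hu
      have := hmB v hv
      omega
    · have := hmB u hu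
      have := hmA v hv
      omega
    · have := hmB u hu
      have := hmB v hv
      omega
  rw [Finset.card_union_of_disjoint hdisj] at key
  omega

/-- The regions are nested, with the bottom path having the largest one. -/
theorem fillingRegion_mono {μ : YoungDiagram} {F : Finset Box} {a b : ℕ} (hab : a ≤ b) {x : Box}
    (h : fillingRegion μ F a x = true) : fillingRegion μ F b x = true := by
  rw [fillingRegion_eq_true] at h ⊢
  refine ⟨h.1, ?_⟩
  have h1 : (diagRows F (content x)).filter (· ≤ x.1 + b) ⊆
      (diagRows F (content x)).filter (· ≤ x.1 + a) ∪ Finset.Ioc (x.1 + a) (x.1 + b) := by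
    intro i hi
    rw [Finset.mem_union, Finset.mem_filter, Finset.mem_Ioc]
    rw [Finset.mem_filter] at hi
    by_cases h2 : i ≤ x.1 + a
    · exact Or.inl ⟨hi.1, h2⟩
    · exact Or.inr ⟨by omega, hi.2⟩
  have h2 := (Finset.card_le_card h1).trans (Finset.card_union_le _ _)
  rw [Nat.card_Ioc] at h2
  omega

/-- Up to the box in question there are more than `a = k - 1 - i` boxes of `F` on the diagonal,
strictly before it there are at most `a`. -/
theorem shiftBox_mem_of_onBoundary {lam : YoungDiagram} {k : ℕ} {F : Finset Box}
    (hF : F ∈ seFillings lam k) {i : ℕ} (hi : i < k) {u : ℕ × ℕ}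
    (hu : OnBoundary (fillingRegion (removeHook lam k) F (k - 1 - i)) u)
    (hd : IsLong lam k (content u)) : shiftBox k i u ∈ F := by
  obtain ⟨hF, -, hk⟩ := mem_seFillings.1 hF
  have hcard := hk _ hd
  have mem : ∀ z ∈ diagRows F (content u), ∃ c : ℕ, (z, c) ∈ lam.cells ∧
      (c : ℤ) - z = (u.2 : ℤ) - u.1 := fun z hz => by
    obtain ⟨c, h1, h2⟩ := mem_diagRows.1 hz
    exact ⟨c, hF.1 h1, h2⟩
  rw [← mem_diagRows_content, content_shiftBox]
  simp only
  set a := k - 1 - i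
  set D := diagRows F (content u) with hD
  have h1 : a + 1 ≤ (D.filter (· ≤ u.1 + a)).card := by
    by_cases h : u ∈ (removeHook lam k).cells
    · have h1 := hu.1
      rw [← Bool.not_eq_true, fillingRegion_eq_true, ← hD] at h1
      by_contra h2
      exact h1 ⟨h, by omega⟩
    · have h1 : (D.filter fun z => ¬ z ≤ u.1 + a) ⊆ Finset.Ioo (u.1 + a) (u.1 + k) := by
        intro z hz
        obtain ⟨hz, h1⟩ := Finset.mem_filter.1 hz
        rw [Finset.mem_Ioo]
        refine ⟨by omega, ?_⟩
        by_contra h2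
        obtain ⟨c, h3, h4⟩ := mem z hz
        exact h (mem_removeHook.2 (mem_cells_of_le h3 (by simp only; omega) (by simp only; omega)))
      have h2 := Finset.card_le_card h1
      have h3 := Finset.card_filter_add_card_filter_not (s := D) (· ≤ u.1 + a)
      rw [Nat.card_Ioo] at h2
      omega
  have h2 : (D.filter (· < u.1 + a)).card ≤ a := by
    by_cases h0 : u.1 = 0 ∨ u.2 = 0
    · have h2 : D.filter (· < u.1 + a) ⊆ Finset.Ico u.1 (u.1 + a) := by
        intro z hz
        obtain ⟨hz, h1⟩ := Finset.mem_filter.1 hz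
        obtain ⟨c, -, h4⟩ := mem z hz
        rw [Finset.mem_Ico]
        omega
      have h3 := Finset.card_le_card h2
      rw [Nat.card_Ico] at h3
      omega
    · rcases hu.2 with h | h | h
      · omega
      · omega
      · have h3 := (fillingRegion_eq_true.1 h).2
        have h4 : content (u.1 - 1, u.2 - 1) = content u := by
          simp only [content]
          omega
        rw [h4] at h3
        refine (Finset.card_le_card fun z hz => ?_).trans h3
        rw [Finset.mem_filter] at hz ⊢
        exact ⟨hz.1, by simp only; omega⟩
  obtain ⟨z, hz, hz'⟩ := Finset.exists_mem_notMem_of_card_lt_card (show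
    (D.filter (· < u.1 + a)).card < (D.filter (· ≤ u.1 + a)).card by omega)
  rw [Finset.mem_filter] at hz hz'
  obtain rfl : z = u.1 + a := by
    by_contra h
    exact hz' ⟨hz.1, by omega⟩
  exact hz.1

theorem bijOn_fillingOfFan (lam : YoungDiagram) (k : ℕ) :
    Set.BijOn (fillingOfFan lam k) (fans (removeHook lam k) k) (seFillings lam k) := by
  refine ⟨fun f hf => fillingOfFan_mem_seFillings hf, injOn_fillingOfFan lam k, fun F hF => ?_⟩
  have hsub : ∀ i : Fin k, IsSubshape (removeHook lam k)
      (fillingRegion (removeHook lam k) F (k - 1 - i)) := fun i =>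
    isSubshape_fillingRegion hF _
  have hf : (fun i : Fin k => fullWalk (removeHook lam k)
      (fillingRegion (removeHook lam k) F (k - 1 - i))) ∈ fans (removeHook lam k) k := by
    refine ⟨fun i => (hsub i).isPathInside, fun i j hij => ?_⟩
    rw [(hsub i).isPathInside.forall₂_iff (hsub j).isPathInside, nwRegion_fullWalk (hsub i),
      nwRegion_fullWalk (hsub j)]
    exact fun x => fillingRegion_mono (by have : (i : ℕ) < j := hij; omega)
  refine ⟨_, hf, Finset.eq_of_subset_of_card_le (fun x hx => ?_)
    ((fillingOfFan_mem_seFillings hf).2 F hF.1)⟩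
  by_cases hp : x ∈ passiveBoxes lam k
  · exact (mem_seFillings.1 hF).2.1 hp
  · rcases mem_fillingOfFan.1 hx with h | ⟨h, i, u, hu, rfl⟩
    · exact absurd h hp
    · refine shiftBox_mem_of_onBoundary hF i.2
        ((hsub i).onBoundary (hsub i).onBoundary_start u hu) ?_
      by_contra hd
      exact hp (mem_passiveBoxes.2 ⟨h, by rwa [content_shiftBox]⟩)


/-! ### The composition of the bijections -/

theorem removeHook_subset {lam : YoungDiagram} (k : ℕ) {n : ℕ} (hn : lam.cells ⊆ staircase n) :
    (removeHook lam k).cells ⊆ staircase n := by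
  rintro ⟨i, j⟩ h
  exact hn (mem_cells_of_le (mem_removeHook.1 h) (Nat.le_add_right _ _) (Nat.le_add_right _ _))

theorem flaggedTableaux_nonempty (μ : YoungDiagram) (k : ℕ) : (flaggedTableaux μ k).Nonempty :=
  ⟨_, SemistandardYoungTableau.highestWeight μ, fun x _ => by
    rw [SemistandardYoungTableau.highestWeight_apply]
    split_ifs <;> omega, rfl⟩

end Fillings

theorem theorem2 (lam : YoungDiagram) (k : ℕ) (hk : 0 < k)
    (n : ℕ) (hn : lam.cells ⊆ Fillings.staircase n) :
    (∃! τ : Equiv.Perm ℕ, Fillings.IsDominantOf n (Fillings.removeHook lam k) τ) ∧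
    (∀ τ : Equiv.Perm ℕ, Fillings.IsDominantOf n (Fillings.removeHook lam k) τ →
      Set.BijOn (Fillings.complementary lam)
        (Fillings.neFillings lam k)
        (Fillings.reducedPipeDreams n (Fillings.shiftPerm k τ)) ∧
      Set.BijOn (Fillings.readingBiword n)
        (Fillings.reducedPipeDreams n (Fillings.shiftPerm k τ))
        (Fillings.compatibleSequences (Fillings.shiftPerm k τ)) ∧
      Set.BijOn Fillings.recordingTableau
        (Fillings.compatibleSequences (Fillings.shiftPerm k τ))
        (Fillings.flaggedTableaux (Fillings.removeHook lam k) k)) ∧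
    Set.BijOn Fillings.subtractRows
      (Fillings.flaggedTableaux (Fillings.removeHook lam k) k)
      (Fillings.reversePlanePartitions (Fillings.removeHook lam k) k) ∧
    Set.BijOn (Fillings.fanOfRPP (Fillings.removeHook lam k) k)
      (Fillings.reversePlanePartitions (Fillings.removeHook lam k) k)
      (Fillings.fans (Fillings.removeHook lam k) k) ∧
    Set.BijOn (Fillings.fillingOfFan lam k)
      (Fillings.fans (Fillings.removeHook lam k) k)
      (Fillings.seFillings lam k) ∧
    Set.BijOn (Fillings.neToSe n lam k)
      (Fillings.neFillings lam k)
      (Fillings.seFillings lam k) := by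

  have hμ := Fillings.removeHook_subset k hn
  have hτ := fun τ => Fillings.isDominantOf_iff (τ := τ) hμ
  have h123 : ∀ τ : Equiv.Perm ℕ, Fillings.IsDominantOf n (Fillings.removeHook lam k) τ →
      Set.BijOn (Fillings.complementary lam)
        (Fillings.neFillings lam k)
        (Fillings.reducedPipeDreams n (Fillings.shiftPerm k τ)) ∧
      Set.BijOn (Fillings.readingBiword n)
        (Fillings.reducedPipeDreams n (Fillings.shiftPerm k τ))
        (Fillings.compatibleSequences (Fillings.shiftPerm k τ)) ∧
      Set.BijOn Fillings.recordingTableau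
        (Fillings.compatibleSequences (Fillings.shiftPerm k τ))
        (Fillings.flaggedTableaux (Fillings.removeHook lam k) k) := by
    intro τ h
    obtain rfl := (hτ τ).1 h
    have hσ := fun i j => Fillings.mem_rotheDiagram_shiftPerm_dominantPerm
      (μ := Fillings.removeHook lam k) (k := k) (i := i) (j := j)
    have h3 := Fillings.bijOn_recordingTableau (Fillings.removeHook lam k) k
    have h2 := Fillings.bijOn_readingBiword (n := n)
      (σ := Fillings.shiftPerm k (Fillings.dominantPerm (Fillings.removeHook lam k))) (by
        rintro ⟨i, j⟩ hx
        obtain ⟨hi, hj, hx⟩ := (hσ i j).1 hx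
        have hx' := Fillings.mem_removeHook.1 hx
        rw [Nat.sub_add_cancel hi, Nat.sub_add_cancel hj] at hx'
        exact hn hx')
    refine ⟨Fillings.bijOn_complementary hn hσ ?_, h2, h3⟩
    -- there is a flagged tableau, hence a compatible sequence, hence a reduced pipe dream
    obtain ⟨T, hT⟩ := Fillings.flaggedTableaux_nonempty (Fillings.removeHook lam k) k
    obtain ⟨t, ht, -⟩ := h3.surjOn hT
    obtain ⟨D, hD, -⟩ := h2.surjOn ht
    exact ⟨D, hD⟩
  have h4 := Fillings.bijOn_subtractRows (Fillings.removeHook lam k) k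
  have h5 := Fillings.bijOn_fanOfRPP (Fillings.removeHook lam k) k
  have h6 := Fillings.bijOn_fillingOfFan lam k
  refine ⟨⟨_, (hτ _).2 rfl, fun τ h => (hτ τ).1 h⟩, h123, h4, h5, h6, ?_⟩
  obtain ⟨h1, h2, h3⟩ := h123 _ ((hτ _).2 rfl)
  exact h6.comp (h5.comp (h4.comp (h3.comp (h2.comp h1))))
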